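/- Let $n\ge 1$ and let $h_0$ be the standard metric on $S^n$. Let $(M^{n+1},g)$ be a smooth Riemannian manifold without boundary with an asymptotically hyperbolic end: there are $R>0$ and an open subset of $M$ diffeomorphic to $(R,\infty)\times S^n$, with radial coordinate $r\in(R,\infty)$, such that $\{r\ge R'\}$ is closed in $M$ for every $R'>R$, and such that in terms of $t=\operatorname{arsinh}(1/r)\in(0,T)$, $T=\operatorname{arsinh}(1/R)$, $$g=\sinh^{-2}(t)\,\bigl(dt^2+h(t,\cdot)\bigr),\qquad h(t,\cdot)=h_0+t^{n+1}k+O(t^{n+2})\quad (t\to0),$$ where $h(t,\cdot)$ is a family of metrics on $S^n$ depending smoothly on $t\in[0,T)$ and $k$ is a symmetric $2$-tensor on $S^n$. (This holds in particular for every asymptotically hyperbolic manifold, i.e. every conformally compact $(M,g)$ with smooth conformal compactification, conformal boundary $S^n$ and $g$ of the above form near the boundary.) Suppose that the scalar curvature of $g$ satisfies $S[g]\ge -n(n+1)$ on $M$ and that the mass aspect function $\mu=\operatorname{tr}_{h_0}k$ is negative at every point of $S^n$. Put $$\lambda=\left(\frac{\max_{S^n}|\mu|}{\min_{S^n}|\mu|}\right)^{\frac1{n+1}}\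 \ge 1 .$$ Then there is $R_0\ge R$ such that for every $R_1>R_0$ there exist $a\in(0,1)$ and a smooth Riemannian metric $\hat g$ on $M$ with 1. $\hat g=g$ on $M\setminus\{r>R_1\}$ (in particular for $R< r\le R_1$); 2. $\hat g=g_a:=\dfrac{1}{1+r^2/a}\,dr^2+r^2h_0$ on $\{r\ge 9\lambda R_1\}$; 3. $S[\hat g]\ge -\dfrac{n(n+1)}{a}$ on $M$. -/

import Mathlib

open Set Filter Topology
open scoped Manifold ContDiff

noncomputable section

/-- The model space `ℝ^m` with its Euclidean inner product. -/
abbrev Eucl (m : ℕ) : Type := EuclideanSpace ℝ (Fin m)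

/-! ### Riemannian metrics and scalar curvature -/

/-- Smooth Riemannian metrics on an `m`-dimensional manifold `M` without boundary. -/
abbrev SmoothMetric (m : ℕ) (M : Type*) [TopologicalSpace M] [ChartedSpace (Eucl m) M]
    [IsManifold (𝓡 m) ∞ M] : Type _ :=
  Bundle.ContMDiffRiemannianMetric (𝓡 m) ∞ (Eucl m) (fun p : M => TangentSpace (𝓡 m) p)

/-- The partial derivative `∂ᵢ f` at `x` of a function on `ℝ^m`. -/
def partialD {m : ℕ} (i : Fin m) (f : Eucl m → ℝ) (x : Eucl m) : ℝ :=
  fderiv ℝ f x (EuclideanSpace.single i 1)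

/-- The Christoffel symbols `Γᵏᵢⱼ = ½ ∑ₗ Gᵏˡ (∂ᵢ Gⱼₗ + ∂ⱼ Gᵢₗ - ∂ₗ Gᵢⱼ)` of a metric `(Gᵢⱼ)` given
in coordinates. -/
def christoffel {m : ℕ} (G : Eucl m → Matrix (Fin m) (Fin m) ℝ) (k i j : Fin m) (x : Eucl m) : ℝ :=
  (1 / 2) * ∑ l, (G x)⁻¹ k l *
    (partialD i (fun y => G y j l) x + partialD j (fun y => G y i l) x
      - partialD l (fun y => G y i j) x)

/-- The Ricci tensor in coordinates,
`Rᵢⱼ = ∑ₖ (∂ₖ Γᵏᵢⱼ - ∂ⱼ Γᵏᵢₖ) + ∑ₖₗ (Γᵏₖₗ Γˡᵢⱼ - Γᵏⱼₗ Γˡᵢₖ)`. -/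
def coordRicci {m : ℕ} (G : Eucl m → Matrix (Fin m) (Fin m) ℝ) (i j : Fin m) (x : Eucl m) : ℝ :=
  ∑ k, (partialD k (christoffel G k i j) x - partialD j (christoffel G k i k) x)
    + ∑ k, ∑ l, (christoffel G k k l x * christoffel G l i j x
        - christoffel G k j l x * christoffel G l i k x)

/-- The scalar curvature in coordinates, `∑ᵢⱼ Gⁱʲ Rᵢⱼ`. -/
def coordScalar {m : ℕ} (G : Eucl m → Matrix (Fin m) (Fin m) ℝ) (x : Eucl m) : ℝ :=
  ∑ i, ∑ j, (G x)⁻¹ i j * coordRicci G i j x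

section Metric

variable {m : ℕ} {M : Type*} [TopologicalSpace M] [ChartedSpace (Eucl m) M]
  [IsManifold (𝓡 m) ∞ M]

/-- The coordinate expression of `g` in a chart `φ`, that is, the pullback of `g` under `φ⁻¹`:
at a point `x` of the target of `φ` it is the bilinear form
`(u, v) ↦ g (dφ⁻¹ u, dφ⁻¹ v)` on `ℝ^m`. -/
def metricInChart (g : SmoothMetric m M) (φ : OpenPartialHomeomorph M (Eucl m))
    (x u v : Eucl m) : ℝ :=
  g.inner (φ.symm x) (mfderiv (𝓡 m) (𝓡 m) φ.symm x u) (mfderiv (𝓡 m) (𝓡 m) φ.symm x v)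

/-- The scalar curvature `S[g]` at `p`, computed in the chart at `p` of the atlas. -/
def scalarCurvature (g : SmoothMetric m M) (p : M) : ℝ :=
  coordScalar (fun x => Matrix.of fun i j =>
    metricInChart g (chartAt (Eucl m) p) x (EuclideanSpace.single i 1) (EuclideanSpace.single j 1))
    (chartAt (Eucl m) p p)

end Metric

/-! ### Polar coordinates and the metrics on the end

The region `{x ∈ ℝ^{n+1} : R < |x|}` is identified with `(R, ∞) × S^n` through `x = r θ`, and with
`(0, T) × S^n`, `sinh T = 1 / R`, through `t = arsinh (1 / r)`. A family of symmetric `2`-tensors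
on `S^n` is a family of bilinear forms on `ℝ^{n+1}`, indexed by `θ ∈ S^n`, of which only the
restriction to `T_θ S^n = θ^⊥` is ever used. The standard metric `h₀` on `S^n` is the restriction
of the Euclidean inner product. -/

section Polar

variable {m : ℕ}

/-- Bilinear forms on `ℝ^m`. -/
abbrev BilForm (m : ℕ) : Type := Eucl m →L[ℝ] Eucl m →L[ℝ] ℝ

/-- The angular coordinate `θ = x / |x|`. -/
def polarTheta (x : Eucl m) : Eucl m := ‖x‖⁻¹ • x

/-- The radial coordinate `t = arsinh (1 / r)`, `r = |x|`. -/
def polarT (x : Eucl m) : ℝ := Real.arsinh (1 / ‖x‖)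

/-- The orthogonal projection of `v` to `θ^⊥`, for a unit vector `θ`. -/
def tangProj (θ v : Eucl m) : Eucl m := v - inner ℝ θ v • θ

/-- The trace with respect to `h₀` of the symmetric `2`-tensor on `S^n` whose value at `θ` is the
restriction of `b` to `θ^⊥`. -/
def sphereTrace (θ : Eucl m) (b : BilForm m) : ℝ :=
  ∑ i, b (tangProj θ (EuclideanSpace.single i 1)) (tangProj θ (EuclideanSpace.single i 1))

/-- The metric `sinh⁻² t (dt² + h(t, ·))` at the point `x = r θ`, `t = arsinh (1 / r)`. -/
def ahForm (h : ℝ → Eucl m → BilForm m) (x u v : Eucl m) : ℝ :=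
  (Real.sinh (polarT x) ^ 2)⁻¹ *
    (fderiv ℝ polarT x u * fderiv ℝ polarT x v
      + h (polarT x) (polarTheta x) (fderiv ℝ polarTheta x u) (fderiv ℝ polarTheta x v))

/-- The metric `g_a = dr² / (1 + r² / a) + r² h₀` at the point `x = r θ`. -/
def gaForm (a : ℝ) (x u v : Eucl m) : ℝ :=
  (1 + ‖x‖ ^ 2 / a)⁻¹ * (fderiv ℝ (fun y : Eucl m => ‖y‖) x u * fderiv ℝ (fun y : Eucl m => ‖y‖) x v)
    + ‖x‖ ^ 2 * inner ℝ (fderiv ℝ polarTheta x u) (fderiv ℝ polarTheta x v)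

end Polar

/-! ### Asymptotically hyperbolic ends -/

/-- An asymptotically hyperbolic end of a Riemannian manifold `(M, g)` of dimension `n + 1`: a
diffeomorphism `φ` of an open subset of `M`, closed towards the inside, with
`{x ∈ ℝ^{n+1} : R < |x|} ≅ (0, T) × S^n`, `T = arsinh (1 / R)`, in which
`g = sinh⁻² t (dt² + h(t, ·))`, where `h` is smooth on `[0, T) × S^n` and
`h(t, ·) = h₀ + t^{n+1} k + O(t^{n+2})`. Adding the boundary `{0} × S^n` at `t = 0`, one obtains
the collar `[0, T) × S^n` of the smooth conformal compactification at this end. -/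
structure AHEnd {n : ℕ} {M : Type*} [TopologicalSpace M] [ChartedSpace (Eucl (n + 1)) M]
    [IsManifold (𝓡 (n + 1)) ∞ M] (g : SmoothMetric (n + 1) M) where
  /-- the inner radius of the end -/
  R : ℝ
  R_pos : 0 < R
  /-- the coordinates on the end -/
  φ : OpenPartialHomeomorph M (Eucl (n + 1))
  φ_smooth : φ ∈ IsManifold.maximalAtlas (𝓡 (n + 1)) ∞ M
  φ_target : φ.target = {x | R < ‖x‖}
  /-- nothing else in `M` is attached to the part `{r ≥ R'}` of the end -/
  φ_closed : ∀ R' > R, IsClosed {p : M | p ∈ φ.source ∧ R' ≤ ‖φ p‖}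
  /-- the family of metrics `h(t, θ)` on `S^n` -/
  h : ℝ → Eucl (n + 1) → BilForm (n + 1)
  /-- `h` is smooth on `[0, T) × S^n`: its extension to `[0, T) × (ℝ^{n+1} \ {0})`, homogeneous of
  degree `0` in the second variable, is smooth -/
  h_smooth : ContDiffOn ℝ ∞ (fun q : ℝ × Eucl (n + 1) => h q.1 (polarTheta q.2))
    (Ico 0 (Real.arsinh (1 / R)) ×ˢ {0}ᶜ)
  metric_eq : ∀ x, R < ‖x‖ → ∀ u v, metricInChart g φ x u v = ahForm h x u v
  /-- the mass aspect tensor -/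
  k : Eucl (n + 1) → BilForm (n + 1)
  h_expansion : ∃ C : ℝ, ∀ᶠ t in 𝓝[>] (0 : ℝ), ∀ θ : Eucl (n + 1), ‖θ‖ = 1 →
    ∀ u v : Eucl (n + 1), inner ℝ θ u = 0 → inner ℝ θ v = 0 →
      |h t θ u v - (inner ℝ u v + t ^ (n + 1) * k θ u v)| ≤ C * t ^ (n + 2) * (‖u‖ * ‖v‖)

namespace AHEnd

variable {n : ℕ} {M : Type*} [TopologicalSpace M] [ChartedSpace (Eucl (n + 1)) M]
  [IsManifold (𝓡 (n + 1)) ∞ M] {g : SmoothMetric (n + 1) M}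

/-- The mass aspect function `tr_{h₀} k` on `S^n`. -/
def massAspect (e : AHEnd g) (θ : Metric.sphere (0 : Eucl (n + 1)) 1) : ℝ :=
  sphereTrace θ.1 (e.k θ.1)

/-- The constant `λ = (max |tr k| / min |tr k|)^{1 / (n + 1)}`. -/
def lam (e : AHEnd g) : ℝ :=
  ((⨆ θ, |e.massAspect θ|) / (⨅ θ, |e.massAspect θ|)) ^ (1 / ((n : ℝ) + 1))

end AHEnd

end

/-! Rescale the end: `s = r / R₁`, `w = R₁^(-1/2)`, so that `s = w² r`, and put `ε = w^(2n+2) =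
R₁^(-(n+1))`. Since `sinh t = 1 / r`, the given metric is `dr² / (1 + r²) + r² h`. It is replaced by
`dr² / (r² F) + r² ((1 - χ(s)) h₀ + χ(s) h)` with `F = 1 + r⁻² + ε (c - m(s) / s^(n+1))`,
equivalently `r² F = 1 + r² / a - m / r^(n-1)` where `1 / a = 1 + c ε`. For constant `m` and `χ = 0`
this is an AdS-Schwarzschild metric of mass parameter `m`. If `χ = 1` and `m = c s^(n+1)` for `s ≤
1`, nothing changes there; if `χ = 0` and `m = 0` for `s ≥ 9λ`, the metric is `g_a` there.

With `ν = -tr k > 0`, the scalar curvature (`coordScalar_radial`) satisfies `S + n(n+1) / a = ε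
s^(-n) (n m' - ν (n χ' - s χ'')) + o(ε)`. Thus everything reduces to the inequality `ν (n χ' - s
χ'') < n m'` on `1 ≤ s ≤ 4λ`, for all values of `ν`. Where `χ = 0` the formula is exact without an
error term, and `m' ≥ 0` is enough.

The profile (`exists_radial_profile`) is found by writing `χ' = -p b s^n` with a bump `b ≥ 0`; then
`n χ' - s χ'' = p s^(n+1) b'`. Switching `b` on in `[1, 2]` forces `m` to grow, in the worst case at
the rate given by `max ν`. Switching `b` off in `[4λ - 1, 4λ]` allows `m` to decrease at the rate
given by `min ν`, but with the much larger weight `s^(n+1)`. As `max ν = λ^(n+1) min ν` and `4λ - 1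
≥ 3λ`, the decrease wins, so `m` becomes negative and can afterwards be brought up to `0`
monotonically. The sign of the mass aspect makes the switching-off the favourable step.

The error term is controlled by treating `w` as a variable near `0`. Because `t = arsinh(w² / s)` is
nonnegative for either sign of `w`, the one-sided smoothness of `h` at `t = 0` becomes smoothness in
`w` on a full neighbourhood of `0`. Hadamard's lemma then gives `h = h₀ + w^(2n+2) κ` with `κ`
smooth and equal to `k / s^(n+1)` at `w = 0` (`exists_perturbation_expansion`). After division by
`ε`, a lower bound for the curvature defect is continuous and positive at `w = 0`
(`eventually_coordScalar_perturbed_ge`); compactness of `[1, 4λ] × S^n` makes the smallness of `w`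
uniform.

Scalar curvature is given in coordinates, so the computation also needs its invariance under changes
of coordinates (`coordScalar_pullback`), via the Levi-Civita connection and the trace of its
curvature. -/

/-! ### Hadamard's lemma with parameters -/

section Hadamard

variable {P : Type*} [NormedAddCommGroup P] [NormedSpace ℝ P]

/-- The integral over `[0, 1]` of a smooth function of a parameter is smooth. -/
theorem contDiff_unitInterval_integral {f : ℝ × P → ℝ} (hf : ContDiff ℝ ∞ f) :
    ContDiff ℝ ∞ (fun p => ∫ σ in (0 : ℝ)..1, f (σ, p)) := by
  -- The integral is the value at `0` of the convolution of the indicator of `[0, 1]` with `u ↦ B(u)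
  -- f(-u, p)`. The bump is `1` on `[-1, 1]`, so it does not change the integral, and it supplies
  -- the compact support that smoothness of a convolution with parameter requires.
  let B : ContDiffBump (0 : ℝ) := ⟨1, 2, one_pos, one_lt_two⟩
  have h := MeasureTheory.contDiffOn_convolution_right_with_param (μ := MeasureTheory.volume) (n := ⊤)
    (f := (Icc (0 : ℝ) 1).indicator fun _ => (1 : ℝ)) (ContinuousLinearMap.mul ℝ ℝ)
    (g := fun (p : P) (u : ℝ) => B u * f (-u, p)) (s := univ) (k := Metric.closedBall 0 2)
    isOpen_univ (isCompact_closedBall _ _)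
    (fun p x _ hx => by
      have : B x = 0 := B.zero_of_le_dist (by
        simp only [Metric.mem_closedBall, not_le] at hx; exact hx.le)
      simp [this])
    ((MeasureTheory.integrable_indicator_iff measurableSet_Icc).2
      (by simp [MeasureTheory.IntegrableOn])).locallyIntegrable
    (by
      refine ContDiff.contDiffOn ?_
      have h1 : ContDiff ℝ ∞ (fun q : P × ℝ => B q.2) := B.contDiff.comp contDiff_snd
      have h2 : ContDiff ℝ ∞ (fun q : P × ℝ => f (-q.2, q.1)) :=
        hf.comp (contDiff_snd.neg.prodMk contDiff_fst)
      exact h1.mul h2)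
  rw [univ_prod_univ, contDiffOn_univ] at h
  have h2 := h.comp (contDiff_id.prodMk (contDiff_const (c := (0 : ℝ))) :
    ContDiff ℝ ∞ fun p : P => (p, (0 : ℝ)))
  convert h2 using 1
  ext p
  simp only [Function.comp_apply, id_eq, MeasureTheory.convolution,
    ContinuousLinearMap.mul_apply', zero_sub, neg_neg]
  rw [intervalIntegral.integral_of_le zero_le_one, ← MeasureTheory.integral_Icc_eq_integral_Ioc,
    ← MeasureTheory.integral_indicator measurableSet_Icc]
  congr 1
  ext t
  by_cases ht : t ∈ Icc (0 : ℝ) 1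
  · have : B (-t) = 1 := B.one_of_mem_closedBall (by
      simp only [Metric.mem_closedBall, dist_zero_right, norm_neg, Real.norm_eq_abs]
      exact abs_le.2 ⟨by linarith [ht.1], ht.2⟩)
    simp [ht, this]
  · simp [ht]

/-- The fundamental theorem of calculus along `σ ↦ f(σ w, p)` gives `κ(w, p) = ∫₀¹ ∂_w f(σ w, p)
dσ`. -/
theorem exists_contDiff_eq_mul_of_zero {f : ℝ × P → ℝ} (hf : ContDiff ℝ ∞ f)
    (h0 : ∀ p, f (0, p) = 0) :
    ∃ κ : ℝ × P → ℝ, ContDiff ℝ ∞ κ ∧ ∀ w p, f (w, p) = w * κ (w, p) := by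
  have hd : ContDiff ℝ ∞ (fun q : ℝ × P => fderiv ℝ f q (1, 0)) :=
    (hf.fderiv_right (by simp)).clm_apply contDiff_const
  refine ⟨fun q => ∫ σ in (0 : ℝ)..1, fderiv ℝ f (σ * q.1, q.2) (1, 0),
    contDiff_unitInterval_integral (f := fun x : ℝ × (ℝ × P) =>
      fderiv ℝ f (x.1 * x.2.1, x.2.2) (1, 0)) (hd.comp
      ((contDiff_fst.mul (contDiff_fst.comp contDiff_snd)).prodMk
        (contDiff_snd.comp contDiff_snd))), fun w p => ?_⟩
  have hder : ∀ σ ∈ uIcc (0 : ℝ) 1, HasDerivAt (fun σ : ℝ => f (σ * w, p))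
      (w * fderiv ℝ f (σ * w, p) (1, 0)) σ := by
    intro σ _
    have h1 : HasDerivAt (fun σ : ℝ => (σ * w, p)) (w, (0 : P)) σ := by
      simpa using ((hasDerivAt_id σ).mul_const w).prodMk (hasDerivAt_const σ p)
    have h2 := (hf.differentiable (by simp) (σ * w, p)).hasFDerivAt.comp_hasDerivAt σ h1
    have h3 : ((w, 0) : ℝ × P) = w • ((1, 0) : ℝ × P) := by simp
    rw [h3, map_smul, smul_eq_mul] at h2
    exact h2
  have hc : Continuous fun σ : ℝ => w * fderiv ℝ f (σ * w, p) (1, 0) :=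
    continuous_const.mul (hd.continuous.comp (by fun_prop))
  have := intervalIntegral.integral_eq_sub_of_hasDerivAt hder (hc.intervalIntegrable 0 1)
  rw [intervalIntegral.integral_const_mul] at this
  simp only [one_mul, zero_mul, h0, sub_zero] at this
  exact this.symm

/-- A smooth function that is `O(w ^ N)` in its first variable is `w ^ N` times a smooth
function. -/
theorem exists_contDiff_eq_pow_mul {f : ℝ × P → ℝ} (hf : ContDiff ℝ ∞ f) (N : ℕ)
    (h0 : ∀ p, (fun w => f (w, p)) =O[𝓝[≠] 0] fun w : ℝ => w ^ N) :
    ∃ κ : ℝ × P → ℝ, ContDiff ℝ ∞ κ ∧ ∀ w p, f (w, p) = w ^ N * κ (w, p) := by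
  induction N with
  | zero => exact ⟨f, hf, by simp⟩
  | succ N ih =>
    obtain ⟨κ, hκ, he⟩ := ih fun p => (h0 p).trans <| by
      refine Asymptotics.IsBigO.of_bound 1 ?_
      have : ∀ᶠ w : ℝ in 𝓝[≠] 0, |w| < 1 :=
        mem_nhdsWithin_of_mem_nhds ((continuous_abs.tendsto (0 : ℝ)).eventually_lt_const (by simp))
      filter_upwards [this] with w hw
      rw [pow_succ, norm_mul, one_mul]
      exact mul_le_of_le_one_right (norm_nonneg _) hw.le
    -- After `N` factors have been removed the quotient is still `O(w)` for `w ≠ 0`; by continuity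
    -- it vanishes at `w = 0`, and one more factor splits off.
    have hz : ∀ p, κ (0, p) = 0 := by
      intro p
      have h1 : Tendsto (fun w => κ (w, p)) (𝓝[≠] 0) (𝓝 (κ (0, p))) :=
        ((hκ.continuous.comp (by fun_prop : Continuous fun w : ℝ => (w, p))).tendsto 0).mono_left
          nhdsWithin_le_nhds
      have h2 : (fun w => κ (w, p)) =O[𝓝[≠] 0] fun w : ℝ => w := by
        obtain ⟨C, hC⟩ := (h0 p).bound
        refine Asymptotics.IsBigO.of_bound C ?_
        filter_upwards [hC, self_mem_nhdsWithin] with w hw hw0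
        have hw0 : w ≠ 0 := hw0
        rw [he, pow_succ, norm_mul, norm_mul] at hw
        have : 0 < ‖w ^ N‖ := norm_pos_iff.2 (pow_ne_zero _ hw0)
        refine le_of_mul_le_mul_left ?_ this
        linarith
      have h3 : Tendsto (fun w => κ (w, p)) (𝓝[≠] 0) (𝓝 0) :=
        h2.trans_tendsto (tendsto_id.mono_left nhdsWithin_le_nhds)
      exact tendsto_nhds_unique h1 h3
    obtain ⟨κ', hκ', he'⟩ := exists_contDiff_eq_mul_of_zero hκ hz
    exact ⟨κ', hκ', fun w p => by rw [he, he', pow_succ, mul_assoc]⟩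

end Hadamard

/-! ### The cut-off and mass functions -/

section Profile

theorem deriv_smoothTransition_nonneg (x : ℝ) : 0 ≤ deriv Real.smoothTransition x :=
  Real.smoothTransition.monotone.deriv_nonneg

theorem deriv_smoothTransition_of_nonpos {x : ℝ} (hx : x ≤ 0) :
    deriv Real.smoothTransition x = 0 := by
  refine IsLocalMin.deriv_eq_zero (Eventually.of_forall fun y => ?_)
  rw [Real.smoothTransition.zero_of_nonpos hx]
  exact Real.smoothTransition.nonneg y

theorem deriv_smoothTransition_of_one_le {x : ℝ} (hx : 1 ≤ x) :
    deriv Real.smoothTransition x = 0 := by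
  refine IsLocalMax.deriv_eq_zero (Eventually.of_forall fun y => ?_)
  rw [Real.smoothTransition.one_of_one_le hx]
  exact Real.smoothTransition.le_one y

theorem hasDerivAt_smoothTransition_sub (a x : ℝ) :
    HasDerivAt (fun s => Real.smoothTransition (s - a))
      (deriv Real.smoothTransition (x - a)) x :=
  HasDerivAt.comp_sub_const x a
    ((Real.smoothTransition.contDiff (n := 1)).differentiable (by simp) (x - a)).hasDerivAt

theorem contDiff_smoothTransition_sub (a : ℝ) :
    ContDiff ℝ ∞ (fun s => Real.smoothTransition (s - a)) :=
  Real.smoothTransition.contDiff.comp (contDiff_id.sub contDiff_const)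

theorem contDiff_deriv_smoothTransition_sub (a : ℝ) :
    ContDiff ℝ ∞ (fun s => deriv Real.smoothTransition (s - a)) :=
  ((contDiff_infty_iff_deriv.1 Real.smoothTransition.contDiff).2).comp
    (contDiff_id.sub contDiff_const)

theorem contDiff_integral_left {f : ℝ → ℝ} (hf : ContDiff ℝ ∞ f) (a : ℝ) :
    (∀ s, HasDerivAt (fun s => ∫ x in a..s, f x) (f s) s) ∧
      ContDiff ℝ ∞ (fun s => ∫ x in a..s, f x) := by
  have h : ∀ s, HasDerivAt (fun s => ∫ x in a..s, f x) (f s) s := fun s =>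
    intervalIntegral.integral_hasDerivAt_right (hf.continuous.intervalIntegrable _ _)
      hf.continuous.stronglyMeasurable.stronglyMeasurableAtFilter hf.continuous.continuousAt
  refine ⟨h, contDiff_infty_iff_deriv.2 ⟨fun s => (h s).differentiableAt, ?_⟩⟩
  rwa [show deriv (fun s => ∫ x in a..s, f x) = f from funext fun s => (h s).deriv]

/-- The cut-off function and the mass function of the radial deformation: `χ` interpolates between
the given metrics on the spheres and the round ones, and `F` is the mass function of the lapse. -/
theorem exists_radial_profile {n : ℕ} (hn : 1 ≤ n) {m m' l : ℝ} (hm : 0 < m) (hm' : m ≤ m')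
    (hl : 1 ≤ l) (hlm : m' ≤ l ^ (n + 1) * m) :
    ∃ c > 0, ∃ χ F : ℝ → ℝ, ContDiff ℝ ∞ χ ∧ ContDiff ℝ ∞ F ∧ (∀ s ≤ 1, χ s = 1) ∧
      (∀ s ≤ 1, F s = c * s ^ (n + 1)) ∧ (∀ s ≥ 4 * l, χ s = 0) ∧
      (∀ s ≥ 4 * l, 0 ≤ deriv F s) ∧ (∀ s ≥ 9 * l, F s = 0) ∧ (∀ s, 0 ≤ χ s) ∧ (∀ s, χ s ≤ 1) ∧
      ∀ s ∈ Icc 1 (4 * l), ∀ ν ∈ Icc m m',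
        ν * (n * deriv χ s - s * deriv (deriv χ) s) < n * deriv F s := by
  have hn0 : (0 : ℝ) < n := by exact_mod_cast hn
  have hm0 : 0 < m' := hm.trans_le hm'
  set T := Real.smoothTransition with hT
  set T' := deriv T with hT'
  have hTn : ∀ x, 0 ≤ T x := Real.smoothTransition.nonneg
  have hT1 : ∀ x, T x ≤ 1 := Real.smoothTransition.le_one
  have hTn' : ∀ x, 0 ≤ T' x := deriv_smoothTransition_nonneg
  -- The bump rises on `[1, 2]` and falls on `[4l - 1, 4l]`; these intervals are disjoint because `l
  -- ≥ 1`.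
  set b : ℝ → ℝ := fun s => T (s - 1) - T (s - (4 * l - 1)) with hb
  have hbs : ContDiff ℝ ∞ b :=
    (contDiff_smoothTransition_sub 1).sub (contDiff_smoothTransition_sub (4 * l - 1))
  have hb0 : ∀ s, 0 ≤ b s := fun s =>
    sub_nonneg.2 (Real.smoothTransition.monotone (by linarith))
  have hbl : ∀ s ≤ 1, b s = 0 := fun s hs => by
    simp only [hb, hT]
    rw [Real.smoothTransition.zero_of_nonpos (by linarith),
      Real.smoothTransition.zero_of_nonpos (by linarith), sub_zero]
  have hbr : ∀ s ≥ 4 * l, b s = 0 := fun s hs => by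
    simp only [hb, hT]
    rw [Real.smoothTransition.one_of_one_le (by linarith),
      Real.smoothTransition.one_of_one_le (by linarith), sub_self]
  have hb2 : b 2 = 1 := by
    simp only [hb, hT]
    rw [Real.smoothTransition.one_of_one_le (by norm_num),
      Real.smoothTransition.zero_of_nonpos (by linarith), sub_zero]
  have hbd : ∀ s, HasDerivAt b (T' (s - 1) - T' (s - (4 * l - 1))) s := fun s =>
    (hasDerivAt_smoothTransition_sub 1 s).sub (hasDerivAt_smoothTransition_sub (4 * l - 1) s)
  have hfs : ContDiff ℝ ∞ (fun s => b s * s ^ n) := hbs.mul (contDiff_id.pow n)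
  obtain ⟨hJd, hJs⟩ := contDiff_integral_left hfs 1
  set J : ℝ → ℝ := fun s => ∫ x in (1 : ℝ)..s, b x * x ^ n with hJ
  have hJ1 : ∀ s ≤ 1, J s = 0 := fun s hs => by
    simp only [hJ]
    rw [intervalIntegral.integral_congr (g := fun _ => (0 : ℝ)), intervalIntegral.integral_zero]
    intro x hx
    rw [uIcc_of_ge hs] at hx
    simp [hbl x hx.2]
  have hJm : MonotoneOn J (Ici 1) := by
    refine monotoneOn_of_deriv_nonneg (convex_Ici 1) hJs.continuous.continuousOn
      (fun s _ => (hJd s).differentiableAt.differentiableWithinAt) fun s hs => ?_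
    rw [interior_Ici] at hs
    rw [(hJd s).deriv]
    exact mul_nonneg (hb0 s) (pow_nonneg (by linarith [hs.out]) n)
  have hJ4 : ∀ s ≥ 4 * l, J s = J (4 * l) := fun s hs => by
    have h1 : J s = J (4 * l) + ∫ x in (4 * l)..s, b x * x ^ n :=
      (intervalIntegral.integral_add_adjacent_intervals
        (hfs.continuous.intervalIntegrable _ _) (hfs.continuous.intervalIntegrable _ _)).symm
    rw [h1, intervalIntegral.integral_congr (g := fun _ => (0 : ℝ)),
      intervalIntegral.integral_zero, add_zero]
    intro x hx
    rw [uIcc_of_le hs] at hx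
    simp [hbr x hx.1]
  have hI : 0 < J (4 * l) := by
    refine intervalIntegral.integral_pos (by linarith) hfs.continuous.continuousOn
      (fun x hx => mul_nonneg (hb0 x) (pow_nonneg (by linarith [hx.1]) n))
      ⟨2, ⟨by norm_num, by linarith⟩, by rw [hb2]; positivity⟩
  -- Normalises the total drop of `χ = 1 - p J` to be exactly `1`.
  set p := (J (4 * l))⁻¹ with hp
  have hp0 : 0 < p := inv_pos.2 hI
  set χ : ℝ → ℝ := fun s => 1 - p * J s with hχ
  have hχs : ContDiff ℝ ∞ χ := contDiff_const.sub (contDiff_const.mul hJs)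
  have hχd : deriv χ = fun s => -(p * (b s * s ^ n)) := funext fun s => by
    have := ((hJd s).const_mul p).const_sub 1
    exact this.deriv
  have hχdd : ∀ s, deriv (deriv χ) s =
      -(p * ((T' (s - 1) - T' (s - (4 * l - 1))) * s ^ n + b s * (n * s ^ (n - 1)))) := by
    intro s
    rw [hχd]
    exact (((hbd s).mul (hasDerivAt_pow n s)).const_mul p).neg.deriv
  -- The worst case over `ν ∈ [m, m']` of `ν (n χ' - s χ'') / n = (p / n) ν s^(n+1) b'`: the largest
  -- `ν` where `b` rises, the smallest where it falls.
  set A' : ℝ → ℝ := fun s =>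
    p / n * (s ^ (n + 1) * (m' * T' (s - 1) - m * T' (s - (4 * l - 1)))) with hA'
  have hA's : ContDiff ℝ ∞ A' := contDiff_const.mul ((contDiff_id.pow _).mul
    ((contDiff_const.mul (contDiff_deriv_smoothTransition_sub 1)).sub
      (contDiff_const.mul (contDiff_deriv_smoothTransition_sub (4 * l - 1)))))
  obtain ⟨hAd, hAs⟩ := contDiff_integral_left hA's 1
  set A : ℝ → ℝ := fun s => ∫ x in (1 : ℝ)..s, A' x with hA
  have hA1 : ∀ s ≤ 1, A s = 0 := fun s hs => by
    simp only [hA]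
    rw [intervalIntegral.integral_congr (g := fun _ => (0 : ℝ)), intervalIntegral.integral_zero]
    intro x hx
    rw [uIcc_of_ge hs] at hx
    simp only [hA', hT', hT]
    rw [deriv_smoothTransition_of_nonpos (by linarith [hx.2]),
      deriv_smoothTransition_of_nonpos (by linarith [hx.2])]
    ring
  -- A lower bound for the net decrease of `A`: the rise has weight at most `2^(n+1)`, the fall at
  -- least `(4l - 1)^(n+1)`. It is positive because `2 < 3`, `3l ≤ 4l - 1` and `m' ≤ l^(n+1) m`;
  -- this is where `λ` enters.
  set K := p / n * (m * (4 * l - 1) ^ (n + 1) - m' * 2 ^ (n + 1)) with hK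
  have hK0 : 0 < K := by
    refine mul_pos (div_pos hp0 hn0) (sub_pos.2 ?_)
    calc m' * 2 ^ (n + 1) < m' * 3 ^ (n + 1) := by gcongr; norm_num
      _ ≤ l ^ (n + 1) * m * 3 ^ (n + 1) := by gcongr
      _ = m * (3 * l) ^ (n + 1) := by rw [mul_pow]; ring
      _ ≤ m * (4 * l - 1) ^ (n + 1) := by gcongr; linarith
  have hAK : ∀ s ≥ 4 * l, A s ≤ -K := by
    intro s hs
    -- Compares `A` with the primitive in which `s^(n+1)` is frozen at `2` on the rising interval
    -- and at `4l - 1` on the falling one. Both replacements enlarge the derivative, so `D`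
    -- decreases from `D(1) = 0`.
    set D : ℝ → ℝ := fun s => A s -
      p / n * (m' * 2 ^ (n + 1) * T (s - 1) - m * (4 * l - 1) ^ (n + 1) * T (s - (4 * l - 1)))
      with hD
    have hDd : ∀ s, HasDerivAt D (A' s - p / n * (m' * 2 ^ (n + 1) * T' (s - 1) -
        m * (4 * l - 1) ^ (n + 1) * T' (s - (4 * l - 1)))) s := fun s =>
      (hAd s).sub ((((hasDerivAt_smoothTransition_sub 1 s).const_mul _).sub
        ((hasDerivAt_smoothTransition_sub (4 * l - 1) s).const_mul _)).const_mul _)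
    have hanti : AntitoneOn D (Ici 1) := by
      refine antitoneOn_of_deriv_nonpos (convex_Ici 1)
        (fun s _ => (hDd s).continuousAt.continuousWithinAt)
        (fun s _ => (hDd s).differentiableAt.differentiableWithinAt) fun x hx => ?_
      rw [interior_Ici] at hx
      have hx : 1 < x := hx
      rw [(hDd x).deriv, hA', ← mul_sub]
      refine mul_nonpos_of_nonneg_of_nonpos (by positivity) ?_
      have h1 : x ^ (n + 1) * T' (x - 1) ≤ 2 ^ (n + 1) * T' (x - 1) := by
        rcases le_total x 2 with h | h
        · exact mul_le_mul_of_nonneg_right (by gcongr) (hTn' _)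
        · rw [hT', hT, deriv_smoothTransition_of_one_le (by linarith)]; simp
      have h2 : (4 * l - 1) ^ (n + 1) * T' (x - (4 * l - 1)) ≤
          x ^ (n + 1) * T' (x - (4 * l - 1)) := by
        rcases le_total x (4 * l - 1) with h | h
        · rw [hT', hT, deriv_smoothTransition_of_nonpos (by linarith)]; simp
        · exact mul_le_mul_of_nonneg_right
            (pow_le_pow_left₀ (by linarith) h _) (hTn' _)
      have h3 := mul_le_mul_of_nonneg_left h1 hm0.le
      have h4 := mul_le_mul_of_nonneg_left h2 hm.le
      linarith
    have h1 := hanti (self_mem_Ici (a := (1 : ℝ))) (show s ∈ Ici (1 : ℝ) by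
      simp only [mem_Ici]; linarith) (by linarith)
    simp only [hD, hA1 1 le_rfl, hT] at h1
    rw [Real.smoothTransition.zero_of_nonpos (x := 1 - 1) (by linarith),
      Real.smoothTransition.zero_of_nonpos (x := 1 - (4 * l - 1)) (by linarith),
      Real.smoothTransition.one_of_one_le (x := s - 1) (by linarith),
      Real.smoothTransition.one_of_one_le (x := s - (4 * l - 1)) (by linarith)] at h1
    rw [hK]
    linarith
  -- So small that `c s^(n+1) + A` is still `≤ 0` on `[4l, 4l + 1]`. Cutting it off to `0` there
  -- therefore moves it upwards, and `F' ≥ 0` is kept. The cut-off is complete at `4l + 1 ≤ 9l`.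
  set c := K / (4 * l + 1) ^ (n + 1) with hc
  have hc0 : 0 < c := by positivity
  set F : ℝ → ℝ := fun s => (c * s ^ (n + 1) + A s) * (1 - T (s - 4 * l)) with hF
  have hFd : ∀ s, deriv F s = (c * ((n + 1 : ℕ) * s ^ n) + A' s) * (1 - T (s - 4 * l)) +
      (c * s ^ (n + 1) + A s) * (- T' (s - 4 * l)) := fun s =>
    ((((hasDerivAt_pow (n + 1) s).const_mul c).add (hAd s)).mul
      ((hasDerivAt_smoothTransition_sub (4 * l) s).const_sub 1)).deriv
  refine ⟨c, hc0, χ, F, hχs, ?_, fun s hs => ?_, fun s hs => ?_, fun s hs => ?_, fun s hs => ?_,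
    fun s hs => ?_, fun s => ?_, fun s => ?_, fun s hs ν hν => ?_⟩
  · exact ((contDiff_const.mul (contDiff_id.pow _)).add hAs).mul
      (contDiff_const.sub (contDiff_smoothTransition_sub (4 * l)))
  · simp [hχ, hJ1 s hs]
  · simp only [hF, hA1 s hs, hT]
    rw [Real.smoothTransition.zero_of_nonpos (by linarith)]
    ring
  · simp only [hχ, hJ4 s hs, hp]
    rw [inv_mul_cancel₀ hI.ne', sub_self]
  · rw [hFd]
    have hs0 : 0 < s := by linarith [hs]
    have h1 : 0 ≤ A' s := by
      simp only [hA', hT', hT]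
      rw [deriv_smoothTransition_of_one_le (x := s - (4 * l - 1)) (by linarith [hs])]
      have := deriv_smoothTransition_nonneg (s - 1)
      simp only [mul_zero, sub_zero]
      positivity
    refine add_nonneg (mul_nonneg (by positivity) (sub_nonneg.2 (hT1 _))) ?_
    rcases le_total s (4 * l + 1) with h | h
    · refine mul_nonneg_of_nonpos_of_nonpos ?_ (neg_nonpos.2 (hTn' _))
      have h2 : c * s ^ (n + 1) ≤ K := by
        calc c * s ^ (n + 1) ≤ c * (4 * l + 1) ^ (n + 1) := by gcongr
          _ = K := by rw [hc]; field_simp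
      linarith [hAK s hs]
    · rw [hT', hT, deriv_smoothTransition_of_one_le (by linarith)]; simp
  · simp only [hF, hT]
    rw [Real.smoothTransition.one_of_one_le (by linarith [hs])]
    ring
  · simp only [hχ]
    have h1 : J s ≤ J (4 * l) := by
      rcases le_total s 1 with h | h
      · rw [hJ1 s h]; exact hI.le
      · rcases le_total s (4 * l) with h' | h'
        · exact hJm h (by simp only [mem_Ici]; linarith) h'
        · exact (hJ4 s h').le
    have : p * J s ≤ p * J (4 * l) := by gcongr
    rw [hp, inv_mul_cancel₀ hI.ne'] at this
    rw [← hp] at this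
    linarith
  · simp only [hχ]
    have h1 : 0 ≤ J s := by
      rcases le_total s 1 with h | h
      · exact (hJ1 s h).ge
      · rw [← hJ1 1 le_rfl]
        exact hJm self_mem_Ici h h
    have := mul_nonneg hp0.le h1
    linarith
  · have hs0 : 0 < s := by linarith [hs.1]
    have e1 : n * deriv χ s - s * deriv (deriv χ) s =
        p * (s ^ (n + 1) * (T' (s - 1) - T' (s - (4 * l - 1)))) := by
      rw [hχdd, hχd]
      obtain ⟨k, rfl⟩ : ∃ k, n = k + 1 := ⟨n - 1, by omega⟩
      simp only [Nat.add_sub_cancel]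
      ring
    have e2 : deriv F s = c * ((n + 1 : ℕ) * s ^ n) + A' s := by
      rw [hFd, hT', hT, deriv_smoothTransition_of_nonpos (by linarith [hs.2]),
        Real.smoothTransition.zero_of_nonpos (by linarith [hs.2])]
      ring
    have e3 : n * A' s = p * (s ^ (n + 1) * (m' * T' (s - 1) - m * T' (s - (4 * l - 1)))) := by
      simp only [hA']
      field_simp
    -- `A'` alone gives only `≤`; the term `c s^(n+1)` makes the inequality strict, including where
    -- `b' = 0`.
    have h0 : 0 < (n : ℝ) * (c * ((n + 1 : ℕ) * s ^ n)) := by positivity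
    rw [e1, e2, mul_add, e3]
    have h1 := mul_le_mul_of_nonneg_right hν.2 (hTn' (s - 1))
    have h2 := mul_le_mul_of_nonneg_right hν.1 (hTn' (s - (4 * l - 1)))
    have h3 : ν * (p * (s ^ (n + 1) * (T' (s - 1) - T' (s - (4 * l - 1))))) ≤
        p * (s ^ (n + 1) * (m' * T' (s - 1) - m * T' (s - (4 * l - 1)))) := by
      have : ν * (p * (s ^ (n + 1) * (T' (s - 1) - T' (s - (4 * l - 1))))) =
        p * (s ^ (n + 1) * (ν * T' (s - 1) - ν * T' (s - (4 * l - 1)))) := by ring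
      rw [this]
      gcongr
    linarith

end Profile

/-! ### The Levi-Civita connection and its curvature under a change of coordinates -/

section LeviCivita

variable {E : Type*} [NormedAddCommGroup E] [NormedSpace ℝ E]

/-- The Koszul formula: `Γ` is the Levi-Civita connection of the family of forms `𝔤` at `x`. -/
def IsKoszul (𝔤 : E → E →L[ℝ] E →L[ℝ] ℝ) (Γ : E → E →L[ℝ] E →L[ℝ] E) (x : E) : Prop :=
  ∀ u v w, 2 * 𝔤 x (Γ x u v) w =
    fderiv ℝ 𝔤 x u v w + fderiv ℝ 𝔤 x v u w - fderiv ℝ 𝔤 x w u v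

/-- The curvature of the connection `Γ`. -/
noncomputable def connCurvature (Γ : E → E →L[ℝ] E →L[ℝ] E) (x u v w : E) : E :=
  fderiv ℝ Γ x u v w - fderiv ℝ Γ x v u w + Γ x u (Γ x v w) - Γ x v (Γ x u w)

theorem ContDiffAt.fderiv_fderiv_symm {F : Type*} [NormedAddCommGroup F] [NormedSpace ℝ F]
    {f : E → F} {x : E} (hf : ContDiffAt ℝ ∞ f x) (u v : E) :
    fderiv ℝ (fderiv ℝ f) x u v = fderiv ℝ (fderiv ℝ f) x v u :=
  (hf.isSymmSndFDerivAt (by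
    rw [minSmoothness_of_isRCLikeNormedField]
    exact WithTop.coe_le_coe.2 (le_top : (2 : ℕ∞) ≤ ⊤))) u v

theorem fderiv_bilin_comp {F : Type*} [NormedAddCommGroup F] [NormedSpace ℝ F]
    {β : E → E →L[ℝ] E →L[ℝ] F} {f : E → E} {a b : E → E} {x : E}
    (hβ : DifferentiableAt ℝ β (f x)) (hf : DifferentiableAt ℝ f x)
    (ha : DifferentiableAt ℝ a x) (hb : DifferentiableAt ℝ b x) (w : E) :
    fderiv ℝ (fun y => β (f y) (a y) (b y)) x w =
      fderiv ℝ β (f x) (fderiv ℝ f x w) (a x) (b x) + β (f x) (fderiv ℝ a x w) (b x)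
        + β (f x) (a x) (fderiv ℝ b x w) := by
  have h0 : HasFDerivAt (fun y => β (f y)) ((fderiv ℝ β (f x)).comp (fderiv ℝ f x)) x :=
    HasFDerivAt.comp (g := β) (f := f) x hβ.hasFDerivAt hf.hasFDerivAt
  have h := (h0.clm_apply ha.hasFDerivAt).clm_apply hb.hasFDerivAt
  have h' : fderiv ℝ (fun y => β (f y) (a y) (b y)) x = _ := h.fderiv
  rw [h']
  simp only [add_apply, ContinuousLinearMap.comp_apply,
    ContinuousLinearMap.flip_apply]
  abel

theorem hasFDerivAt_fderiv_apply {F : Type*} [NormedAddCommGroup F] [NormedSpace ℝ F]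
    {f : E → F} {x : E} (hf : ContDiffAt ℝ ∞ f x) (u : E) :
    HasFDerivAt (fun y => fderiv ℝ f y u) ((fderiv ℝ (fderiv ℝ f) x).flip u) x := by
  have h := ((hf.fderiv_right (m := ∞) (by simp)).differentiableAt (by simp)).hasFDerivAt
  convert h.clm_apply (hasFDerivAt_const u x) using 1
  ext w
  simp

theorem fderiv_pullback_form {𝔤 𝔤' : E → E →L[ℝ] E →L[ℝ] ℝ} {f : E → E} {x : E}
    (hf : ContDiffAt ℝ ∞ f x) (hg : DifferentiableAt ℝ 𝔤 (f x)) (hg' : DifferentiableAt ℝ 𝔤' x)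
    (h : ∀ᶠ y in 𝓝 x, ∀ u v, 𝔤' y u v = 𝔤 (f y) (fderiv ℝ f y u) (fderiv ℝ f y v)) (w u v : E) :
    fderiv ℝ 𝔤' x w u v =
      fderiv ℝ 𝔤 (f x) (fderiv ℝ f x w) (fderiv ℝ f x u) (fderiv ℝ f x v)
        + 𝔤 (f x) (fderiv ℝ (fderiv ℝ f) x w u) (fderiv ℝ f x v)
        + 𝔤 (f x) (fderiv ℝ f x u) (fderiv ℝ (fderiv ℝ f) x w v) := by
  have h1 := ((hg'.hasFDerivAt.clm_apply (hasFDerivAt_const u x)).clm_apply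
    (hasFDerivAt_const v x)).fderiv
  have h2 : fderiv ℝ (fun y => 𝔤' y u v) x w = fderiv ℝ 𝔤' x w u v := by
    rw [h1]; simp
  have h3 : (fun y => 𝔤' y u v) =ᶠ[𝓝 x]
      fun y => 𝔤 (f y) (fderiv ℝ f y u) (fderiv ℝ f y v) := h.mono fun y hy => hy u v
  have hu := hasFDerivAt_fderiv_apply hf u
  have hv := hasFDerivAt_fderiv_apply hf v
  rw [← h2, h3.fderiv_eq, fderiv_bilin_comp hg (hf.differentiableAt (by simp))
    hu.differentiableAt hv.differentiableAt, hu.fderiv, hv.fderiv]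
  simp

/-- The inhomogeneous transformation law of Christoffel symbols. In the Koszul combination of the
derivatives of the pulled back metric, symmetry of `D²f` cancels four of the six second-order terms
and leaves `2 𝔤(D²f(u, v), Df w)`. Nondegeneracy of `𝔤` and surjectivity of `Df` then identify the
vectors. -/
theorem IsKoszul.pullback {𝔤 𝔤' : E → E →L[ℝ] E →L[ℝ] ℝ} {Γ Γ' : E → E →L[ℝ] E →L[ℝ] E}
    {f : E → E} {x : E} (hf : ContDiffAt ℝ ∞ f x) (hg : DifferentiableAt ℝ 𝔤 (f x))
    (hg' : DifferentiableAt ℝ 𝔤' x)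
    (h : ∀ᶠ y in 𝓝 x, ∀ u v, 𝔤' y u v = 𝔤 (f y) (fderiv ℝ f y u) (fderiv ℝ f y v))
    (hA : Function.Surjective (fderiv ℝ f x)) (hs : ∀ u v, 𝔤 (f x) u v = 𝔤 (f x) v u)
    (hnd : ∀ u, (∀ v, 𝔤 (f x) u v = 0) → u = 0)
    (hΓ : IsKoszul 𝔤 Γ (f x)) (hΓ' : IsKoszul 𝔤' Γ' x) (u v : E) :
    fderiv ℝ f x (Γ' x u v) =
      fderiv ℝ (fderiv ℝ f) x u v + Γ (f x) (fderiv ℝ f x u) (fderiv ℝ f x v) := by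
  rw [← sub_eq_zero]
  refine hnd _ fun z => ?_
  obtain ⟨w, rfl⟩ := hA z
  have h1 := hΓ' u v w
  have h2 := hΓ (fderiv ℝ f x u) (fderiv ℝ f x v) (fderiv ℝ f x w)
  rw [h.self_of_nhds, fderiv_pullback_form hf hg hg' h, fderiv_pullback_form hf hg hg' h,
    fderiv_pullback_form hf hg hg' h, hf.fderiv_fderiv_symm v u, hf.fderiv_fderiv_symm w u,
    hf.fderiv_fderiv_symm w v, hs _ (fderiv ℝ (fderiv ℝ f) x u w)] at h1
  rw [map_sub, map_add, sub_apply, add_apply]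
  linarith

/-- Curvature is a tensor: on differentiating the transformation law and antisymmetrising, the `D³f`
terms cancel by symmetry, and the `D²f` terms cancel against those from the quadratic part of the
curvature. -/
theorem connCurvature_pullback {Γ Γ' : E → E →L[ℝ] E →L[ℝ] E} {f : E → E} {x : E}
    (hf : ContDiffAt ℝ ∞ f x) (hΓ : DifferentiableAt ℝ Γ (f x)) (hΓ' : DifferentiableAt ℝ Γ' x)
    (h : ∀ᶠ y in 𝓝 x, ∀ u v, fderiv ℝ f y (Γ' y u v) =
      fderiv ℝ (fderiv ℝ f) y u v + Γ (f y) (fderiv ℝ f y u) (fderiv ℝ f y v)) (w u v : E) :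
    fderiv ℝ f x (connCurvature Γ' x w u v) =
      connCurvature Γ (f x) (fderiv ℝ f x w) (fderiv ℝ f x u) (fderiv ℝ f x v) := by
  have hf1 : ContDiffAt ℝ ∞ (fderiv ℝ f) x := hf.fderiv_right (by simp)
  have hf2 : ContDiffAt ℝ ∞ (fderiv ℝ (fderiv ℝ f)) x := hf1.fderiv_right (by simp)
  -- The derivative of the transformation law at `x` in the direction `w`.
  have key : ∀ w u v : E, fderiv ℝ (fderiv ℝ f) x w (Γ' x u v)
      + fderiv ℝ f x (fderiv ℝ Γ' x w u v) =
      fderiv ℝ (fderiv ℝ (fderiv ℝ f)) x w u v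
        + (fderiv ℝ Γ (f x) (fderiv ℝ f x w) (fderiv ℝ f x u) (fderiv ℝ f x v)
        + Γ (f x) (fderiv ℝ (fderiv ℝ f) x w u) (fderiv ℝ f x v)
        + Γ (f x) (fderiv ℝ f x u) (fderiv ℝ (fderiv ℝ f) x w v)) := by
    intro w u v
    have e : (fun y => fderiv ℝ f y (Γ' y u v)) =ᶠ[𝓝 x] fun y => fderiv ℝ (fderiv ℝ f) y u v
        + Γ (f y) (fderiv ℝ f y u) (fderiv ℝ f y v) := h.mono fun y hy => hy u v
    have h1 := (hf1.differentiableAt (by simp)).hasFDerivAt.clm_apply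
      ((hΓ'.hasFDerivAt.clm_apply (hasFDerivAt_const u x)).clm_apply (hasFDerivAt_const v x))
    have h2 := ((hf2.differentiableAt (by simp)).hasFDerivAt.clm_apply
      (hasFDerivAt_const u x)).clm_apply (hasFDerivAt_const v x)
    have hu := hasFDerivAt_fderiv_apply hf u
    have hv := hasFDerivAt_fderiv_apply hf v
    have h3 : DifferentiableAt ℝ (fun y => Γ (f y) (fderiv ℝ f y u) (fderiv ℝ f y v)) x :=
      ((hΓ.comp x (hf.differentiableAt (by simp))).clm_apply hu.differentiableAt).clm_apply
        hv.differentiableAt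
    have e1 := congrArg (fun L : E →L[ℝ] E => L w) e.fderiv_eq
    have e2 : fderiv ℝ (fun y => fderiv ℝ (fderiv ℝ f) y u v
        + Γ (f y) (fderiv ℝ f y u) (fderiv ℝ f y v)) x = _ :=
      fderiv_add h2.differentiableAt h3
    rw [e2] at e1
    simp only [add_apply] at e1
    rw [fderiv_bilin_comp hΓ (hf.differentiableAt (by simp)) hu.differentiableAt
      hv.differentiableAt, hu.fderiv, hv.fderiv, h1.fderiv, h2.fderiv] at e1
    simp only [add_apply, ContinuousLinearMap.comp_apply,
      ContinuousLinearMap.flip_apply, zero_apply, map_zero, zero_add] at e1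
    rw [← e1]
    abel
  have hx := h.self_of_nhds
  have k1 := eq_sub_of_add_eq' (key w u v)
  have k2 := eq_sub_of_add_eq' (key u w v)
  simp only [connCurvature, map_add, map_sub, k1, k2, hx, hf1.fderiv_fderiv_symm u w,
    hf.fderiv_fderiv_symm u w]
  abel

end LeviCivita

/-! ### Christoffel symbols as a connection: smoothness, locality and the Koszul formula -/

section CoordinateInvariance

variable {m : ℕ}

/-- The matrix of a bilinear form in the standard basis. -/
noncomputable def formMatrix (b : BilForm m) : Matrix (Fin m) (Fin m) ℝ :=
  Matrix.of fun i j => b (EuclideanSpace.single i 1) (EuclideanSpace.single j 1)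

@[simp] theorem formMatrix_apply (b : BilForm m) (i j : Fin m) :
    formMatrix b i j = b (EuclideanSpace.single i 1) (EuclideanSpace.single j 1) := rfl

theorem eucl_eq_sum (u : Eucl m) : u = ∑ i, u i • EuclideanSpace.single i (1 : ℝ) := by
  ext j
  simp [Finset.sum_apply, Pi.single_apply]

theorem IsLinearMap.eq_of_single {F : Type*} [AddCommGroup F] [Module ℝ F] {f g : Eucl m → F}
    (hf : IsLinearMap ℝ f) (hg : IsLinearMap ℝ g)
    (h : ∀ i, f (EuclideanSpace.single i 1) = g (EuclideanSpace.single i 1)) (u : Eucl m) :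
    f u = g u := by
  have : hf.mk' f = hg.mk' g :=
    (EuclideanSpace.basisFun (Fin m) ℝ).toBasis.ext fun i => by simpa using h i
  exact congrArg (fun L : Eucl m →ₗ[ℝ] F => L u) this

theorem LinearMap.apply₂_eq_sum (B : Eucl m →ₗ[ℝ] Eucl m →ₗ[ℝ] ℝ) (u v : Eucl m) :
    B u v = ∑ a, ∑ b, u a * v b *
      B (EuclideanSpace.single a 1) (EuclideanSpace.single b 1) := by
  conv_lhs => rw [eucl_eq_sum u, eucl_eq_sum v]
  simp only [map_sum, map_smul, LinearMap.sum_apply, LinearMap.smul_apply, sum_apply,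
    smul_apply, smul_eq_mul, Finset.mul_sum, mul_assoc]
  rw [Finset.sum_comm]
  exact Finset.sum_congr rfl fun a _ => Finset.sum_congr rfl fun b _ => by ring

theorem BilForm.apply_eq_sum (B : BilForm m) (u v : Eucl m) :
    B u v = ∑ a, ∑ b, u a * v b * formMatrix B a b := by
  conv_lhs => rw [eucl_eq_sum u, eucl_eq_sum v]
  simp only [map_sum, map_smul, sum_apply,
    smul_apply, smul_eq_mul, Finset.mul_sum, mul_assoc, formMatrix_apply]
  rw [Finset.sum_comm]
  exact Finset.sum_congr rfl fun a _ => Finset.sum_congr rfl fun b _ => by ring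

theorem formMatrix_det_ne_zero_iff (B : BilForm m) :
    (formMatrix B).det ≠ 0 ↔ ∀ u, (∀ v, B u v = 0) → u = 0 := by
  rw [← not_iff_not, not_not, ← Matrix.exists_vecMul_eq_zero_iff]
  push Not
  constructor
  · rintro ⟨v, hv, h⟩
    refine ⟨WithLp.toLp 2 v, fun w => ?_, fun h' => hv ?_⟩
    · rw [BilForm.apply_eq_sum, Finset.sum_comm]
      refine Finset.sum_eq_zero fun b _ => ?_
      have := congrFun h b
      simp only [Matrix.vecMul, dotProduct, Pi.zero_apply] at this
      calc _ = w b * ∑ a, v a * formMatrix B a b := by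
            rw [Finset.mul_sum]; exact Finset.sum_congr rfl fun a _ => by ring
        _ = 0 := by rw [this, mul_zero]
    · simpa using congrArg (WithLp.ofLp) h'
  · rintro ⟨u, hu, hu0⟩
    refine ⟨u.ofLp, fun h => hu0 (by ext i; exact congrFun h i), ?_⟩
    ext b
    have h := hu (EuclideanSpace.single b 1)
    conv_lhs at h => rw [eucl_eq_sum u]
    simpa [Matrix.vecMul, dotProduct] using h

/-- The Levi-Civita connection given by the Christoffel symbols. -/
noncomputable def christoffelMap (G : Eucl m → Matrix (Fin m) (Fin m) ℝ) (x : Eucl m) :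
    Eucl m →L[ℝ] Eucl m →L[ℝ] Eucl m :=
  ∑ i, ∑ j, ∑ k, christoffel G k i j x •
    (EuclideanSpace.proj i : Eucl m →L[ℝ] ℝ).smulRight
      ((EuclideanSpace.proj j : Eucl m →L[ℝ] ℝ).smulRight (EuclideanSpace.single k (1 : ℝ)))

theorem christoffelMap_single (G : Eucl m → Matrix (Fin m) (Fin m) ℝ) (x : Eucl m)
    (i j k : Fin m) :
    christoffelMap G x (EuclideanSpace.single i 1) (EuclideanSpace.single j 1) k =
      christoffel G k i j x := by
  simp [christoffelMap, Finset.sum_apply, Pi.single_apply]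

theorem contDiffAt_partialD {f : Eucl m → ℝ} {x : Eucl m} (hf : ContDiffAt ℝ ∞ f x) (i : Fin m) :
    ContDiffAt ℝ ∞ (partialD i f) x :=
  (hf.fderiv_right (by simp)).clm_apply contDiffAt_const

theorem contDiffAt_matrix_det {P : Type*} [NormedAddCommGroup P] [NormedSpace ℝ P]
    {ι : Type*} [Fintype ι] [DecidableEq ι]
    {G : P → Matrix ι ι ℝ} {x : P} (hG : ∀ i j, ContDiffAt ℝ ∞ (fun y => G y i j) x) :
    ContDiffAt ℝ ∞ (fun y => (G y).det) x := by
  simp only [Matrix.det_apply']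
  exact ContDiffAt.sum fun σ _ => contDiffAt_const.mul (contDiffAt_prod fun i _ => hG _ _)

theorem contDiffAt_matrix_inv {P : Type*} [NormedAddCommGroup P] [NormedSpace ℝ P]
    {ι : Type*} [Fintype ι] [DecidableEq ι]
    {G : P → Matrix ι ι ℝ} {x : P} (hG : ∀ i j, ContDiffAt ℝ ∞ (fun y => G y i j) x)
    (hx : (G x).det ≠ 0) (i j : ι) :
    ContDiffAt ℝ ∞ (fun y => (G y)⁻¹ i j) x := by
  simp only [Matrix.inv_def, Matrix.smul_apply, smul_eq_mul, Ring.inverse_eq_inv',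
    Matrix.adjugate_apply]
  refine ((contDiffAt_matrix_det hG).inv hx).mul (contDiffAt_matrix_det fun k l => ?_)
  by_cases h : k = j
  · subst h; simpa using contDiffAt_const
  · simpa [Matrix.updateRow_ne h] using hG k l

theorem contDiffAt_christoffel {G : Eucl m → Matrix (Fin m) (Fin m) ℝ} {x : Eucl m}
    (hG : ∀ i j, ContDiffAt ℝ ∞ (fun y => G y i j) x) (hx : (G x).det ≠ 0) (k i j : Fin m) :
    ContDiffAt ℝ ∞ (christoffel G k i j) x := by
  unfold christoffel
  exact contDiffAt_const.mul (ContDiffAt.sum fun l _ => (contDiffAt_matrix_inv hG hx k l).mul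
    (((contDiffAt_partialD (hG _ _) _).add (contDiffAt_partialD (hG _ _) _)).sub
      (contDiffAt_partialD (hG _ _) _)))

theorem ContDiffAt.smul_fixed {P F : Type*} [NormedAddCommGroup P] [NormedSpace ℝ P]
    [NormedAddCommGroup F] [NormedSpace ℝ F] {c : P → ℝ} {x : P} (hc : ContDiffAt ℝ ∞ c x)
    (v : F) : ContDiffAt ℝ ∞ (fun y => c y • v) x :=
  hc.smul contDiffAt_const

theorem contDiffAt_christoffelMap {G : Eucl m → Matrix (Fin m) (Fin m) ℝ} {x : Eucl m}
    (hG : ∀ i j, ContDiffAt ℝ ∞ (fun y => G y i j) x) (hx : (G x).det ≠ 0) :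
    ContDiffAt ℝ ∞ (christoffelMap G) x := by
  unfold christoffelMap
  exact ContDiffAt.sum fun i _ => ContDiffAt.sum fun j _ => ContDiffAt.sum fun k _ =>
    (contDiffAt_christoffel hG hx k i j).smul_fixed _

theorem partialD_congr {f g : Eucl m → ℝ} {x : Eucl m} (h : f =ᶠ[𝓝 x] g) (i : Fin m) :
    partialD i f x = partialD i g x := by
  simp only [partialD, h.fderiv_eq]

theorem christoffel_congr {G G' : Eucl m → Matrix (Fin m) (Fin m) ℝ} {x : Eucl m}
    (h : G =ᶠ[𝓝 x] G') (k i j : Fin m) : christoffel G k i j x = christoffel G' k i j x := by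
  have h' : ∀ i j, (fun y => G y i j) =ᶠ[𝓝 x] fun y => G' y i j := fun i j =>
    h.mono fun y hy => by simp only [hy]
  simp only [christoffel, h.self_of_nhds, fun i j k => partialD_congr (h' i j) k]

theorem coordScalar_congr {G G' : Eucl m → Matrix (Fin m) (Fin m) ℝ} {x : Eucl m}
    (h : G =ᶠ[𝓝 x] G') : coordScalar G x = coordScalar G' x := by
  have h' : ∀ k i j, christoffel G k i j =ᶠ[𝓝 x] christoffel G' k i j := fun k i j =>
    h.eventually_nhds.mono fun y hy => christoffel_congr hy k i j
  simp only [coordScalar, coordRicci, h.self_of_nhds, fun k i j l => partialD_congr (h' k i j) l,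
    fun k i j => (h' k i j).self_of_nhds]

theorem christoffel_symm {G : Eucl m → Matrix (Fin m) (Fin m) ℝ} {x : Eucl m}
    (h : ∀ᶠ y in 𝓝 x, (G y).IsSymm) (k i j : Fin m) :
    christoffel G k i j x = christoffel G k j i x := by
  have h' : ∀ l, partialD l (fun y => G y i j) x = partialD l (fun y => G y j i) x := fun l =>
    partialD_congr (h.mono fun y hy => hy.apply j i) l
  simp only [christoffel, h']
  congr 1
  refine Finset.sum_congr rfl fun l _ => ?_
  ring

theorem partialD_eq_fderiv_form {𝔤 : Eucl m → BilForm m} {x : Eucl m}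
    (h : DifferentiableAt ℝ 𝔤 x) (l i j : Fin m) :
    partialD l (fun y => formMatrix (𝔤 y) i j) x =
      fderiv ℝ 𝔤 x (EuclideanSpace.single l 1) (EuclideanSpace.single i 1)
        (EuclideanSpace.single j 1) := by
  have h1 := ((h.hasFDerivAt.clm_apply (hasFDerivAt_const (EuclideanSpace.single i (1 : ℝ)) x)
    ).clm_apply (hasFDerivAt_const (EuclideanSpace.single j (1 : ℝ)) x)).fderiv
  simp only [partialD, formMatrix_apply]
  rw [h1]
  simp

theorem contDiffAt_formMatrix {𝔤 : Eucl m → BilForm m} {x : Eucl m}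
    (h : ContDiffAt ℝ ∞ 𝔤 x) (i j : Fin m) :
    ContDiffAt ℝ ∞ (fun y => formMatrix (𝔤 y) i j) x :=
  (h.clm_apply contDiffAt_const).clm_apply contDiffAt_const

/-- Both sides are trilinear, so basis vectors suffice; there, contracting the Christoffel symbols
with the metric cancels the inverse matrix in their definition. -/
theorem isKoszul_christoffelMap {𝔤 : Eucl m → BilForm m} {x : Eucl m}
    (h : DifferentiableAt ℝ 𝔤 x) (hs : (formMatrix (𝔤 x)).IsSymm)
    (hd : (formMatrix (𝔤 x)).det ≠ 0) :
    IsKoszul 𝔤 (christoffelMap fun y => formMatrix (𝔤 y)) x := by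
  have key : ∀ i j l : Fin m, 2 * 𝔤 x (christoffelMap (fun y => formMatrix (𝔤 y)) x
      (EuclideanSpace.single i 1) (EuclideanSpace.single j 1)) (EuclideanSpace.single l 1) =
      fderiv ℝ 𝔤 x (EuclideanSpace.single i 1) (EuclideanSpace.single j 1)
        (EuclideanSpace.single l 1) + fderiv ℝ 𝔤 x (EuclideanSpace.single j 1)
        (EuclideanSpace.single i 1) (EuclideanSpace.single l 1) -
      fderiv ℝ 𝔤 x (EuclideanSpace.single l 1) (EuclideanSpace.single i 1)
        (EuclideanSpace.single j 1) := by
    intro i j l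
    simp only [← partialD_eq_fderiv_form h]
    set c : Fin m → ℝ := fun l' => partialD i (fun y => formMatrix (𝔤 y) j l') x
      + partialD j (fun y => formMatrix (𝔤 y) i l') x
      - partialD l' (fun y => formMatrix (𝔤 y) i j) x with hc
    rw [BilForm.apply_eq_sum]
    simp only [christoffelMap_single]
    have h1 : ∀ a, ∑ b, christoffel (fun y => formMatrix (𝔤 y)) a i j x *
        (EuclideanSpace.single l (1 : ℝ) : Eucl m) b * formMatrix (𝔤 x) a b =
        ((1 / 2) * ∑ l', (formMatrix (𝔤 x))⁻¹ a l' * c l') * formMatrix (𝔤 x) l a := by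
      intro a
      rw [Finset.sum_eq_single l (by intro b _ hb; simp [hb]) (by simp), ← hs.apply a l]
      simp [christoffel, hc]
    have h2 : ∀ a, ((1 / 2) * ∑ l', (formMatrix (𝔤 x))⁻¹ a l' * c l') * formMatrix (𝔤 x) l a =
        (1 / 2) * (formMatrix (𝔤 x) l a * ((formMatrix (𝔤 x))⁻¹.mulVec c) a) := by
      intro a
      simp only [Matrix.mulVec, dotProduct]
      ring
    simp only [h1, h2]
    rw [← Finset.mul_sum]
    have h3 : ∑ a, formMatrix (𝔤 x) l a * ((formMatrix (𝔤 x))⁻¹.mulVec c) a = c l := by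
      change (formMatrix (𝔤 x)).mulVec ((formMatrix (𝔤 x))⁻¹.mulVec c) l = c l
      rw [Matrix.mulVec_mulVec, Matrix.mul_nonsing_inv _ (isUnit_iff_ne_zero.2 hd),
        Matrix.one_mulVec]
    rw [h3]
    simp only [hc]
    ring
  intro u v w
  refine IsLinearMap.eq_of_single (f := fun w => 2 * 𝔤 x (christoffelMap _ x u v) w)
    (g := fun w => fderiv ℝ 𝔤 x u v w + fderiv ℝ 𝔤 x v u w - fderiv ℝ 𝔤 x w u v)
    ⟨fun _ _ => by simp; ring, fun _ _ => by simp; ring⟩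
    ⟨fun _ _ => by simp; ring, fun _ _ => by simp; ring⟩ (fun l => ?_) w
  refine IsLinearMap.eq_of_single
    (f := fun v => 2 * 𝔤 x (christoffelMap _ x u v) (EuclideanSpace.single l 1))
    (g := fun v => fderiv ℝ 𝔤 x u v (EuclideanSpace.single l 1) +
      fderiv ℝ 𝔤 x v u (EuclideanSpace.single l 1) -
      fderiv ℝ 𝔤 x (EuclideanSpace.single l 1) u v)
    ⟨fun _ _ => by simp; ring, fun _ _ => by simp; ring⟩
    ⟨fun _ _ => by simp; ring, fun _ _ => by simp; ring⟩ (fun j => ?_) v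
  exact IsLinearMap.eq_of_single
    (f := fun u => 2 * 𝔤 x (christoffelMap _ x u (EuclideanSpace.single j 1))
      (EuclideanSpace.single l 1))
    (g := fun u => fderiv ℝ 𝔤 x u (EuclideanSpace.single j 1) (EuclideanSpace.single l 1) +
      fderiv ℝ 𝔤 x (EuclideanSpace.single j 1) u (EuclideanSpace.single l 1) -
      fderiv ℝ 𝔤 x (EuclideanSpace.single l 1) u (EuclideanSpace.single j 1))
    ⟨fun _ _ => by simp; ring, fun _ _ => by simp; ring⟩
    ⟨fun _ _ => by simp; ring, fun _ _ => by simp; ring⟩ (fun i => key i j l) u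

end CoordinateInvariance

/-! ### Ricci and scalar curvature as traces; invariance under diffeomorphisms -/

section CoordinateInvariance

variable {m : ℕ}

/-- The curvature `u ↦ R(u, v) w` as a linear map. -/
noncomputable def connCurvatureLin (Γ : Eucl m → Eucl m →L[ℝ] Eucl m →L[ℝ] Eucl m)
    (x v w : Eucl m) : Eucl m →ₗ[ℝ] Eucl m where
  toFun u := connCurvature Γ x u v w
  map_add' a b := by simp only [connCurvature, map_add, add_apply]; abel
  map_smul' c a := by
    simp only [connCurvature, map_smul, smul_apply, RingHom.id_apply, smul_sub, smul_add]

/-- The Ricci form of a connection, as the trace of the curvature. -/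
noncomputable def ricciForm (Γ : Eucl m → Eucl m →L[ℝ] Eucl m →L[ℝ] Eucl m) (x : Eucl m) :
    Eucl m →ₗ[ℝ] Eucl m →ₗ[ℝ] ℝ :=
  LinearMap.mk₂ ℝ (fun v w => LinearMap.trace ℝ (Eucl m) (connCurvatureLin Γ x v w))
    (fun v v' w => by
      rw [← map_add]; congr 1; ext1 u
      simp only [connCurvatureLin, connCurvature, LinearMap.coe_mk, AddHom.coe_mk,
        LinearMap.add_apply, map_add, add_apply]; abel)
    (fun c v w => by
      rw [← map_smul]; congr 1; ext1 u
      simp only [connCurvatureLin, connCurvature, LinearMap.coe_mk, AddHom.coe_mk,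
        LinearMap.smul_apply, map_smul, smul_apply, smul_sub, smul_add])
    (fun v w w' => by
      rw [← map_add]; congr 1; ext1 u
      simp only [connCurvatureLin, connCurvature, LinearMap.coe_mk, AddHom.coe_mk,
        LinearMap.add_apply, map_add]; abel)
    (fun c v w => by
      rw [← map_smul]; congr 1; ext1 u
      simp only [connCurvatureLin, connCurvature, LinearMap.coe_mk, AddHom.coe_mk,
        LinearMap.smul_apply, map_smul, smul_sub, smul_add])

theorem ricciForm_apply (Γ : Eucl m → Eucl m →L[ℝ] Eucl m →L[ℝ] Eucl m) (x v w : Eucl m) :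
    ricciForm Γ x v w = ∑ k, connCurvature Γ x (EuclideanSpace.single k 1) v w k := by
  change LinearMap.trace ℝ (Eucl m) (connCurvatureLin Γ x v w) = _
  rw [LinearMap.trace_eq_sum_inner _ (EuclideanSpace.basisFun (Fin m) ℝ)]
  refine Finset.sum_congr rfl fun k _ => ?_
  simp [connCurvatureLin, EuclideanSpace.inner_single_left]

theorem partialD_christoffel_eq {G : Eucl m → Matrix (Fin m) (Fin m) ℝ} {x : Eucl m}
    (h : DifferentiableAt ℝ (christoffelMap G) x) (l k i j : Fin m) :
    partialD l (christoffel G k i j) x = fderiv ℝ (christoffelMap G) x (EuclideanSpace.single l 1)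
      (EuclideanSpace.single i 1) (EuclideanSpace.single j 1) k := by
  have h1 := ((h.hasFDerivAt.clm_apply (hasFDerivAt_const (EuclideanSpace.single i (1 : ℝ)) x)
    ).clm_apply (hasFDerivAt_const (EuclideanSpace.single j (1 : ℝ)) x))
  have h2 := ((EuclideanSpace.proj k : Eucl m →L[ℝ] ℝ).hasFDerivAt.comp x h1).fderiv
  have h3 : christoffel G k i j = (EuclideanSpace.proj k : Eucl m →L[ℝ] ℝ) ∘ fun y =>
      christoffelMap G y (EuclideanSpace.single i 1) (EuclideanSpace.single j 1) :=
    funext fun y => (christoffelMap_single G y i j k).symm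
  rw [partialD, h3, h2]
  simp

/-- The trace of `u ↦ R(u, e_j) e_i` reproduces the coordinate formula only after lower indices of
Christoffel symbols are exchanged, inside derivatives too; hence symmetry of the metric is needed
near `x`. -/
theorem coordRicci_eq_ricciForm {G : Eucl m → Matrix (Fin m) (Fin m) ℝ} {x : Eucl m}
    (h : DifferentiableAt ℝ (christoffelMap G) x) (hs : ∀ᶠ y in 𝓝 x, (G y).IsSymm)
    (i j : Fin m) :
    coordRicci G i j x = ricciForm (christoffelMap G) x (EuclideanSpace.single j 1)
      (EuclideanSpace.single i 1) := by
  have hs' : ∀ k i j, christoffel G k i j =ᶠ[𝓝 x] christoffel G k j i := fun k i j =>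
    hs.eventually_nhds.mono fun y hy => christoffel_symm hy k i j
  have hsx : ∀ k i j, christoffel G k i j x = christoffel G k j i x := fun k i j =>
    (hs' k i j).self_of_nhds
  rw [ricciForm_apply, coordRicci, ← Finset.sum_add_distrib]
  refine Finset.sum_congr rfl fun k _ => ?_
  have e : ∀ a b c : Fin m, christoffelMap G x (EuclideanSpace.single a 1)
      (christoffelMap G x (EuclideanSpace.single b 1) (EuclideanSpace.single c 1)) k =
      ∑ l, christoffel G k a l x * christoffel G l b c x := by
    intro a b c
    conv_lhs => rw [eucl_eq_sum (christoffelMap G x (EuclideanSpace.single b 1)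
      (EuclideanSpace.single c 1))]
    simp only [map_sum, map_smul, christoffelMap_single]
    simp only [WithLp.ofLp_sum, Finset.sum_apply, PiLp.smul_apply, smul_eq_mul,
      christoffelMap_single, mul_comm]
  simp only [connCurvature, PiLp.sub_apply, PiLp.add_apply, e, ← partialD_christoffel_eq h]
  rw [partialD_congr (hs' k i j), partialD_congr (hs' k i k), Finset.sum_sub_distrib]
  simp only [hsx _ i j, hsx _ i k]
  ring

theorem contDiffAt_form_of_formMatrix {P : Type*} [NormedAddCommGroup P] [NormedSpace ℝ P]
    {𝔤 : P → BilForm m} {x : P} (h : ∀ i j, ContDiffAt ℝ ∞ (fun y => formMatrix (𝔤 y) i j) x) :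
    ContDiffAt ℝ ∞ 𝔤 x := by
  have h3 : 𝔤 = fun y => ∑ i, ∑ j, formMatrix (𝔤 y) i j •
      (EuclideanSpace.proj i : Eucl m →L[ℝ] ℝ).smulRight
        (EuclideanSpace.proj j : Eucl m →L[ℝ] ℝ) := by
    funext y
    ext u v
    rw [BilForm.apply_eq_sum]
    simp only [sum_apply, smul_apply, ContinuousLinearMap.smulRight_apply, smul_eq_mul]
    refine Finset.sum_congr rfl fun a _ => Finset.sum_congr rfl fun b _ => ?_
    simp [mul_comm]
  rw [h3]
  exact ContDiffAt.sum fun i _ => ContDiffAt.sum fun j _ => (h i j).smul_fixed _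

/-- The scalar curvature does not depend on the coordinates. -/
theorem coordScalar_pullback {𝔤 𝔤' : Eucl m → BilForm m} {f : Eucl m → Eucl m} {x : Eucl m}
    (hf' : ∀ᶠ y in 𝓝 x, ContDiffAt ℝ ∞ f y) (hA : Function.Injective (fderiv ℝ f x))
    (hG : ∀ᶠ y in 𝓝 (f x), ContDiffAt ℝ ∞ 𝔤 y)
    (hs : ∀ᶠ y in 𝓝 (f x), ∀ u v, 𝔤 y u v = 𝔤 y v u)
    (hnd : (formMatrix (𝔤 (f x))).det ≠ 0)
    (h : ∀ᶠ y in 𝓝 x, ∀ u v, 𝔤' y u v = 𝔤 (f y) (fderiv ℝ f y u) (fderiv ℝ f y v)) :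
    coordScalar (fun y => formMatrix (𝔤' y)) x = coordScalar (fun y => formMatrix (𝔤 y)) (f x) := by
  classical
  have hf := hf'.self_of_nhds
  have hg := hG.self_of_nhds
  -- Smoothness, symmetry and nondegeneracy of `𝔤'` are inherited from `𝔤` through the pullback
  -- formula.
  have hsmooth : ∀ᶠ y in 𝓝 x, ContDiffAt ℝ ∞ 𝔤' y := by
    filter_upwards [hf', hf.continuousAt.eventually hG, h.eventually_nhds] with x hf hg h
    have hf1 : ContDiffAt ℝ ∞ (fderiv ℝ f) x := hf.fderiv_right (by simp)
    have h1 : ∀ i j, ContDiffAt ℝ ∞ (fun y => formMatrix (𝔤' y) i j) x := by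
      intro i j
      have h2 : ContDiffAt ℝ ∞ (fun y => 𝔤 (f y) (fderiv ℝ f y (EuclideanSpace.single i 1))
          (fderiv ℝ f y (EuclideanSpace.single j 1))) x :=
        ((hg.comp x hf).clm_apply (hf1.clm_apply contDiffAt_const)).clm_apply
          (hf1.clm_apply contDiffAt_const)
      exact h2.congr_of_eventuallyEq (h.mono fun y hy => by simp [hy])
    exact contDiffAt_form_of_formMatrix h1
  have hg' := hsmooth.self_of_nhds
  have hdiff' : ∀ᶠ y in 𝓝 x, DifferentiableAt ℝ 𝔤' y :=
    hsmooth.mono fun y hy => hy.differentiableAt (by simp)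
  have hsurj : Function.Surjective (fderiv ℝ f x) :=
    (fderiv ℝ f x).toLinearMap.surjective_of_injective hA
  have hs' : ∀ᶠ y in 𝓝 x, ∀ u v, 𝔤' y u v = 𝔤' y v u := by
    filter_upwards [h, hf.continuousAt.eventually hs] with y hy hy' u v
    rw [hy, hy, hy']
  have hsm : ∀ᶠ y in 𝓝 (f x), (formMatrix (𝔤 y)).IsSymm := hs.mono fun y hy =>
    Matrix.IsSymm.ext fun i j => hy _ _
  have hsm' : ∀ᶠ y in 𝓝 x, (formMatrix (𝔤' y)).IsSymm := hs'.mono fun y hy =>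
    Matrix.IsSymm.ext fun i j => hy _ _
  have hdet : ∀ᶠ y in 𝓝 (f x), (formMatrix (𝔤 y)).det ≠ 0 :=
    (contDiffAt_matrix_det (contDiffAt_formMatrix hg)).continuousAt.eventually_ne hnd
  have hnd' : (formMatrix (𝔤' x)).det ≠ 0 := by
    rw [formMatrix_det_ne_zero_iff] at hnd ⊢
    intro u hu
    refine hA ?_
    rw [map_zero]
    refine hnd _ fun v => ?_
    obtain ⟨w, rfl⟩ := hsurj v
    rw [← h.self_of_nhds, hu]
  have hdet' : ∀ᶠ y in 𝓝 x, (formMatrix (𝔤' y)).det ≠ 0 :=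
    (contDiffAt_matrix_det (contDiffAt_formMatrix hg')).continuousAt.eventually_ne hnd'
  have hsurj' : ∀ᶠ y in 𝓝 x, Function.Surjective (fderiv ℝ f y) := by
    filter_upwards [hdet', h] with y hy h1
    refine (fderiv ℝ f y).toLinearMap.surjective_of_injective
      ((injective_iff_map_eq_zero _).2 fun u hu => ?_)
    refine (formMatrix_det_ne_zero_iff _).1 hy u fun v => ?_
    have hu' : fderiv ℝ f y u = 0 := hu
    rw [h1, hu']
    simp
  have hkos : ∀ᶠ y in 𝓝 x, ∀ u v, fderiv ℝ f y
      (christoffelMap (fun y => formMatrix (𝔤' y)) y u v) = fderiv ℝ (fderiv ℝ f) y u v +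
      christoffelMap (fun y => formMatrix (𝔤 y)) (f y) (fderiv ℝ f y u) (fderiv ℝ f y v) := by
    have hc := hf.continuousAt
    filter_upwards [hf', hc.eventually hG, hc.eventually hsm, hc.eventually hs,
      hc.eventually hdet, hdet', hsm', hsurj', h.eventually_nhds, hdiff'] with y h1 h2 h3 h4 h5 h6 h7
      h8 h9 h10
    exact IsKoszul.pullback h1 (h2.differentiableAt (by simp)) h10 h9 h8 h4
      ((formMatrix_det_ne_zero_iff _).1 h5)
      (isKoszul_christoffelMap (h2.differentiableAt (by simp)) h3 h5)
      (isKoszul_christoffelMap h10 h7 h6)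
  have hΓ : DifferentiableAt ℝ (christoffelMap fun y => formMatrix (𝔤 y)) (f x) :=
    (contDiffAt_christoffelMap (contDiffAt_formMatrix hg) hnd).differentiableAt (by simp)
  have hΓ' : DifferentiableAt ℝ (christoffelMap fun y => formMatrix (𝔤' y)) x :=
    (contDiffAt_christoffelMap (contDiffAt_formMatrix hg') hnd').differentiableAt (by simp)
  have hcurv := connCurvature_pullback hf hΓ hΓ' hkos
  let e : Eucl m ≃ₗ[ℝ] Eucl m := LinearEquiv.ofBijective (fderiv ℝ f x).toLinearMap ⟨hA, hsurj⟩
  -- The curvature endomorphisms at `x` and `f x` are conjugate by `Df`, so their traces agree.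
  have hric : ∀ v w, ricciForm (christoffelMap fun y => formMatrix (𝔤' y)) x v w =
      ricciForm (christoffelMap fun y => formMatrix (𝔤 y)) (f x) (fderiv ℝ f x v)
        (fderiv ℝ f x w) := by
    intro v w
    change LinearMap.trace ℝ _ _ = LinearMap.trace ℝ _ _
    rw [← LinearMap.trace_conj' _ e]
    congr 1
    ext1 u
    obtain ⟨u, rfl⟩ := hsurj u
    have : e.symm (fderiv ℝ f x u) = u := e.symm_apply_apply u
    simp only [LinearEquiv.conj_apply, LinearMap.comp_apply, LinearEquiv.coe_coe, this]
    exact hcurv u v w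
  -- With the Jacobian `J`, metric and Ricci matrices transform as `Jᵀ G J` and `Jᵀ N J`, and the
  -- contraction with the inverse metric is invariant by cyclicity of the trace.
  set J : Matrix (Fin m) (Fin m) ℝ :=
    Matrix.of fun a i => fderiv ℝ f x (EuclideanSpace.single i 1) a with hJ
  set N : Matrix (Fin m) (Fin m) ℝ := Matrix.of fun i j =>
    ricciForm (christoffelMap fun y => formMatrix (𝔤 y)) (f x) (EuclideanSpace.single j 1)
      (EuclideanSpace.single i 1) with hN
  have h1 : formMatrix (𝔤' x) = J.transpose * formMatrix (𝔤 (f x)) * J := by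
    ext i j
    rw [formMatrix_apply, h.self_of_nhds, BilForm.apply_eq_sum, Finset.sum_comm]
    simp only [Matrix.mul_apply, Matrix.transpose_apply, hJ, Matrix.of_apply, Finset.sum_mul]
    exact Finset.sum_congr rfl fun a _ => Finset.sum_congr rfl fun b _ => by ring
  have h2 : ∀ i j, coordRicci (fun y => formMatrix (𝔤' y)) i j x =
      (J.transpose * N * J) i j := by
    intro i j
    rw [coordRicci_eq_ricciForm hΓ' hsm', hric, LinearMap.apply₂_eq_sum]
    simp only [Matrix.mul_apply, Matrix.transpose_apply, hJ, hN, Matrix.of_apply, Finset.sum_mul]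
    exact Finset.sum_congr rfl fun a _ => Finset.sum_congr rfl fun b _ => by ring
  have h3 : ∀ i j, coordRicci (fun y => formMatrix (𝔤 y)) i j (f x) = N i j := fun i j => by
    rw [coordRicci_eq_ricciForm hΓ hsm]; rfl
  have h4 : ∀ A B : Matrix (Fin m) (Fin m) ℝ,
      ∑ i, ∑ j, A i j * B i j = (A * B.transpose).trace := fun A B => by
    simp [Matrix.trace, Matrix.mul_apply]
  have hJd : IsUnit J.det := by
    refine isUnit_iff_ne_zero.2 fun h0 => hnd' ?_
    rw [h1, Matrix.det_mul, h0, mul_zero]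
  have hJt : IsUnit J.transpose.det := by rwa [Matrix.det_transpose]
  simp only [coordScalar, h2, h3]
  rw [h4, h4, h1, Matrix.mul_inv_rev, Matrix.mul_inv_rev, Matrix.transpose_mul,
    Matrix.transpose_mul, Matrix.transpose_transpose, Matrix.trace_mul_comm]
  have h5 : J.transpose * (N.transpose * J) * (J⁻¹ * ((formMatrix (𝔤 (f x)))⁻¹ * J.transpose⁻¹)) =
      J.transpose * (N.transpose * (J * J⁻¹) * (formMatrix (𝔤 (f x)))⁻¹) * J.transpose⁻¹ := by
    simp only [Matrix.mul_assoc]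
  rw [h5, Matrix.mul_nonsing_inv _ hJd, Matrix.mul_one, Matrix.trace_mul_comm,
    ← Matrix.mul_assoc, Matrix.nonsing_inv_mul _ hJt, Matrix.one_mul, Matrix.trace_mul_comm]

end CoordinateInvariance

/-! ### Christoffel symbols of `W(s) ds² + γ(s, y)` -/

section Block

variable {n : ℕ}

/-- The last `n` coordinates. -/
noncomputable def euclTail (n : ℕ) : Eucl (n + 1) →L[ℝ] Eucl n :=
  ((PiLp.continuousLinearEquiv 2 ℝ fun _ : Fin n => ℝ).symm : (Fin n → ℝ) →L[ℝ] Eucl n).comp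
    (ContinuousLinearMap.pi fun i : Fin n => (EuclideanSpace.proj i.succ : Eucl (n + 1) →L[ℝ] ℝ))

@[simp] theorem euclTail_apply (x : Eucl (n + 1)) (i : Fin n) : euclTail n x i = x i.succ := rfl

@[simp] theorem euclTail_single_zero (c : ℝ) : euclTail n (EuclideanSpace.single 0 c) = 0 := by
  ext i; simp

@[simp] theorem euclTail_single_succ (i : Fin n) (c : ℝ) :
    euclTail n (EuclideanSpace.single i.succ c) = EuclideanSpace.single i c := by
  ext j; simp

/-- The first coordinate and the last `n` coordinates. -/
noncomputable def euclSplit (n : ℕ) : Eucl (n + 1) →L[ℝ] ℝ × Eucl n :=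
  (EuclideanSpace.proj 0 : Eucl (n + 1) →L[ℝ] ℝ).prod (euclTail n)

@[simp] theorem euclSplit_apply (x : Eucl (n + 1)) : euclSplit n x = (x 0, euclTail n x) := rfl

theorem partialD_zero_split {F : ℝ → Eucl n → ℝ} {x : Eucl (n + 1)}
    (h : DifferentiableAt ℝ (fun q : ℝ × Eucl n => F q.1 q.2) (x 0, euclTail n x)) :
    partialD 0 (fun x => F (x 0) (euclTail n x)) x = deriv (fun s => F s (euclTail n x)) (x 0) := by
  have h1 : HasFDerivAt (fun x => F (x 0) (euclTail n x)) _ x :=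
    HasFDerivAt.comp (f := euclSplit n) x h.hasFDerivAt (euclSplit n).hasFDerivAt
  have h2 := h.hasFDerivAt.comp_hasDerivAt (x 0)
    ((hasDerivAt_id (x 0)).prodMk (hasDerivAt_const (x 0) (euclTail n x)))
  have h3 : deriv (fun s => F s (euclTail n x)) (x 0) = _ := h2.deriv
  rw [partialD, h1.fderiv, h3]
  simp

theorem partialD_succ_split {F : ℝ → Eucl n → ℝ} {x : Eucl (n + 1)}
    (h : DifferentiableAt ℝ (fun q : ℝ × Eucl n => F q.1 q.2) (x 0, euclTail n x)) (i : Fin n) :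
    partialD i.succ (fun x => F (x 0) (euclTail n x)) x = partialD i (F (x 0)) (euclTail n x) := by
  have h1 : HasFDerivAt (fun x => F (x 0) (euclTail n x)) _ x :=
    HasFDerivAt.comp (f := euclSplit n) x h.hasFDerivAt (euclSplit n).hasFDerivAt
  have h2 : HasFDerivAt (F (x 0)) _ (euclTail n x) :=
    HasFDerivAt.comp (f := fun y : Eucl n => (x 0, y)) (euclTail n x) h.hasFDerivAt
      ((hasFDerivAt_const (x 0) (euclTail n x)).prodMk (hasFDerivAt_id (euclTail n x)))
  rw [partialD, partialD, h1.fderiv, h2.fderiv]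
  simp

/-- The block diagonal matrix with blocks `a` and `A`. -/
def blockMat (a : ℝ) (A : Matrix (Fin n) (Fin n) ℝ) : Matrix (Fin (n + 1)) (Fin (n + 1)) ℝ :=
  Matrix.of (Fin.cons (Fin.cons a 0) fun i => Fin.cons 0 (A i))

@[simp] theorem blockMat_zero_zero (a : ℝ) (A : Matrix (Fin n) (Fin n) ℝ) :
    blockMat a A 0 0 = a := rfl
@[simp] theorem blockMat_zero_succ (a : ℝ) (A : Matrix (Fin n) (Fin n) ℝ) (j : Fin n) :
    blockMat a A 0 j.succ = 0 := rfl
@[simp] theorem blockMat_succ_zero (a : ℝ) (A : Matrix (Fin n) (Fin n) ℝ) (i : Fin n) :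
    blockMat a A i.succ 0 = 0 := rfl
@[simp] theorem blockMat_succ_succ (a : ℝ) (A : Matrix (Fin n) (Fin n) ℝ) (i j : Fin n) :
    blockMat a A i.succ j.succ = A i j := rfl

theorem blockMat_inv {a : ℝ} {A : Matrix (Fin n) (Fin n) ℝ} (ha : a ≠ 0) (hA : A.det ≠ 0) :
    (blockMat a A)⁻¹ = blockMat a⁻¹ A⁻¹ := by
  refine Matrix.inv_eq_right_inv ?_
  have h := Matrix.mul_nonsing_inv A (isUnit_iff_ne_zero.2 hA)
  ext i j
  refine Fin.cases ?_ (fun i => ?_) i <;> refine Fin.cases ?_ (fun j => ?_) j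
  · simp [Matrix.mul_apply, Fin.sum_univ_succ, ha]
  · simp [Matrix.mul_apply, Fin.sum_univ_succ, (Fin.succ_ne_zero _).symm]
  · simp [Matrix.mul_apply, Fin.sum_univ_succ]
  · rw [Matrix.mul_apply, Fin.sum_univ_succ]
    have := congrFun (congrFun h i) j
    rw [Matrix.mul_apply] at this
    simp [this, Matrix.one_apply]

/-- The `s`-derivative of a family of matrices. -/
noncomputable def matDeriv (γ : ℝ → Eucl n → Matrix (Fin n) (Fin n) ℝ) (s : ℝ) (y : Eucl n) :
    Matrix (Fin n) (Fin n) ℝ :=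
  Matrix.of fun i j => deriv (fun s => γ s y i j) s

/-- The logarithmic `s`-derivative `γ⁻¹ ∂ₛγ` of a family of matrices. -/
noncomputable def logDerivMat (γ : ℝ → Eucl n → Matrix (Fin n) (Fin n) ℝ) (s : ℝ) (y : Eucl n) :
    Matrix (Fin n) (Fin n) ℝ :=
  (γ s y)⁻¹ * matDeriv γ s y

/-- The metric `W(s) ds² + γ(s, y)`, `s` being the first coordinate. -/
noncomputable def blockMetric (W : ℝ → ℝ) (γ : ℝ → Eucl n → Matrix (Fin n) (Fin n) ℝ)
    (x : Eucl (n + 1)) : Matrix (Fin (n + 1)) (Fin (n + 1)) ℝ :=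
  blockMat (W (x 0)) (γ (x 0) (euclTail n x))

/-- Regularity of a block metric at a point. -/
structure BlockRegular (W : ℝ → ℝ) (γ : ℝ → Eucl n → Matrix (Fin n) (Fin n) ℝ) (s : ℝ)
    (y : Eucl n) : Prop where
  smooth_W : ContDiffAt ℝ ∞ W s
  smooth : ∀ i j, ContDiffAt ℝ ∞ (fun q : ℝ × Eucl n => γ q.1 q.2 i j) (s, y)
  symm : ∀ᶠ q : ℝ × Eucl n in 𝓝 (s, y), (γ q.1 q.2).IsSymm
  W_ne : W s ≠ 0
  det_ne : (γ s y).det ≠ 0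

theorem contDiffAt_deriv_fst {Q : Type*} [NormedAddCommGroup Q] [NormedSpace ℝ Q]
    {f : ℝ × Q → ℝ} {q : ℝ × Q} (h : ContDiffAt ℝ ∞ f q) :
    ContDiffAt ℝ ∞ (fun q : ℝ × Q => deriv (fun s => f (s, q.2)) q.1) q := by
  have h1 : ContDiffAt ℝ ∞ (fun q => fderiv ℝ f q (1, 0)) q :=
    (h.fderiv_right (by simp)).clm_apply contDiffAt_const
  refine h1.congr_of_eventuallyEq ?_
  have h2 : ∀ᶠ q in 𝓝 q, ContDiffAt ℝ 1 f q :=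
    (h.of_le (by exact_mod_cast le_top)).eventually (by simp)
  filter_upwards [h2] with q hq
  have := (hq.differentiableAt (by simp)).hasFDerivAt.comp_hasDerivAt q.1
    ((hasDerivAt_id q.1).prodMk (hasDerivAt_const q.1 q.2))
  exact this.deriv

variable {W : ℝ → ℝ} {γ : ℝ → Eucl n → Matrix (Fin n) (Fin n) ℝ}

namespace BlockRegular

variable {s : ℝ} {y : Eucl n}

theorem contDiffAt_matDeriv (h : BlockRegular W γ s y) (i j : Fin n) :
    ContDiffAt ℝ ∞ (fun q : ℝ × Eucl n => matDeriv γ q.1 q.2 i j) (s, y) :=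
  contDiffAt_deriv_fst (h.smooth i j)

theorem contDiffAt_inv (h : BlockRegular W γ s y) (i j : Fin n) :
    ContDiffAt ℝ ∞ (fun q : ℝ × Eucl n => (γ q.1 q.2)⁻¹ i j) (s, y) :=
  contDiffAt_matrix_inv h.smooth h.det_ne i j

theorem contDiffAt_logDerivMat (h : BlockRegular W γ s y) (i j : Fin n) :
    ContDiffAt ℝ ∞ (fun q : ℝ × Eucl n => logDerivMat γ q.1 q.2 i j) (s, y) := by
  simp only [logDerivMat, Matrix.mul_apply]
  exact ContDiffAt.sum fun l _ => (h.contDiffAt_inv i l).mul (h.contDiffAt_matDeriv l j)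

theorem matDeriv_symm (h : BlockRegular W γ s y) : (matDeriv γ s y).IsSymm := by
  refine Matrix.IsSymm.ext fun i j => ?_
  have h1 : ∀ᶠ s' in 𝓝 s, (γ s' y).IsSymm :=
    (continuousAt_id.prodMk continuousAt_const : ContinuousAt (fun s' : ℝ => (s', y)) s).eventually
      h.symm
  exact EventuallyEq.deriv_eq (h1.mono fun s' hs' => hs'.apply i j)

end BlockRegular

section Christoffel

variable {x : Eucl (n + 1)}

theorem partialD_blockMetric_zero_zero_zero (h : BlockRegular W γ (x 0) (euclTail n x)) :
    partialD 0 (fun x => blockMetric W γ x 0 0) x = deriv W (x 0) :=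
  partialD_zero_split (F := fun s _ => W s)
    ((h.smooth_W.differentiableAt (by simp)).comp (x 0, euclTail n x) differentiableAt_fst)

theorem partialD_blockMetric_succ_zero_zero (h : BlockRegular W γ (x 0) (euclTail n x))
    (i : Fin n) : partialD i.succ (fun x => blockMetric W γ x 0 0) x = 0 := by
  have := partialD_succ_split (x := x) (F := fun s (_ : Eucl n) => W s)
    ((h.smooth_W.differentiableAt (by simp)).comp (x 0, euclTail n x) differentiableAt_fst) i
  refine this.trans ?_
  simp [partialD]

theorem partialD_zero_fun (i : Fin (n + 1)) (x : Eucl (n + 1)) :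
    partialD i (fun _ => (0 : ℝ)) x = 0 := by simp [partialD]

theorem partialD_blockMetric_zero_succ_succ (h : BlockRegular W γ (x 0) (euclTail n x))
    (i j : Fin n) : partialD 0 (fun x => blockMetric W γ x i.succ j.succ) x =
      matDeriv γ (x 0) (euclTail n x) i j :=
  partialD_zero_split (F := fun s y => γ s y i j) ((h.smooth i j).differentiableAt (by simp))

theorem partialD_blockMetric_succ_succ_succ (h : BlockRegular W γ (x 0) (euclTail n x))
    (i j k : Fin n) : partialD k.succ (fun x => blockMetric W γ x i.succ j.succ) x =
      partialD k (fun y => γ (x 0) y i j) (euclTail n x) :=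
  partialD_succ_split (F := fun s y => γ s y i j) ((h.smooth i j).differentiableAt (by simp)) k

theorem partialD_blockMetric_zero_succ (i : Fin n) (k : Fin (n + 1)) :
    partialD k (fun x => blockMetric W γ x 0 i.succ) x = 0 := partialD_zero_fun k x

theorem partialD_blockMetric_succ_zero (i : Fin n) (k : Fin (n + 1)) :
    partialD k (fun x => blockMetric W γ x i.succ 0) x = 0 := partialD_zero_fun k x

theorem blockMetric_inv (h : BlockRegular W γ (x 0) (euclTail n x)) :
    (blockMetric W γ x)⁻¹ = blockMat (W (x 0))⁻¹ (γ (x 0) (euclTail n x))⁻¹ :=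
  blockMat_inv h.W_ne h.det_ne

theorem christoffel_block_zero_zero_zero (h : BlockRegular W γ (x 0) (euclTail n x)) :
    christoffel (blockMetric W γ) 0 0 0 x = deriv W (x 0) / (2 * W (x 0)) := by
  simp only [christoffel, blockMetric_inv h, Fin.sum_univ_succ,
    partialD_blockMetric_zero_zero_zero h, blockMat_zero_zero, blockMat_zero_succ]
  have := h.W_ne
  simp only [zero_mul, Finset.sum_const_zero, add_zero]
  field_simp
  ring

theorem christoffel_block_zero_zero_succ (h : BlockRegular W γ (x 0) (euclTail n x)) (i : Fin n) :
    christoffel (blockMetric W γ) 0 0 i.succ x = 0 := by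
  simp [christoffel, blockMetric_inv h, Fin.sum_univ_succ, partialD_blockMetric_succ_zero,
    partialD_blockMetric_zero_succ, partialD_blockMetric_succ_zero_zero h]

theorem christoffel_block_zero_succ_zero (h : BlockRegular W γ (x 0) (euclTail n x)) (i : Fin n) :
    christoffel (blockMetric W γ) 0 i.succ 0 x = 0 := by
  simp [christoffel, blockMetric_inv h, Fin.sum_univ_succ, partialD_blockMetric_succ_zero,
    partialD_blockMetric_zero_succ, partialD_blockMetric_succ_zero_zero h]

theorem christoffel_block_zero_succ_succ (h : BlockRegular W γ (x 0) (euclTail n x))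
    (i j : Fin n) : christoffel (blockMetric W γ) 0 i.succ j.succ x =
      -((2 * W (x 0))⁻¹ * matDeriv γ (x 0) (euclTail n x) i j) := by
  simp only [christoffel, blockMetric_inv h, Fin.sum_univ_succ, partialD_blockMetric_succ_zero,
    partialD_blockMetric_zero_succ_succ h, blockMat_zero_zero, blockMat_zero_succ, zero_mul,
    Finset.sum_const_zero, mul_inv]
  ring

theorem christoffel_block_succ_zero_zero (h : BlockRegular W γ (x 0) (euclTail n x)) (i : Fin n) :
    christoffel (blockMetric W γ) i.succ 0 0 x = 0 := by
  simp [christoffel, blockMetric_inv h, Fin.sum_univ_succ, partialD_blockMetric_zero_succ,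
    partialD_blockMetric_succ_zero_zero h]

theorem christoffel_block_succ_zero_succ (h : BlockRegular W γ (x 0) (euclTail n x))
    (i j : Fin n) : christoffel (blockMetric W γ) i.succ 0 j.succ x =
      (1 / 2) * logDerivMat γ (x 0) (euclTail n x) i j := by
  simp only [christoffel, blockMetric_inv h, Fin.sum_univ_succ, partialD_blockMetric_zero_succ,
    partialD_blockMetric_zero_succ_succ h, blockMat_succ_zero, blockMat_succ_succ, zero_mul,
    logDerivMat, Matrix.mul_apply, zero_add, add_zero, sub_zero, h.matDeriv_symm.apply]

theorem christoffel_block_succ_succ_zero (h : BlockRegular W γ (x 0) (euclTail n x))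
    (i j : Fin n) : christoffel (blockMetric W γ) i.succ j.succ 0 x =
      (1 / 2) * logDerivMat γ (x 0) (euclTail n x) i j := by
  simp only [christoffel, blockMetric_inv h, Fin.sum_univ_succ, partialD_blockMetric_zero_succ,
    partialD_blockMetric_succ_zero,
    partialD_blockMetric_zero_succ_succ h, blockMat_succ_zero, blockMat_succ_succ, zero_mul,
    logDerivMat, Matrix.mul_apply, zero_add, sub_zero, h.matDeriv_symm.apply]

theorem christoffel_block_succ_succ_succ (h : BlockRegular W γ (x 0) (euclTail n x))
    (i j k : Fin n) : christoffel (blockMetric W γ) i.succ j.succ k.succ x =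
      christoffel (γ (x 0)) i j k (euclTail n x) := by
  simp only [christoffel, blockMetric_inv h, Fin.sum_univ_succ, blockMat_succ_zero,
    blockMat_succ_succ, partialD_blockMetric_succ_succ_succ h, zero_mul, zero_add]

end Christoffel

end Block

/-! ### Smooth dependence of curvature on parameters -/

section Parameters

variable {n : ℕ} {P : Type*} [NormedAddCommGroup P] [NormedSpace ℝ P]

theorem contDiffAt_partialD_snd {f : P × Eucl n → ℝ} {q : P × Eucl n} (h : ContDiffAt ℝ ∞ f q)
    (i : Fin n) :
    ContDiffAt ℝ ∞ (fun q : P × Eucl n => partialD i (fun y => f (q.1, y)) q.2) q := by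
  have h1 : ContDiffAt ℝ ∞ (fun q => fderiv ℝ f q (0, EuclideanSpace.single i 1)) q :=
    (h.fderiv_right (by simp)).clm_apply contDiffAt_const
  refine h1.congr_of_eventuallyEq ?_
  have h2 : ∀ᶠ q in 𝓝 q, ContDiffAt ℝ 1 f q :=
    (h.of_le (by exact_mod_cast le_top)).eventually (by simp)
  filter_upwards [h2] with q hq
  have h3 : HasFDerivAt (fun y => f (q.1, y)) _ q.2 :=
    (hq.differentiableAt (by simp)).hasFDerivAt.comp (f := fun y => (q.1, y)) q.2
    ((hasFDerivAt_const q.1 q.2).prodMk (hasFDerivAt_id q.2))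
  rw [partialD, h3.fderiv]
  simp

theorem contDiffAt_christoffel_param {G : P → Eucl n → Matrix (Fin n) (Fin n) ℝ}
    {q : P × Eucl n} (hG : ∀ i j, ContDiffAt ℝ ∞ (fun q : P × Eucl n => G q.1 q.2 i j) q)
    (hx : (G q.1 q.2).det ≠ 0) (k i j : Fin n) :
    ContDiffAt ℝ ∞ (fun q : P × Eucl n => christoffel (G q.1) k i j q.2) q := by
  unfold christoffel
  exact contDiffAt_const.mul (ContDiffAt.sum fun l _ => (contDiffAt_matrix_inv hG hx k l).mul
    (((contDiffAt_partialD_snd (hG _ _) _).add (contDiffAt_partialD_snd (hG _ _) _)).sub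
      (contDiffAt_partialD_snd (hG _ _) _)))

theorem contDiffAt_coordScalar_param {G : P → Eucl n → Matrix (Fin n) (Fin n) ℝ}
    {q : P × Eucl n} (hG : ∀ i j, ContDiffAt ℝ ∞ (fun q : P × Eucl n => G q.1 q.2 i j) q)
    (hx : (G q.1 q.2).det ≠ 0) :
    ContDiffAt ℝ ∞ (fun q : P × Eucl n => coordScalar (G q.1) q.2) q := by
  have h := contDiffAt_christoffel_param hG hx
  unfold coordScalar coordRicci
  exact ContDiffAt.sum fun i _ => ContDiffAt.sum fun j _ => (contDiffAt_matrix_inv hG hx i j).mul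
    ((ContDiffAt.sum fun k _ => (contDiffAt_partialD_snd (h _ _ _) _).sub
      (contDiffAt_partialD_snd (h _ _ _) _)).add
      (ContDiffAt.sum fun k _ => ContDiffAt.sum fun l _ =>
        ((h _ _ _).mul (h _ _ _)).sub ((h _ _ _).mul (h _ _ _))))

end Parameters

/-! ### Ricci and scalar curvature of `W(s) ds² + γ(s, y)` -/

section BlockScalar

variable {n : ℕ} {W : ℝ → ℝ} {γ : ℝ → Eucl n → Matrix (Fin n) (Fin n) ℝ} {x : Eucl (n + 1)}

theorem BlockRegular.contDiffAt_matDeriv_slice (h : BlockRegular W γ (x 0) (euclTail n x)) (i j : Fin n) :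
    ContDiffAt ℝ ∞ (fun s => matDeriv γ s (euclTail n x) i j) (x 0) :=
  ContDiffAt.comp (g := fun q : ℝ × Eucl n => matDeriv γ q.1 q.2 i j)
    (f := fun s => (s, euclTail n x)) (x 0) (h.contDiffAt_matDeriv i j) (contDiffAt_id.prodMk contDiffAt_const)

theorem BlockRegular.contDiffAt_logDerivMat_slice (h : BlockRegular W γ (x 0) (euclTail n x))
    (i j : Fin n) : ContDiffAt ℝ ∞ (fun s => logDerivMat γ s (euclTail n x) i j) (x 0) :=
  ContDiffAt.comp (g := fun q : ℝ × Eucl n => logDerivMat γ q.1 q.2 i j)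
    (f := fun s => (s, euclTail n x)) (x 0) (h.contDiffAt_logDerivMat i j) (contDiffAt_id.prodMk contDiffAt_const)

theorem eventually_blockRegular
    (hr : ∀ᶠ q : ℝ × Eucl n in 𝓝 (x 0, euclTail n x), BlockRegular W γ q.1 q.2) :
    ∀ᶠ x' : Eucl (n + 1) in 𝓝 x, BlockRegular W γ (x' 0) (euclTail n x') :=
  (euclSplit n).continuous.continuousAt.eventually hr

/-- The traced Riccati equation of the slices `s = const`, whose shape operator is proportional to
`γ⁻¹ ∂ₛγ`; the term with `W'` appears because `s` is not arc length. -/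
theorem coordRicci_block_zero_zero
    (hr : ∀ᶠ q : ℝ × Eucl n in 𝓝 (x 0, euclTail n x), BlockRegular W γ q.1 q.2) :
    coordRicci (blockMetric W γ) 0 0 x =
      -(1 / 2) * deriv (fun s => (logDerivMat γ s (euclTail n x)).trace) (x 0)
      + (1 / 2) * (logDerivMat γ (x 0) (euclTail n x)).trace * (deriv W (x 0) / (2 * W (x 0)))
      - (1 / 4) * (logDerivMat γ (x 0) (euclTail n x) *
          logDerivMat γ (x 0) (euclTail n x)).trace := by
  have h := hr.self_of_nhds
  have hr' := eventually_blockRegular hr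
  have e1 : ∀ k : Fin n, partialD k.succ (christoffel (blockMetric W γ) k.succ 0 0) x = 0 :=
    fun k => (partialD_congr (hr'.mono fun y hy => christoffel_block_succ_zero_zero hy k) _).trans
      (partialD_zero_fun _ _)
  have e2 : ∀ k : Fin n, partialD 0 (christoffel (blockMetric W γ) k.succ 0 k.succ) x =
      (1 / 2) * deriv (fun s => logDerivMat γ s (euclTail n x) k k) (x 0) := by
    intro k
    rw [partialD_congr (hr'.mono fun y hy => christoffel_block_succ_zero_succ hy k k),
      partialD_zero_split (F := fun s y => 1 / 2 * logDerivMat γ s y k k)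
        ((contDiffAt_const.mul (h.contDiffAt_logDerivMat k k)).differentiableAt (by simp))]
    exact deriv_const_mul _ ((h.contDiffAt_logDerivMat_slice k k).differentiableAt (by simp))
  have e3 : deriv (fun s => (logDerivMat γ s (euclTail n x)).trace) (x 0) =
      ∑ k, deriv (fun s => logDerivMat γ s (euclTail n x) k k) (x 0) := by
    simp only [Matrix.trace, Matrix.diag_apply]
    exact deriv_fun_sum fun k _ => (h.contDiffAt_logDerivMat_slice k k).differentiableAt (by simp)
  rw [e3]
  simp only [coordRicci, Fin.sum_univ_succ, e1, e2, christoffel_block_zero_zero_zero h,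
    christoffel_block_zero_zero_succ h, christoffel_block_succ_zero_zero h,
    christoffel_block_succ_zero_succ h,
    christoffel_block_succ_succ_zero h, Matrix.trace, Matrix.diag_apply, Matrix.mul_apply]
  simp only [mul_zero, sub_zero, Finset.sum_const_zero, add_zero, zero_sub, sub_self,
    zero_add, Finset.sum_neg_distrib, Finset.sum_add_distrib,
    ← Finset.mul_sum, ← Finset.sum_mul]
  have e4 : ∑ i, ∑ j, 1 / 2 * logDerivMat γ (x 0) (euclTail n x) i j *
      (1 / 2 * logDerivMat γ (x 0) (euclTail n x) j i) = 1 / 4 * ∑ i, ∑ j,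
      logDerivMat γ (x 0) (euclTail n x) i j * logDerivMat γ (x 0) (euclTail n x) j i := by
    simp only [Finset.mul_sum]
    exact Finset.sum_congr rfl fun i _ => Finset.sum_congr rfl fun j _ => by ring
  rw [e4]
  ring

/-- A Gauss-type equation: the intrinsic Ricci curvature of the slice plus terms from its second
fundamental form and the normal derivative of that form. -/
theorem coordRicci_block_succ_succ
    (hr : ∀ᶠ q : ℝ × Eucl n in 𝓝 (x 0, euclTail n x), BlockRegular W γ q.1 q.2) (i j : Fin n) :
    coordRicci (blockMetric W γ) i.succ j.succ x = coordRicci (γ (x 0)) i j (euclTail n x)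
      - (2 * W (x 0))⁻¹ * deriv (fun s => matDeriv γ s (euclTail n x) i j) (x 0)
      + (deriv W (x 0) / (4 * W (x 0) ^ 2)
          - (4 * W (x 0))⁻¹ * (logDerivMat γ (x 0) (euclTail n x)).trace)
        * matDeriv γ (x 0) (euclTail n x) i j
      + (2 * W (x 0))⁻¹ * (matDeriv γ (x 0) (euclTail n x) *
          logDerivMat γ (x 0) (euclTail n x)) i j := by
  have h := hr.self_of_nhds
  have hr' := eventually_blockRegular hr
  have hW : W (x 0) ≠ 0 := h.W_ne
  have hsm := fun k i j => (contDiffAt_christoffel_param (q := (x 0, euclTail n x)) h.smooth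
    h.det_ne k i j).differentiableAt (by simp)
  have e1 : partialD 0 (christoffel (blockMetric W γ) 0 i.succ j.succ) x =
      deriv W (x 0) / (2 * W (x 0) ^ 2) * matDeriv γ (x 0) (euclTail n x) i j -
        (2 * W (x 0))⁻¹ * deriv (fun s => matDeriv γ s (euclTail n x) i j) (x 0) := by
    have d1 : ContDiffAt ℝ ∞ (fun q : ℝ × Eucl n => W q.1) (x 0, euclTail n x) :=
      ContDiffAt.comp (x 0, euclTail n x) h.smooth_W contDiffAt_fst
    rw [partialD_congr (hr'.mono fun y hy => christoffel_block_zero_succ_succ hy i j),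
      partialD_zero_split (F := fun s y => -((2 * W s)⁻¹ * matDeriv γ s y i j))
        ((((contDiffAt_const.mul d1).inv (mul_ne_zero two_ne_zero hW)).mul
          (h.contDiffAt_matDeriv i j)).neg.differentiableAt (by simp))]
    have h1 := (h.smooth_W.differentiableAt (by simp)).hasDerivAt
    have h2 := ((h.contDiffAt_matDeriv_slice i j).differentiableAt (by simp)).hasDerivAt
    have h3 := ((((h1.const_mul 2).fun_inv (mul_ne_zero two_ne_zero hW))).mul h2).neg
    refine h3.deriv.trans ?_
    field_simp
    ring
  have e2 : ∀ k : Fin n, partialD k.succ (christoffel (blockMetric W γ) k.succ i.succ j.succ) x =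
      partialD k (christoffel (γ (x 0)) k i j) (euclTail n x) := fun k => by
    rw [partialD_congr (hr'.mono fun y hy => christoffel_block_succ_succ_succ hy k i j)]
    exact partialD_succ_split (F := fun s y => christoffel (γ s) k i j y) (hsm k i j) k
  have e3 : partialD j.succ (christoffel (blockMetric W γ) 0 i.succ 0) x = 0 :=
    (partialD_congr (hr'.mono fun y hy => christoffel_block_zero_succ_zero hy i) _).trans
      (partialD_zero_fun _ _)
  have e4 : ∀ k : Fin n, partialD j.succ (christoffel (blockMetric W γ) k.succ i.succ k.succ) x =
      partialD j (christoffel (γ (x 0)) k i k) (euclTail n x) := fun k => by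
    rw [partialD_congr (hr'.mono fun y hy => christoffel_block_succ_succ_succ hy k i k)]
    exact partialD_succ_split (F := fun s y => christoffel (γ s) k i k y) (hsm k i k) j
  have e5 : ∑ k, 1 / 2 * logDerivMat γ (x 0) (euclTail n x) k j *
      -((2 * W (x 0))⁻¹ * matDeriv γ (x 0) (euclTail n x) i k) =
      -((4 * W (x 0))⁻¹ * (matDeriv γ (x 0) (euclTail n x) *
        logDerivMat γ (x 0) (euclTail n x)) i j) := by
    rw [Matrix.mul_apply, Finset.mul_sum, ← Finset.sum_neg_distrib]
    refine Finset.sum_congr rfl fun k _ => ?_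
    field_simp
    ring
  have e6 : ∑ k, -((2 * W (x 0))⁻¹ * matDeriv γ (x 0) (euclTail n x) j k) *
      (1 / 2 * logDerivMat γ (x 0) (euclTail n x) k i) =
      -((4 * W (x 0))⁻¹ * (matDeriv γ (x 0) (euclTail n x) *
        logDerivMat γ (x 0) (euclTail n x)) i j) := by
    -- `γ' γ⁻¹ γ'` is symmetric, so the two quadratic contributions, which differ by exchanging `i`
    -- and `j`, coincide.
    have hs : (matDeriv γ (x 0) (euclTail n x) * logDerivMat γ (x 0) (euclTail n x)).IsSymm := by
      rw [Matrix.IsSymm, logDerivMat, Matrix.transpose_mul, Matrix.transpose_mul,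
        Matrix.transpose_nonsing_inv, h.matDeriv_symm.eq, h.symm.self_of_nhds.eq, Matrix.mul_assoc]
    rw [← hs.apply, Matrix.mul_apply, Finset.mul_sum, ← Finset.sum_neg_distrib]
    refine Finset.sum_congr rfl fun k _ => ?_
    field_simp
    ring
  simp only [coordRicci, Fin.sum_univ_succ, e1, e2, e3, e4, christoffel_block_zero_zero_zero h,
    christoffel_block_zero_zero_succ h, christoffel_block_zero_succ_zero h,
    christoffel_block_zero_succ_succ h, christoffel_block_succ_succ_zero h,
    christoffel_block_succ_succ_succ h]
  simp only [zero_mul, mul_zero, sub_zero, Finset.sum_add_distrib,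
    Finset.sum_sub_distrib, e5, e6, zero_sub, Finset.sum_neg_distrib]
  simp only [← Finset.sum_mul, ← Finset.mul_sum, Matrix.trace, Matrix.diag_apply]
  field_simp
  ring

/-- The scalar curvature of the metric `W(s) ds² + γ(s, y)`. -/
theorem coordScalar_blockMetric
    (hr : ∀ᶠ q : ℝ × Eucl n in 𝓝 (x 0, euclTail n x), BlockRegular W γ q.1 q.2) :
    coordScalar (blockMetric W γ) x = coordScalar (γ (x 0)) (euclTail n x) + (W (x 0))⁻¹ *
      (-deriv (fun s => (logDerivMat γ s (euclTail n x)).trace) (x 0)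
        + deriv W (x 0) / (2 * W (x 0)) * (logDerivMat γ (x 0) (euclTail n x)).trace
        - (1 / 4) * (logDerivMat γ (x 0) (euclTail n x) *
          logDerivMat γ (x 0) (euclTail n x)).trace
        - (1 / 4) * (logDerivMat γ (x 0) (euclTail n x)).trace ^ 2) := by
  have h := hr.self_of_nhds
  have hW : W (x 0) ≠ 0 := h.W_ne
  set g := γ (x 0) (euclTail n x) with hg
  set g' := matDeriv γ (x 0) (euclTail n x) with hg'
  set K := logDerivMat γ (x 0) (euclTail n x) with hK
  have hgd : IsUnit g.det := isUnit_iff_ne_zero.2 h.det_ne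
  set K' : Matrix (Fin n) (Fin n) ℝ :=
    Matrix.of fun i j => deriv (fun s => logDerivMat γ s (euclTail n x) i j) (x 0) with hK'
  set g'' : Matrix (Fin n) (Fin n) ℝ :=
    Matrix.of fun i j => deriv (fun s => matDeriv γ s (euclTail n x) i j) (x 0) with hg''
  have e3 : deriv (fun s => (logDerivMat γ s (euclTail n x)).trace) (x 0) = K'.trace := by
    simp only [Matrix.trace, Matrix.diag_apply]
    exact deriv_fun_sum fun k _ => (h.contDiffAt_logDerivMat_slice k k).differentiableAt (by simp)
  -- Differentiating `γ' = γ K` eliminates the second derivative of `γ`; after taking traces only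
  -- `(tr K)'` and `tr K²` remain.
  have e4 : g'' = g' * K + g * K' := by
    ext i j
    have h1 : ∀ᶠ s in 𝓝 (x 0), matDeriv γ s (euclTail n x) i j =
        ∑ l, γ s (euclTail n x) i l * logDerivMat γ s (euclTail n x) l j := by
      have h2 : ∀ᶠ s in 𝓝 (x 0), BlockRegular W γ s (euclTail n x) :=
        (continuousAt_id.prodMk continuousAt_const :
          ContinuousAt (fun s : ℝ => (s, euclTail n x)) (x 0)).eventually hr
      filter_upwards [h2] with s hs
      rw [← Matrix.mul_apply, logDerivMat, ← Matrix.mul_assoc,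
        Matrix.mul_nonsing_inv _ (isUnit_iff_ne_zero.2 hs.det_ne), Matrix.one_mul]
    simp only [hg'', Matrix.of_apply, EventuallyEq.deriv_eq h1, Matrix.add_apply, Matrix.mul_apply,
      ← Finset.sum_add_distrib]
    rw [deriv_fun_sum]
    · refine Finset.sum_congr rfl fun l _ => ?_
      exact deriv_fun_mul (((h.smooth i l).comp (x 0) (contDiffAt_id.prodMk
        contDiffAt_const)).differentiableAt (by simp))
        ((h.contDiffAt_logDerivMat_slice l j).differentiableAt (by simp))
    · exact fun l _ => (((h.smooth i l).comp (x 0) (contDiffAt_id.prodMk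
        contDiffAt_const)).differentiableAt (by simp)).mul
        ((h.contDiffAt_logDerivMat_slice l j).differentiableAt (by simp))
  have e5 : ∀ A : Matrix (Fin n) (Fin n) ℝ, ∑ i, ∑ j, g⁻¹ i j * A i j = (g⁻¹ * A).trace := by
    intro A
    have hs : (g⁻¹).IsSymm := by
      rw [Matrix.IsSymm, Matrix.transpose_nonsing_inv, h.symm.self_of_nhds.eq]
    simp only [Matrix.trace, Matrix.diag_apply, Matrix.mul_apply]
    rw [Finset.sum_comm]
    exact Finset.sum_congr rfl fun i _ => Finset.sum_congr rfl fun j _ => by rw [hs.apply]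
  have e6 : g⁻¹ * g' = K := rfl
  have e7 : g⁻¹ * g'' = K * K + K' := by
    rw [e4, Matrix.mul_add, ← Matrix.mul_assoc, ← Matrix.mul_assoc, Matrix.nonsing_inv_mul _ hgd,
      Matrix.one_mul, e6]
  have e8 : ∑ i, ∑ j, g⁻¹ i j * coordRicci (blockMetric W γ) i.succ j.succ x =
      coordScalar (γ (x 0)) (euclTail n x) - (2 * W (x 0))⁻¹ * (K * K + K').trace
        + (deriv W (x 0) / (4 * W (x 0) ^ 2) - (4 * W (x 0))⁻¹ * K.trace) * K.trace
        + (2 * W (x 0))⁻¹ * (K * K).trace := by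
    have e9 : ∀ i j, g⁻¹ i j * coordRicci (blockMetric W γ) i.succ j.succ x =
        g⁻¹ i j * coordRicci (γ (x 0)) i j (euclTail n x) - (2 * W (x 0))⁻¹ * (g⁻¹ i j * g'' i j)
        + (deriv W (x 0) / (4 * W (x 0) ^ 2) - (4 * W (x 0))⁻¹ * K.trace) * (g⁻¹ i j * g' i j)
        + (2 * W (x 0))⁻¹ * (g⁻¹ i j * (g' * K) i j) := fun i j => by
      rw [coordRicci_block_succ_succ hr]
      simp only [hg'', Matrix.of_apply]
      ring
    simp only [e9, Finset.sum_add_distrib, Finset.sum_sub_distrib, ← Finset.mul_sum, e5, e6, e7,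
      ← Matrix.mul_assoc]
    rfl
  rw [coordScalar, Fin.sum_univ_succ]
  simp only [Fin.sum_univ_succ, blockMetric_inv h, blockMat_zero_zero, blockMat_zero_succ,
    blockMat_succ_zero, blockMat_succ_succ, zero_mul, Finset.sum_const_zero, add_zero, zero_add]
  rw [e8, coordRicci_block_zero_zero hr, e3, ← hK, Matrix.trace_add]
  field_simp
  ring

end BlockScalar

/-! ### The radial form `ds² / (s² F) + (ρ s)² H` -/

section RadialBlock

variable {n : ℕ}

/-- A constant factor cancels in the Christoffel symbols, hence in the Ricci tensor, and survives
only in the last contraction. -/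
theorem coordScalar_const_smul {c : ℝ} (hc : c ≠ 0) (G : Eucl n → Matrix (Fin n) (Fin n) ℝ)
    (x : Eucl n) : coordScalar (fun y => c • G y) x = c⁻¹ * coordScalar G x := by
  classical
  have hinv : ∀ y i j, (c • G y)⁻¹ i j = c⁻¹ * (G y)⁻¹ i j := by
    intro y i j
    by_cases h : IsUnit (G y).det
    · have : (c • G y)⁻¹ = c⁻¹ • (G y)⁻¹ := by
        refine Matrix.inv_eq_right_inv ?_
        rw [Matrix.smul_mul, Matrix.mul_smul, Matrix.mul_nonsing_inv _ h, smul_smul,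
          mul_inv_cancel₀ hc, one_smul]
      rw [this, Matrix.smul_apply, smul_eq_mul]
    -- For a singular matrix both inverses are `0` by convention, so the scaling rule still holds
    -- and nondegeneracy need not be assumed.
    · have h' : ¬ IsUnit (c • G y).det := by
        rw [Matrix.det_smul, isUnit_iff_ne_zero] at *
        simp only [ne_eq, mul_eq_zero, not_or, not_and, not_not] at h ⊢
        exact fun _ => h
      rw [Matrix.nonsing_inv_apply_not_isUnit _ h, Matrix.nonsing_inv_apply_not_isUnit _ h']
      simp
  have hchr : ∀ k i j, christoffel (fun y => c • G y) k i j = christoffel G k i j := by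
    intro k i j
    funext y
    have hp : ∀ l a b, partialD l (fun y => (c • G y) a b) y =
        c * partialD l (fun y => G y a b) y := fun l a b => by
      have h1 := fderiv_const_smul_field (𝕜 := ℝ) (f := fun y => G y a b) c
      have h2 := congrArg (fun T : Eucl n → Eucl n →L[ℝ] ℝ => T y (EuclideanSpace.single l 1)) h1
      exact h2
    simp only [christoffel, hp, hinv]
    congr 1
    refine Finset.sum_congr rfl fun l _ => ?_
    field_simp
  simp only [coordScalar, coordRicci, hchr, hinv, Finset.mul_sum, mul_assoc]

theorem BlockRegular.of_radial {F : ℝ → ℝ} {H : ℝ → Eucl n → Matrix (Fin n) (Fin n) ℝ} {ρ s : ℝ}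
    {y : Eucl n} (hρ : 0 < ρ) (hs : 0 < s) (h : BlockRegular F H s y) :
    BlockRegular (fun s => (s ^ 2 * F s)⁻¹) (fun s y => (ρ * s) ^ 2 • H s y) s y where
  smooth_W := ((contDiffAt_id.pow 2).mul h.smooth_W).inv (mul_ne_zero (pow_ne_zero 2 hs.ne') h.W_ne)
  smooth i j := by
    simp only [Matrix.smul_apply, smul_eq_mul]
    exact ((contDiffAt_const.mul contDiffAt_fst).pow 2).mul (h.smooth i j)
  symm := h.symm.mono fun q hq => hq.smul _
  W_ne := inv_ne_zero (mul_ne_zero (pow_ne_zero 2 hs.ne') h.W_ne)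
  det_ne := by
    rw [Matrix.det_smul]
    exact mul_ne_zero (pow_ne_zero _ (pow_ne_zero 2 (mul_pos hρ hs).ne')) h.det_ne

/-- Logarithmic derivatives add under multiplication by the scalar `(ρ s)²`, which contributes `2 /
s`; the scale `ρ` drops out. -/
theorem logDerivMat_radial {F : ℝ → ℝ} {H : ℝ → Eucl n → Matrix (Fin n) (Fin n) ℝ} {ρ s : ℝ}
    {y : Eucl n} (hρ : 0 < ρ) (hs : 0 < s) (h : BlockRegular F H s y) :
    logDerivMat (fun s y => (ρ * s) ^ 2 • H s y) s y = (2 / s) • 1 + logDerivMat H s y := by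
  have hρs : (ρ * s) ^ 2 ≠ 0 := pow_ne_zero 2 (mul_pos hρ hs).ne'
  have hu := isUnit_iff_ne_zero.2 h.det_ne
  have h1 : ((ρ * s) ^ 2 • H s y)⁻¹ = ((ρ * s) ^ 2)⁻¹ • (H s y)⁻¹ := by
    refine Matrix.inv_eq_right_inv ?_
    rw [Matrix.smul_mul, Matrix.mul_smul, Matrix.mul_nonsing_inv _ hu, smul_smul,
      mul_inv_cancel₀ hρs, one_smul]
  have h2 : matDeriv (fun s y => (ρ * s) ^ 2 • H s y) s y =
      (2 * ρ ^ 2 * s) • H s y + (ρ * s) ^ 2 • matDeriv H s y := by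
    ext i j
    simp only [matDeriv, Matrix.of_apply, Matrix.smul_apply, Matrix.add_apply, smul_eq_mul]
    have d1 : HasDerivAt (fun s : ℝ => (ρ * s) ^ 2) (2 * ρ ^ 2 * s) s := by
      refine (((hasDerivAt_id s).const_mul ρ).pow 2).congr_deriv ?_
      simp only [id_eq]; push_cast; ring
    have d2 : HasDerivAt (fun s => H s y i j) _ s :=
      ((ContDiffAt.comp (g := fun q : ℝ × Eucl n => H q.1 q.2 i j) (f := fun s => (s, y)) s
        (h.smooth i j) (contDiffAt_id.prodMk contDiffAt_const)).differentiableAt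
          (by simp)).hasDerivAt
    exact (d1.mul d2).deriv
  rw [logDerivMat, h1, h2, Matrix.mul_add, Matrix.smul_mul, Matrix.mul_smul, Matrix.smul_mul,
    Matrix.mul_smul, Matrix.nonsing_inv_mul _ hu, smul_smul, smul_smul, inv_mul_cancel₀ hρs,
    one_smul, logDerivMat]
  congr 2
  field_simp

/-- The scalar curvature of the metric `ds² / (s² F(s)) + (ρ s)² H(s, y)`. -/
theorem coordScalar_radial {F : ℝ → ℝ} {H : ℝ → Eucl n → Matrix (Fin n) (Fin n) ℝ} {ρ : ℝ}
    {x : Eucl (n + 1)} (hρ : 0 < ρ) (hx : 0 < x 0)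
    (hr : ∀ᶠ q : ℝ × Eucl n in 𝓝 (x 0, euclTail n x), BlockRegular F H q.1 q.2) :
    coordScalar (blockMetric (fun s => (s ^ 2 * F s)⁻¹) fun s y => (ρ * s) ^ 2 • H s y) x =
      ((ρ * x 0) ^ 2)⁻¹ * coordScalar (H (x 0)) (euclTail n x)
        - n * (x 0 * deriv F (x 0) + (n + 1) * F (x 0))
        - F (x 0) * (x 0 ^ 2 * deriv (fun s => (logDerivMat H s (euclTail n x)).trace) (x 0)
          + (n + 2) * x 0 * (logDerivMat H (x 0) (euclTail n x)).trace
          + x 0 ^ 2 / 4 * ((logDerivMat H (x 0) (euclTail n x) *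
              logDerivMat H (x 0) (euclTail n x)).trace
            + (logDerivMat H (x 0) (euclTail n x)).trace ^ 2))
        - x 0 ^ 2 / 2 * deriv F (x 0) * (logDerivMat H (x 0) (euclTail n x)).trace := by
  have h := hr.self_of_nhds
  have hF : F (x 0) ≠ 0 := h.W_ne
  have hpos : ∀ᶠ q : ℝ × Eucl n in 𝓝 (x 0, euclTail n x), 0 < q.1 :=
    (continuous_fst.tendsto _).eventually (lt_mem_nhds hx)
  rw [coordScalar_blockMetric (by
    filter_upwards [hr, hpos] with q hq hq0 using hq.of_radial hρ hq0)]
  have hW : deriv (fun s => (s ^ 2 * F s)⁻¹) (x 0) =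
      -(2 * x 0 * F (x 0) + x 0 ^ 2 * deriv F (x 0)) / (x 0 ^ 2 * F (x 0)) ^ 2 := by
    have d := (((hasDerivAt_pow 2 (x 0)).mul (h.smooth_W.differentiableAt
      (by simp)).hasDerivAt).fun_inv (mul_ne_zero (pow_ne_zero 2 hx.ne') hF)).deriv
    refine d.trans ?_
    simp
  have hK := logDerivMat_radial hρ hx h
  have hKs : (fun s => (logDerivMat (fun s y => (ρ * s) ^ 2 • H s y) s (euclTail n x)).trace)
      =ᶠ[𝓝 (x 0)] fun s => n * (2 * s⁻¹) + (logDerivMat H s (euclTail n x)).trace := by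
    have h2 : ∀ᶠ s in 𝓝 (x 0), BlockRegular F H s (euclTail n x) ∧ 0 < s :=
      (continuousAt_id.prodMk continuousAt_const :
        ContinuousAt (fun s : ℝ => (s, euclTail n x)) (x 0)).eventually (hr.and hpos)
    filter_upwards [h2] with s hs
    rw [logDerivMat_radial hρ hs.2 hs.1, Matrix.trace_add, Matrix.trace_smul, Matrix.trace_one,
      Fintype.card_fin, smul_eq_mul]
    ring
  have hKd : deriv (fun s => (logDerivMat (fun s y => (ρ * s) ^ 2 • H s y) s
      (euclTail n x)).trace) (x 0) = -(2 * n / x 0 ^ 2)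
        + deriv (fun s => (logDerivMat H s (euclTail n x)).trace) (x 0) := by
    rw [hKs.deriv_eq]
    have d1 : HasDerivAt (fun s : ℝ => n * (2 * s⁻¹)) (-(2 * n / x 0 ^ 2)) (x 0) := by
      refine (((hasDerivAt_inv hx.ne').const_mul 2).const_mul (n : ℝ)).congr_deriv ?_
      field_simp
    have d2 : DifferentiableAt ℝ (fun s => (logDerivMat H s (euclTail n x)).trace) (x 0) := by
      simp only [Matrix.trace, Matrix.diag_apply]
      exact DifferentiableAt.fun_sum fun k _ =>
        (h.contDiffAt_logDerivMat_slice k k).differentiableAt (by simp)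
    exact (d1.add d2.hasDerivAt).deriv
  rw [coordScalar_const_smul (pow_ne_zero 2 (mul_pos hρ hx).ne'), hW, hK, hKd]
  set B := logDerivMat H (x 0) (euclTail n x) with hB
  have t1 : ((2 / x 0) • (1 : Matrix (Fin n) (Fin n) ℝ) + B).trace = 2 * n / x 0 + B.trace := by
    rw [Matrix.trace_add, Matrix.trace_smul, Matrix.trace_one, Fintype.card_fin, smul_eq_mul]
    ring
  have t2 : (((2 / x 0) • (1 : Matrix (Fin n) (Fin n) ℝ) + B) *
      ((2 / x 0) • (1 : Matrix (Fin n) (Fin n) ℝ) + B)).trace =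
      4 * n / x 0 ^ 2 + 4 / x 0 * B.trace + (B * B).trace := by
    simp only [Matrix.mul_add, Matrix.add_mul, Matrix.smul_mul, Matrix.mul_smul, Matrix.one_mul,
      Matrix.mul_one, Matrix.trace_add, Matrix.trace_smul, Matrix.trace_one, Fintype.card_fin,
      smul_eq_mul]
    ring
  rw [t1, t2]
  have hx' : x 0 ≠ 0 := hx.ne'
  field_simp
  ring

end RadialBlock

/-! ### Polar coordinates in Euclidean space -/

section PolarCoordinates

variable {m : ℕ}

theorem contDiffAt_polarTheta {x : Eucl m} (hx : x ≠ 0) : ContDiffAt ℝ ∞ polarTheta x :=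
  ((contDiffAt_norm ℝ hx).inv (norm_ne_zero_iff.2 hx)).smul contDiffAt_id

theorem norm_polarTheta {x : Eucl m} (hx : x ≠ 0) : ‖polarTheta x‖ = 1 := by
  rw [polarTheta, norm_smul, norm_inv, norm_norm, inv_mul_cancel₀ (norm_ne_zero_iff.2 hx)]

theorem norm_smul_polarTheta {x : Eucl m} (hx : x ≠ 0) : ‖x‖ • polarTheta x = x := by
  rw [polarTheta, smul_smul, mul_inv_cancel₀ (norm_ne_zero_iff.2 hx), one_smul]

theorem polarTheta_smul {c : ℝ} (hc : 0 < c) (x : Eucl m) :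
    polarTheta (c • x) = polarTheta x := by
  rw [polarTheta, polarTheta, norm_smul, Real.norm_of_nonneg hc.le, mul_inv, smul_smul,
    mul_right_comm, inv_mul_cancel₀ hc.ne', one_mul]

theorem polarTheta_of_norm_eq_one {x : Eucl m} (hx : ‖x‖ = 1) : polarTheta x = x := by
  rw [polarTheta, hx, inv_one, one_smul]

/-- The derivative of `x = |x| θ(x)`, splitting `u` into its radial and angular parts. Pairing it
with `θ`, which is orthogonal to the angular part, yields the explicit formulas for `d|x|` and `dθ`.
-/
theorem fderiv_norm_smul_add {x : Eucl m} (hx : x ≠ 0) (u : Eucl m) :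
    fderiv ℝ (fun y : Eucl m => ‖y‖) x u • polarTheta x + ‖x‖ • fderiv ℝ polarTheta x u = u := by
  have h1 := ((contDiffAt_norm ℝ hx (n := ∞)).differentiableAt (by simp)).hasFDerivAt
  have h2 := ((contDiffAt_polarTheta hx).differentiableAt (by simp)).hasFDerivAt
  have h3 : (fun y : Eucl m => ‖y‖ • polarTheta y) =ᶠ[𝓝 x] id :=
    (eventually_ne_nhds hx).mono fun y hy => norm_smul_polarTheta hy
  have h4 := (h1.smul h2).fderiv
  have h5 := h3.fderiv_eq (𝕜 := ℝ)
  rw [show fderiv ℝ (fun y : Eucl m => ‖y‖ • polarTheta y) x = _ from h4, fderiv_id] at h5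
  have := congrArg (fun T : Eucl m →L[ℝ] Eucl m => T u) h5
  simp only [add_apply, smul_apply, ContinuousLinearMap.smulRight_apply,
    ContinuousLinearMap.id_apply] at this
  rw [← add_comm]
  exact this

theorem inner_polarTheta_fderiv {x : Eucl m} (hx : x ≠ 0) (u : Eucl m) :
    inner ℝ (polarTheta x) (fderiv ℝ polarTheta x u) = 0 := by
  have h2 := ((contDiffAt_polarTheta hx).differentiableAt (by simp)).hasFDerivAt
  have h3 : (fun y : Eucl m => inner ℝ (polarTheta y) (polarTheta y)) =ᶠ[𝓝 x] fun _ => 1 :=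
    (eventually_ne_nhds hx).mono fun y hy => by
      simp only [real_inner_self_eq_norm_sq, norm_polarTheta hy, one_pow]
  have h5 := h3.fderiv_eq (𝕜 := ℝ)
  rw [(h2.inner ℝ h2).fderiv, fderiv_const_apply] at h5
  have := congrArg (fun T : Eucl m →L[ℝ] ℝ => T u) h5
  simp only [ContinuousLinearMap.comp_apply, ContinuousLinearMap.prod_apply,
    fderivInnerCLM_apply, zero_apply] at this
  rw [real_inner_comm (polarTheta x)] at this
  linarith

theorem fderiv_norm_apply {x : Eucl m} (hx : x ≠ 0) (u : Eucl m) :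
    fderiv ℝ (fun y : Eucl m => ‖y‖) x u = inner ℝ (polarTheta x) u := by
  have h := congrArg (fun v => inner ℝ (polarTheta x) v) (fderiv_norm_smul_add hx u)
  simp only [inner_add_right, inner_smul_right, inner_polarTheta_fderiv hx,
    real_inner_self_eq_norm_sq, norm_polarTheta hx] at h
  linarith

theorem fderiv_polarTheta_apply {x : Eucl m} (hx : x ≠ 0) (u : Eucl m) :
    fderiv ℝ polarTheta x u = ‖x‖⁻¹ • tangProj (polarTheta x) u := by
  have h := fderiv_norm_smul_add hx u
  rw [fderiv_norm_apply hx] at h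
  have h2 : tangProj (polarTheta x) u = ‖x‖ • fderiv ℝ polarTheta x u := by
    rw [tangProj, sub_eq_iff_eq_add', h]
  rw [h2, smul_smul, inv_mul_cancel₀ (norm_ne_zero_iff.2 hx), one_smul]

theorem inner_eq_polar {x : Eucl m} (hx : x ≠ 0) (u v : Eucl m) :
    inner ℝ u v = fderiv ℝ (fun y : Eucl m => ‖y‖) x u * fderiv ℝ (fun y : Eucl m => ‖y‖) x v
      + ‖x‖ ^ 2 * inner ℝ (fderiv ℝ polarTheta x u) (fderiv ℝ polarTheta x v) := by
  conv_lhs => rw [← fderiv_norm_smul_add hx u, ← fderiv_norm_smul_add hx v]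
  simp only [inner_add_left, inner_add_right, inner_smul_left, inner_smul_right,
    inner_polarTheta_fderiv hx, real_inner_self_eq_norm_sq, norm_polarTheta hx,
    real_inner_comm (polarTheta x) (fderiv ℝ polarTheta x u)]
  simp
  ring

/-- The bilinear form `W(r) dr² + r² β(r, θ)`. -/
noncomputable def polarForm (W : ℝ → ℝ) (β : ℝ → Eucl m → BilForm m) (x : Eucl m) : BilForm m :=
  W ‖x‖ • (fderiv ℝ (fun y : Eucl m => ‖y‖) x).smulRight (fderiv ℝ (fun y : Eucl m => ‖y‖) x)
    + ‖x‖ ^ 2 • (β ‖x‖ (polarTheta x)).bilinearComp (fderiv ℝ polarTheta x) (fderiv ℝ polarTheta x)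

theorem polarForm_apply (W : ℝ → ℝ) (β : ℝ → Eucl m → BilForm m) (x u v : Eucl m) :
    polarForm W β x u v = W ‖x‖ * (fderiv ℝ (fun y : Eucl m => ‖y‖) x u
      * fderiv ℝ (fun y : Eucl m => ‖y‖) x v)
      + ‖x‖ ^ 2 * β ‖x‖ (polarTheta x) (fderiv ℝ polarTheta x u) (fderiv ℝ polarTheta x v) := by
  simp [polarForm]

end PolarCoordinates

/-! ### Charts of the sphere by central projection -/

/-- A point of the sphere and an orthonormal frame of the orthogonal hyperplane. -/
structure SphereFrame (n : ℕ) where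
  /-- the point of the sphere -/
  center : Eucl (n + 1)
  /-- the frame of the orthogonal hyperplane -/
  L : Eucl n →ₗᵢ[ℝ] Eucl (n + 1)
  norm_center : ‖center‖ = 1
  inner_center : ∀ y, inner ℝ center (L y) = 0
  exists_eq : ∀ v, inner ℝ center v = 0 → ∃ y, L y = v

namespace SphereFrame

variable {n : ℕ}

theorem exists_center {θ : Eucl (n + 1)} (hθ : ‖θ‖ = 1) :
    ∃ A : SphereFrame n, A.center = θ := by
  have h0 : θ ≠ 0 := by intro h; simp [h] at hθ
  have : Fact (Module.finrank ℝ (Eucl (n + 1)) = n + 1) := ⟨by simp⟩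
  let b := OrthonormalBasis.fromOrthogonalSpanSingleton (𝕜 := ℝ) n h0
  refine ⟨⟨θ, (Submodule.subtypeₗᵢ _).comp b.repr.symm.toLinearIsometry, hθ, fun y => ?_,
    fun v hv => ?_⟩, rfl⟩
  · exact Submodule.mem_orthogonal_singleton_iff_inner_right.1 (b.repr.symm y).2
  · refine ⟨b.repr ⟨v, Submodule.mem_orthogonal_singleton_iff_inner_right.2 hv⟩, ?_⟩
    simp

variable (A : SphereFrame n)

/-- The central projection of the affine hyperplane `center + range L` to the sphere. -/
noncomputable def om (y : Eucl n) : Eucl (n + 1) := polarTheta (A.center + A.L y)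

theorem inner_center_add (y : Eucl n) : inner ℝ A.center (A.center + A.L y) = 1 := by
  rw [inner_add_right, A.inner_center, real_inner_self_eq_norm_sq, A.norm_center]; norm_num

theorem add_ne_zero (y : Eucl n) : A.center + A.L y ≠ 0 := by
  intro h
  have := A.inner_center_add y
  simp [h] at this

theorem contDiff_add : ContDiff ℝ ∞ fun y => A.center + A.L y :=
  contDiff_const.add A.L.contDiff

theorem contDiff_om : ContDiff ℝ ∞ A.om := contDiff_iff_contDiffAt.2 fun y =>
  (contDiffAt_polarTheta (A.add_ne_zero y)).comp y A.contDiff_add.contDiffAt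

theorem norm_om (y : Eucl n) : ‖A.om y‖ = 1 := norm_polarTheta (A.add_ne_zero y)

theorem fderiv_om (y v : Eucl n) :
    fderiv ℝ A.om y v = ‖A.center + A.L y‖⁻¹ • tangProj (A.om y) (A.L v) := by
  have h1 := ((contDiffAt_polarTheta (A.add_ne_zero y)).differentiableAt (by simp)).hasFDerivAt
  have h2 : HasFDerivAt (fun y => A.center + A.L y) A.L.toContinuousLinearMap y :=
    A.L.toContinuousLinearMap.hasFDerivAt.const_add _
  have h3 : fderiv ℝ A.om y = _ := (h1.comp y h2).fderiv
  rw [h3, ContinuousLinearMap.comp_apply, fderiv_polarTheta_apply (A.add_ne_zero y)]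
  rfl

/-- A vector `v` in the kernel has `L v` proportional to `center + L y`; pairing with `center` shows
that the factor is `0`. -/
theorem fderiv_om_injective (y : Eucl n) : Function.Injective (fderiv ℝ A.om y) := by
  refine (injective_iff_map_eq_zero _).2 fun v hv => ?_
  rw [fderiv_om, smul_eq_zero, or_iff_right (inv_ne_zero (norm_ne_zero_iff.2 (A.add_ne_zero y))),
    tangProj, sub_eq_zero, om, polarTheta, smul_smul] at hv
  have h := congrArg (fun w => inner ℝ A.center w) hv
  simp only [A.inner_center, inner_smul_right, A.inner_center_add, mul_one] at h
  rw [← h, zero_smul] at hv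
  exact A.L.injective (by rw [hv, map_zero])

theorem inner_om_fderiv (y v : Eucl n) : inner ℝ (A.om y) (fderiv ℝ A.om y v) = 0 := by
  rw [fderiv_om, inner_smul_right, tangProj, inner_sub_right, inner_smul_right,
    real_inner_self_eq_norm_sq, A.norm_om]
  ring

theorem om_zero : A.om 0 = A.center := by
  rw [om, map_zero, add_zero, polarTheta_of_norm_eq_one A.norm_center]

theorem fderiv_om_zero (v : Eucl n) : fderiv ℝ A.om 0 v = A.L v := by
  rw [fderiv_om, om_zero, map_zero, add_zero, A.norm_center, inv_one, one_smul, tangProj,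
    A.inner_center, zero_smul, sub_zero]

/-- The pull-back of a bilinear form on the sphere under `om`. -/
noncomputable def pull (β : Eucl (n + 1) → BilForm (n + 1)) (y : Eucl n) : BilForm n :=
  (β (A.om y)).bilinearComp (fderiv ℝ A.om y) (fderiv ℝ A.om y)

theorem pull_apply (β : Eucl (n + 1) → BilForm (n + 1)) (y u v : Eucl n) :
    A.pull β y u v = β (A.om y) (fderiv ℝ A.om y u) (fderiv ℝ A.om y v) := by simp [pull]

/-- The inverse of the central projection. -/
noncomputable def omInv (θ : Eucl (n + 1)) : Eucl n :=
  (inner ℝ A.center θ)⁻¹ • ContinuousLinearMap.adjoint A.L.toContinuousLinearMap θ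

theorem adjoint_L (y : Eucl n) :
    ContinuousLinearMap.adjoint A.L.toContinuousLinearMap (A.L y) = y := by
  refine ext_inner_right ℝ fun v => ?_
  rw [ContinuousLinearMap.adjoint_inner_left]
  exact A.L.inner_map_map y v

theorem adjoint_center : ContinuousLinearMap.adjoint A.L.toContinuousLinearMap A.center = 0 := by
  refine ext_inner_right ℝ fun v => ?_
  rw [ContinuousLinearMap.adjoint_inner_left, inner_zero_left]
  exact A.inner_center v

theorem tangProj_center (v : Eucl (n + 1)) : tangProj A.center v =
    A.L (ContinuousLinearMap.adjoint A.L.toContinuousLinearMap v) := by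
  obtain ⟨y, hy⟩ := A.exists_eq (tangProj A.center v) (by
    rw [tangProj, inner_sub_right, inner_smul_right, real_inner_self_eq_norm_sq, A.norm_center]
    ring)
  have h : v = A.L y + inner ℝ A.center v • A.center := by rw [hy, tangProj]; abel
  rw [← hy]
  conv_rhs => rw [h, map_add, map_smul, adjoint_L, adjoint_center, smul_zero, add_zero]

theorem om_omInv {θ : Eucl (n + 1)} (hθ : ‖θ‖ = 1) (h : 0 < inner ℝ A.center θ) :
    A.om (A.omInv θ) = θ := by
  have h1 : A.center + A.L (A.omInv θ) = (inner ℝ A.center θ)⁻¹ • θ := by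
    rw [omInv, map_smul, ← tangProj_center, tangProj, smul_sub, smul_smul,
      inv_mul_cancel₀ h.ne', one_smul]
    abel
  rw [om, h1, polarTheta_smul (inv_pos.2 h), polarTheta_of_norm_eq_one hθ]

theorem continuousAt_omInv : ContinuousAt A.omInv A.center := by
  have h : ContinuousAt (fun θ : Eucl (n + 1) => inner ℝ A.center θ) A.center := by fun_prop
  refine (h.inv₀ ?_).smul (ContinuousLinearMap.continuous _).continuousAt
  rw [real_inner_self_eq_norm_sq, A.norm_center]; norm_num

theorem omInv_center : A.omInv A.center = 0 := by rw [omInv, adjoint_center, smul_zero]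

/-- The projection to `center^⊥` is `L L*`; expanding in coordinates, the sum over the standard
basis of `ℝ^(n+1)` collapses by `L* L = 1` to a trace over the frame. -/
theorem sphereTrace_center (b : BilForm (n + 1)) : sphereTrace A.center b =
    ∑ i, b (A.L (EuclideanSpace.single i 1)) (A.L (EuclideanSpace.single i 1)) := by
  set T := ContinuousLinearMap.adjoint A.L.toContinuousLinearMap with hT
  have h1 : ∀ (a : Fin (n + 1)) (i : Fin n), T (EuclideanSpace.single a 1) i =
      A.L (EuclideanSpace.single i 1) a := by
    intro a i
    have : inner ℝ (T (EuclideanSpace.single a 1)) (EuclideanSpace.single i (1 : ℝ)) =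
        inner ℝ (EuclideanSpace.single a (1 : ℝ)) (A.L (EuclideanSpace.single i 1)) := by
      rw [hT, ContinuousLinearMap.adjoint_inner_left]; rfl
    simpa [EuclideanSpace.inner_single_left, EuclideanSpace.inner_single_right] using this
  let B : BilForm n := b.bilinearComp A.L.toContinuousLinearMap A.L.toContinuousLinearMap
  have hB : ∀ u v, B u v = b (A.L u) (A.L v) := fun u v => by simp [B]
  have h3 : ∀ a : Fin (n + 1), b (tangProj A.center (EuclideanSpace.single a 1))
      (tangProj A.center (EuclideanSpace.single a 1)) = ∑ i, ∑ j,
      A.L (EuclideanSpace.single i 1) a * A.L (EuclideanSpace.single j 1) a * formMatrix B i j :=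
    fun a => by
      rw [tangProj_center, ← hB, BilForm.apply_eq_sum]
      simp only [← hT, h1]
  simp only [sphereTrace, h3]
  rw [Finset.sum_comm]
  refine Finset.sum_congr rfl fun i _ => ?_
  rw [Finset.sum_comm]
  have h2 : ∀ j, ∑ a, A.L (EuclideanSpace.single i 1) a * A.L (EuclideanSpace.single j 1) a *
      formMatrix B i j = (if i = j then 1 else 0) * formMatrix B i j := by
    intro j
    rw [← Finset.sum_mul]
    congr 1
    have := A.L.inner_map_map (EuclideanSpace.single i (1 : ℝ)) (EuclideanSpace.single j (1 : ℝ))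
    rw [PiLp.inner_apply, EuclideanSpace.inner_single_left] at this
    simp only [RCLike.inner_apply, conj_trivial, one_mul, PiLp.single_apply] at this
    simpa [mul_comm] using this
  rw [Finset.sum_congr rfl fun j _ => h2 j]
  simp [hB]

end SphereFrame

/-! ### Polar charts and the curvature of the round sphere -/

namespace SphereFrame

variable {n : ℕ} (A : SphereFrame n)

/-- Polar coordinates `(s, y) ↦ ρ s om(y)`. -/
noncomputable def polarMap (ρ : ℝ) (z : Eucl (n + 1)) : Eucl (n + 1) :=
  (ρ * z 0) • A.om (euclTail n z)

theorem contDiff_polarMap (ρ : ℝ) : ContDiff ℝ ∞ (A.polarMap ρ) :=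
  (contDiff_const.mul (EuclideanSpace.proj 0 : Eucl (n + 1) →L[ℝ] ℝ).contDiff).smul
    (A.contDiff_om.comp (euclTail n).contDiff)

variable {A} {ρ : ℝ} {z : Eucl (n + 1)}

theorem norm_polarMap (hρ : 0 < ρ) (hz : 0 < z 0) : ‖A.polarMap ρ z‖ = ρ * z 0 := by
  rw [polarMap, norm_smul, A.norm_om, mul_one, Real.norm_of_nonneg (mul_pos hρ hz).le]

theorem polarMap_ne_zero (hρ : 0 < ρ) (hz : 0 < z 0) : A.polarMap ρ z ≠ 0 := by
  rw [← norm_ne_zero_iff, norm_polarMap hρ hz]; exact (mul_pos hρ hz).ne'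

theorem polarTheta_polarMap (hρ : 0 < ρ) (hz : 0 < z 0) :
    polarTheta (A.polarMap ρ z) = A.om (euclTail n z) := by
  rw [polarMap, polarTheta_smul (mul_pos hρ hz), polarTheta_of_norm_eq_one (A.norm_om _)]

theorem eventually_pos (hz : 0 < z 0) : ∀ᶠ y : Eucl (n + 1) in 𝓝 z, 0 < y 0 :=
  ((EuclideanSpace.proj 0 : Eucl (n + 1) →L[ℝ] ℝ).continuous.tendsto z).eventually (lt_mem_nhds hz)

theorem fderiv_norm_polarMap (hρ : 0 < ρ) (hz : 0 < z 0) (u : Eucl (n + 1)) :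
    fderiv ℝ (fun y : Eucl (n + 1) => ‖y‖) (A.polarMap ρ z) (fderiv ℝ (A.polarMap ρ) z u) =
      ρ * u 0 := by
  have h1 := ((contDiffAt_norm ℝ (polarMap_ne_zero (A := A) hρ hz)
    (n := ∞)).differentiableAt (by simp)).hasFDerivAt
  have h2 := ((A.contDiff_polarMap ρ).differentiable (by simp) z).hasFDerivAt
  have h3 : (fun y => ‖A.polarMap ρ y‖) =ᶠ[𝓝 z] fun y => ρ * y 0 :=
    (eventually_pos hz).mono fun y hy => norm_polarMap hρ hy
  have h4 : HasFDerivAt (fun y : Eucl (n + 1) => ρ * y 0)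
    (ρ • (EuclideanSpace.proj 0 : Eucl (n + 1) →L[ℝ] ℝ)) z :=
    (EuclideanSpace.proj 0 : Eucl (n + 1) →L[ℝ] ℝ).hasFDerivAt.const_mul ρ
  have h5 := (h1.comp z h2).unique (h4.congr_of_eventuallyEq h3)
  have := congrArg (fun T : Eucl (n + 1) →L[ℝ] ℝ => T u) h5
  simpa using this

theorem fderiv_polarTheta_polarMap (hρ : 0 < ρ) (hz : 0 < z 0) (u : Eucl (n + 1)) :
    fderiv ℝ polarTheta (A.polarMap ρ z) (fderiv ℝ (A.polarMap ρ) z u) =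
      fderiv ℝ A.om (euclTail n z) (euclTail n u) := by
  have h1 := ((contDiffAt_polarTheta (polarMap_ne_zero (A := A) hρ hz)).differentiableAt
    (by simp)).hasFDerivAt
  have h2 := ((A.contDiff_polarMap ρ).differentiable (by simp) z).hasFDerivAt
  have h3 : (fun y => polarTheta (A.polarMap ρ y)) =ᶠ[𝓝 z] fun y => A.om (euclTail n y) :=
    (eventually_pos hz).mono fun y hy => polarTheta_polarMap hρ hy
  have h4 := (A.contDiff_om.differentiable (by simp) (euclTail n z)).hasFDerivAt.comp z
    (euclTail n).hasFDerivAt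
  have h5 := (h1.comp z h2).unique (h4.congr_of_eventuallyEq h3)
  have := congrArg (fun T : Eucl (n + 1) →L[ℝ] Eucl (n + 1) => T u) h5
  simpa using this

theorem fderiv_polarMap_injective (hρ : 0 < ρ) (hz : 0 < z 0) :
    Function.Injective (fderiv ℝ (A.polarMap ρ) z) := by
  refine (injective_iff_map_eq_zero _).2 fun u hu => ?_
  have h1 := fderiv_norm_polarMap (A := A) hρ hz u
  have h2 := fderiv_polarTheta_polarMap (A := A) hρ hz u
  rw [hu, map_zero] at h1 h2
  have h3 : u 0 = 0 := by simpa [hρ.ne'] using h1.symm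
  have h4 : euclTail n u = 0 := A.fderiv_om_injective (euclTail n z) (by rw [← h2, map_zero])
  ext i
  refine Fin.cases h3 (fun i => ?_) i
  exact congrArg (fun v : Eucl n => v i) h4

theorem polarForm_polarMap (W : ℝ → ℝ) (β : ℝ → Eucl (n + 1) → BilForm (n + 1)) (hρ : 0 < ρ)
    (hz : 0 < z 0) (u v : Eucl (n + 1)) :
    polarForm W β (A.polarMap ρ z) (fderiv ℝ (A.polarMap ρ) z u) (fderiv ℝ (A.polarMap ρ) z v) =
      ρ ^ 2 * W (ρ * z 0) * (u 0 * v 0) + (ρ * z 0) ^ 2 *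
        A.pull (β (ρ * z 0)) (euclTail n z) (euclTail n u) (euclTail n v) := by
  rw [polarForm_apply, norm_polarMap hρ hz, polarTheta_polarMap hρ hz, fderiv_norm_polarMap hρ hz,
    fderiv_norm_polarMap hρ hz, fderiv_polarTheta_polarMap hρ hz, fderiv_polarTheta_polarMap hρ hz,
    pull_apply]
  ring

/-- The scalar curvature of `W(r) dr² + r² β(r, θ)` in polar coordinates. -/
theorem coordScalar_polarForm {W : ℝ → ℝ} {β : ℝ → Eucl (n + 1) → BilForm (n + 1)} (hρ : 0 < ρ)
    (hz : 0 < z 0) (hG : ∀ᶠ x in 𝓝 (A.polarMap ρ z), ContDiffAt ℝ ∞ (polarForm W β) x)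
    (hs : ∀ᶠ x in 𝓝 (A.polarMap ρ z), ∀ u v, polarForm W β x u v = polarForm W β x v u)
    (hnd : (formMatrix (polarForm W β (A.polarMap ρ z))).det ≠ 0) :
    coordScalar (fun x => formMatrix (polarForm W β x)) (A.polarMap ρ z) =
      coordScalar (blockMetric (fun s => ρ ^ 2 * W (ρ * s))
        fun s y => (ρ * s) ^ 2 • formMatrix (A.pull (β (ρ * s)) y)) z := by
  rw [← coordScalar_pullback (f := A.polarMap ρ) (𝔤' := fun y => (polarForm W β
    (A.polarMap ρ y)).bilinearComp (fderiv ℝ (A.polarMap ρ) y) (fderiv ℝ (A.polarMap ρ) y))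
    (Eventually.of_forall fun y => (A.contDiff_polarMap ρ).contDiffAt)
    (fderiv_polarMap_injective hρ hz) hG hs hnd
    (Eventually.of_forall fun y u v => by simp)]
  refine coordScalar_congr ((eventually_pos hz).mono fun y hy => ?_)
  ext i j
  simp only [formMatrix_apply, ContinuousLinearMap.bilinearComp_apply, polarForm_polarMap W β hρ hy,
    blockMetric]
  refine Fin.cases ?_ (fun i => ?_) i <;> refine Fin.cases ?_ (fun j => ?_) j
  · simp
  · simp [(Fin.succ_ne_zero _).symm]
  · simp [(Fin.succ_ne_zero _).symm]
  · simp

/-- The round metric in the coordinates given by the central projection. -/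
noncomputable def roundForm (A : SphereFrame n) : Eucl n → BilForm n := A.pull fun _ => innerSL ℝ

theorem roundForm_apply (y u v : Eucl n) :
    A.roundForm y u v = inner ℝ (fderiv ℝ A.om y u) (fderiv ℝ A.om y v) := by
  rw [roundForm, pull_apply]; rfl

theorem contDiff_roundForm (i j : Fin n) :
    ContDiff ℝ ∞ fun y => formMatrix (A.roundForm y) i j := by
  have h : ContDiff ℝ ∞ (fderiv ℝ A.om) := A.contDiff_om.fderiv_right (by simp)
  simp only [formMatrix_apply, roundForm_apply]
  exact (h.clm_apply contDiff_const).inner ℝ (h.clm_apply contDiff_const)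

theorem isSymm_roundForm (y : Eucl n) : (formMatrix (A.roundForm y)).IsSymm :=
  Matrix.IsSymm.ext fun i j => by
    simp only [formMatrix_apply, roundForm_apply]; exact real_inner_comm _ _

theorem det_roundForm_ne_zero (y : Eucl n) : (formMatrix (A.roundForm y)).det ≠ 0 := by
  rw [formMatrix_det_ne_zero_iff]
  intro u hu
  have h := hu u
  rw [roundForm_apply, inner_self_eq_zero] at h
  exact A.fderiv_om_injective y (by rw [h, map_zero])

/-- The chart is orthonormal to first order at its centre. This removes the inverse metric from the
first-order coefficient of the curvature there, leaving plain matrix traces. -/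
theorem formMatrix_roundForm_zero : formMatrix (A.roundForm 0) = 1 := by
  ext i j
  rw [formMatrix_apply, roundForm_apply, fderiv_om_zero, fderiv_om_zero, A.L.inner_map_map]
  simp [EuclideanSpace.inner_single_left, Matrix.one_apply]

theorem blockRegular_roundForm {F : ℝ → ℝ} {s : ℝ} (hF : ContDiffAt ℝ ∞ F s) (h0 : F s ≠ 0)
    (y : Eucl n) : BlockRegular F (fun _ y => formMatrix (A.roundForm y)) s y where
  smooth_W := hF
  smooth i j := ((contDiff_roundForm i j).comp contDiff_snd).contDiffAt
  symm := Eventually.of_forall fun _ => isSymm_roundForm _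
  W_ne := h0
  det_ne := det_roundForm_ne_zero y

theorem logDerivMat_const (γ : Eucl n → Matrix (Fin n) (Fin n) ℝ) (s : ℝ) (y : Eucl n) :
    logDerivMat (fun _ y => γ y) s y = 0 := by
  rw [logDerivMat]
  convert Matrix.mul_zero _
  ext i j
  simp [matDeriv]

/-- The scalar curvature of the round sphere of dimension `n` is `n (n - 1)`. -/
theorem coordScalar_roundForm (y : Eucl n) :
    coordScalar (fun y => formMatrix (A.roundForm y)) y = n * (n - 1) := by
  -- Euclidean space is flat, and in polar coordinates it is the radial metric with `ρ = 1`, `F =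
  -- s⁻²` and `H` the round metric. The radial formula at `s = 1` is then an equation for the
  -- curvature of the sphere.
  let z : Eucl (n + 1) := WithLp.toLp 2 (Fin.cons 1 y.ofLp)
  have hz0 : z 0 = 1 := rfl
  have hz : 0 < z 0 := by rw [hz0]; norm_num
  have hzt : euclTail n z = y := by ext i; rfl
  have hflat : ∀ x : Eucl (n + 1), x ≠ 0 →
      polarForm (fun _ => 1) (fun _ _ => innerSL ℝ) x = (innerSL ℝ : BilForm (n + 1)) := by
    intro x hx
    ext u v
    rw [polarForm_apply, innerSL_apply_apply, innerSL_apply_apply, one_mul]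
    exact (inner_eq_polar hx u v).symm
  have hne := polarMap_ne_zero (A := A) (ρ := 1) one_pos hz
  have hev := eventually_ne_nhds hne
  have h1 := coordScalar_polarForm (A := A) (W := fun _ => 1) (β := fun _ _ => innerSL ℝ)
    (ρ := 1) one_pos hz
    (hev.mono fun x hx => (contDiffAt_const (c := (innerSL ℝ : BilForm (n + 1)))).congr_of_eventuallyEq
      ((eventually_ne_nhds hx).mono hflat))
    (hev.mono fun x hx u v => by
      rw [hflat x hx, innerSL_apply_apply, innerSL_apply_apply]; exact real_inner_comm _ _)
    (by
      rw [hflat _ hne, formMatrix_det_ne_zero_iff]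
      intro u hu
      exact inner_self_eq_zero.1 (hu u))
  have h2 : coordScalar (fun x => formMatrix (polarForm (fun _ => 1) (fun _ _ => innerSL ℝ) x))
      (A.polarMap 1 z) = 0 := by
    rw [coordScalar_congr (G' := fun _ => formMatrix (innerSL ℝ : BilForm (n + 1)))
      (hev.mono fun x hx => by rw [hflat x hx])]
    have h3 : ∀ k i j, christoffel (fun _ => formMatrix (innerSL ℝ : BilForm (n + 1))) k i j =
        fun _ => 0 := by
      intro k i j
      funext x
      simp [christoffel, partialD]
    simp [coordScalar, coordRicci, h3, partialD]
  have h4 := coordScalar_radial (F := fun s => (s ^ 2)⁻¹)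
    (H := fun _ y => formMatrix (A.roundForm y)) (ρ := 1) (x := z) one_pos hz (by
      have : ∀ᶠ q : ℝ × Eucl n in 𝓝 (z 0, euclTail n z), 0 < q.1 :=
        (continuous_fst.tendsto _).eventually (lt_mem_nhds hz)
      filter_upwards [this] with q hq
      exact blockRegular_roundForm ((contDiffAt_id.pow 2).inv (pow_ne_zero 2 hq.ne'))
        (inv_ne_zero (pow_ne_zero 2 hq.ne')) _)
  have h5 : blockMetric (fun s => (s ^ 2 * (s ^ 2)⁻¹)⁻¹)
      (fun s y => (1 * s) ^ 2 • formMatrix (A.roundForm y)) =ᶠ[𝓝 z]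
      blockMetric (fun s => 1 ^ 2 * 1) (fun s y => (1 * s) ^ 2 • formMatrix (A.roundForm y)) :=
    (eventually_pos hz).mono fun x hx => by
      simp only [blockMetric]
      rw [mul_inv_cancel₀ (pow_ne_zero 2 hx.ne')]
      norm_num
  have h6 : deriv (fun s : ℝ => (s ^ 2)⁻¹) 1 = -2 := by
    have := ((hasDerivAt_pow 2 (1 : ℝ)).fun_inv (by norm_num)).deriv
    rw [this]; norm_num
  rw [coordScalar_congr h5] at h4
  rw [h2] at h1
  have h7 := h1.trans h4
  simp only [logDerivMat_const, hz0, hzt, h6, Matrix.trace_zero, Matrix.mul_zero] at h7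
  norm_num at h7
  linarith

end SphereFrame

/-! ### Differentials of charts and smooth sections in a chart -/

section
variable {m : ℕ} {M : Type*} [TopologicalSpace M] [ChartedSpace (Eucl m) M]

/-- The differential of a chart, on the model space. -/
noncomputable def chartDeriv (φ : OpenPartialHomeomorph M (Eucl m)) (p : M) :
    Eucl m →L[ℝ] Eucl m :=
  mfderiv (𝓡 m) (𝓡 m) φ p

/-- The differential of the inverse of a chart, on the model space. -/
noncomputable def chartSymmDeriv (φ : OpenPartialHomeomorph M (Eucl m)) (x : Eucl m) :
    Eucl m →L[ℝ] Eucl m :=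
  mfderiv (𝓡 m) (𝓡 m) φ.symm x

variable {φ ψ : OpenPartialHomeomorph M (Eucl m)}

theorem contDiffAt_transition (hφ : φ ∈ IsManifold.maximalAtlas (𝓡 m) ∞ M)
    (hψ : ψ ∈ IsManifold.maximalAtlas (𝓡 m) ∞ M) {x : Eucl m} (hx : x ∈ ψ.target)
    (hx' : ψ.symm x ∈ φ.source) : ContDiffAt ℝ ∞ (φ ∘ ψ.symm) x := by
  rw [← contMDiffAt_iff_contDiffAt]
  have h1 := (contMDiffOn_of_mem_maximalAtlas hφ).contMDiffAt (φ.open_source.mem_nhds hx')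
  have h2 := (contMDiffOn_symm_of_mem_maximalAtlas hψ).contMDiffAt (ψ.open_target.mem_nhds hx)
  exact h1.comp x h2

theorem fderiv_transition (hφ : φ ∈ IsManifold.maximalAtlas (𝓡 m) ∞ M)
    (hψ : ψ ∈ IsManifold.maximalAtlas (𝓡 m) ∞ M) {x : Eucl m} (hx : x ∈ ψ.target)
    (hx' : ψ.symm x ∈ φ.source) :
    fderiv ℝ (φ ∘ ψ.symm) x = (chartDeriv φ (ψ.symm x)).comp (chartSymmDeriv ψ x) := by
  have h1 := (contMDiffOn_of_mem_maximalAtlas hφ).contMDiffAt (φ.open_source.mem_nhds hx')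
  have h2 := (contMDiffOn_symm_of_mem_maximalAtlas hψ).contMDiffAt (ψ.open_target.mem_nhds hx)
  have h := mfderiv_comp x (h1.mdifferentiableAt (by simp)) (h2.mdifferentiableAt (by simp))
  rw [mfderiv_eq_fderiv] at h
  exact h

theorem chartDeriv_chartSymmDeriv (hφ : φ ∈ IsManifold.maximalAtlas (𝓡 m) ∞ M) {x : Eucl m}
    (hx : x ∈ φ.target) (u : Eucl m) :
    chartDeriv φ (φ.symm x) (chartSymmDeriv φ x u) = u := by
  have h := fderiv_transition hφ hφ hx (φ.map_target hx)
  have h' : φ ∘ φ.symm =ᶠ[𝓝 x] id := by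
    filter_upwards [φ.open_target.mem_nhds hx] with y hy using φ.right_inv hy
  rw [h'.fderiv_eq (𝕜 := ℝ), fderiv_id] at h
  exact (DFunLike.congr_fun h u).symm

theorem chartSymmDeriv_chartDeriv (hφ : φ ∈ IsManifold.maximalAtlas (𝓡 m) ∞ M) {x : Eucl m}
    (hx : x ∈ φ.target) (u : Eucl m) :
    chartSymmDeriv φ x (chartDeriv φ (φ.symm x) u) = u := by
  have h : (chartDeriv φ (φ.symm x)).comp (chartSymmDeriv φ x) = .id ℝ _ :=
    ContinuousLinearMap.ext (chartDeriv_chartSymmDeriv hφ hx)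
  have h2 : (chartDeriv φ (φ.symm x)).toLinearMap * (chartSymmDeriv φ x).toLinearMap = 1 :=
    congrArg ContinuousLinearMap.toLinearMap h
  exact DFunLike.congr_fun (mul_eq_one_comm.1 h2) u

theorem chartDeriv_injective (hφ : φ ∈ IsManifold.maximalAtlas (𝓡 m) ∞ M) {p : M}
    (hp : p ∈ φ.source) : Function.Injective (chartDeriv φ p) := by
  have := chartSymmDeriv_chartDeriv hφ (φ.map_source hp)
  rw [φ.left_inv hp] at this
  exact Function.LeftInverse.injective this

theorem fderiv_transition_injective (hφ : φ ∈ IsManifold.maximalAtlas (𝓡 m) ∞ M)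
    (hψ : ψ ∈ IsManifold.maximalAtlas (𝓡 m) ∞ M) {x : Eucl m} (hx : x ∈ ψ.target)
    (hx' : ψ.symm x ∈ φ.source) : Function.Injective (fderiv ℝ (φ ∘ ψ.symm) x) := by
  rw [fderiv_transition hφ hψ hx hx']
  exact (chartDeriv_injective hφ hx').comp
    (Function.LeftInverse.injective (chartDeriv_chartSymmDeriv hψ hx))

variable [IsManifold (𝓡 m) ∞ M]

/-- A section of the bundle of bilinear forms is smooth if its chart expression is. -/
theorem contMDiffAt_bilinear_section 
    {B : ∀ p : M, TangentSpace (𝓡 m) p →L[ℝ] TangentSpace (𝓡 m) p →L[ℝ] ℝ}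
    {p₀ : M} {b : Eucl m → BilForm m} (hb : ContDiffAt ℝ ∞ b (chartAt (Eucl m) p₀ p₀))
    (h : ∀ᶠ x in 𝓝 (chartAt (Eucl m) p₀ p₀), ∀ u v : Eucl m,
      b x u v = B ((chartAt (Eucl m) p₀).symm x) (chartSymmDeriv (chartAt (Eucl m) p₀) x u)
        (chartSymmDeriv (chartAt (Eucl m) p₀) x v)) :
    ContMDiffAt (𝓡 m) ((𝓡 m).prod 𝓘(ℝ, Eucl m →L[ℝ] Eucl m →L[ℝ] ℝ)) ∞
      (fun p => Bundle.TotalSpace.mk' (Eucl m →L[ℝ] Eucl m →L[ℝ] ℝ) p (B p)) p₀ := by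
  rw [Bundle.contMDiffAt_section]
  have hsrc := mem_chart_source (Eucl m) p₀
  have h1 : ContMDiffAt (𝓡 m) 𝓘(ℝ, BilForm m) ∞ (b ∘ chartAt (Eucl m) p₀) p₀ :=
    (contMDiffAt_iff_contDiffAt.2 hb).comp p₀ (contMDiffAt_of_mem_maximalAtlas
      (IsManifold.chart_mem_maximalAtlas p₀) hsrc)
  refine h1.congr_of_eventuallyEq ?_
  have h2 := (chartAt (Eucl m) p₀).continuousAt hsrc |>.eventually h
  filter_upwards [h2, (chartAt (Eucl m) p₀).open_source.mem_nhds hsrc] with p hp hps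
  ext u v
  rw [Function.comp_apply, hp u v, (chartAt (Eucl m) p₀).left_inv hps]
  rw [hom_trivializationAt_apply]
  -- The tangent bundle is trivialised at `p₀` by the differential of the inverse chart, so in the
  -- trivialisation the section is exactly the chart expression `b`.
  have h3 : (trivializationAt (Eucl m) (TangentSpace (𝓡 m)) p₀).symm p
      = (chartSymmDeriv (chartAt (Eucl m) p₀) (chartAt (Eucl m) p₀ p) : Eucl m → Eucl m) := by
    have h3 := TangentBundle.symmL_trivializationAt (I := 𝓡 m) (𝕜 := ℝ) hps
    rw [modelWithCornersSelf_coe, range_id, mfderivWithin_univ] at h3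
    rw [extChartAt_coe, extChartAt_coe_symm, modelWithCornersSelf_coe,
      modelWithCornersSelf_coe_symm, Function.id_comp, Function.comp_id] at h3
    funext v
    exact (Bundle.Trivialization.symmL_apply (R := ℝ) _ hps v).symm.trans (DFunLike.congr_fun h3 v)
  have h4 : (trivializationAt ℝ (fun _ : M => ℝ) p₀).linearMapAt ℝ p = LinearMap.id :=
    Bundle.Trivial.linearMapAt_trivialization ℝ M ℝ p
  refine (inCoordinates_apply_eq₂ hps hps (mem_univ _)).trans ?_
  rw [h3]
  exact DFunLike.congr_fun h4 _

/-- Positive definite forms on a finite-dimensional space have bounded unit balls. -/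
theorem isVonNBounded_of_pos {b : BilForm m} (hb : ∀ u, u ≠ 0 → 0 < b u u) :
    Bornology.IsVonNBounded ℝ {u : Eucl m | b u u < 1} := by
  have hc : Continuous fun u : Eucl m => b u u := by fun_prop
  obtain ⟨c, hc0, hcb⟩ : ∃ c > 0, ∀ u : Eucl m, ‖u‖ = 1 → c ≤ b u u := by
    rcases (Metric.sphere (0 : Eucl m) 1).eq_empty_or_nonempty with he | hne
    · refine ⟨1, one_pos, fun u hu => ?_⟩
      have : u ∈ Metric.sphere (0 : Eucl m) 1 := by simpa using hu
      simp [he] at this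
    · obtain ⟨u, hu, hmin⟩ := (isCompact_sphere (0 : Eucl m) 1).exists_isMinOn hne hc.continuousOn
      have hu1 : ‖u‖ = 1 := by simpa using hu
      refine ⟨b u u, hb u (by rintro rfl; simp at hu1), fun v hv => hmin (by simpa using hv)⟩
  have hle : ∀ u : Eucl m, c * ‖u‖ ^ 2 ≤ b u u := by
    intro u
    rcases eq_or_ne u 0 with rfl | hu
    · simp
    · have hn : ‖u‖ ≠ 0 := norm_ne_zero_iff.2 hu
      have := hcb (‖u‖⁻¹ • u) (by rw [norm_smul, norm_inv, norm_norm, inv_mul_cancel₀ hn])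
      rw [map_smul, map_smul, smul_apply, smul_eq_mul, smul_eq_mul] at this
      have h2 := mul_le_mul_of_nonneg_right this (sq_nonneg ‖u‖)
      have h3 : ‖u‖⁻¹ * (‖u‖⁻¹ * b u u) * ‖u‖ ^ 2 = b u u := by field_simp
      rwa [h3] at h2
  rw [NormedSpace.isVonNBounded_iff]
  refine (Metric.isBounded_closedBall (x := (0 : Eucl m)) (r := √(1 / c))).subset fun u hu => ?_
  rw [mem_closedBall_zero_iff]
  refine Real.le_sqrt_of_sq_le ?_
  rw [le_div_iff₀ hc0]
  have := hle u
  have h3 : b u u < 1 := hu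
  linarith
end

/-! ### Replacing a metric inside a chart -/

section
variable {m : ℕ} {M : Type*} [TopologicalSpace M] [ChartedSpace (Eucl m) M]
  [IsManifold (𝓡 m) ∞ M] {φ ψ : OpenPartialHomeomorph M (Eucl m)}

theorem metricInChart_transition (g : SmoothMetric m M)
    (hφ : φ ∈ IsManifold.maximalAtlas (𝓡 m) ∞ M) (hψ : ψ ∈ IsManifold.maximalAtlas (𝓡 m) ∞ M)
    {x : Eucl m} (hx : x ∈ ψ.target) (hx' : ψ.symm x ∈ φ.source) (u v : Eucl m) :
    metricInChart g ψ x u v = metricInChart g φ ((φ ∘ ψ.symm) x)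
      (fderiv ℝ (φ ∘ ψ.symm) x u) (fderiv ℝ (φ ∘ ψ.symm) x v) := by
  have key : ∀ w, chartSymmDeriv φ (φ (ψ.symm x)) (fderiv ℝ (φ ∘ ψ.symm) x w)
      = chartSymmDeriv ψ x w := by
    intro w
    rw [fderiv_transition hφ hψ hx hx', ContinuousLinearMap.comp_apply]
    have h := chartSymmDeriv_chartDeriv hφ (φ.map_source hx') (chartSymmDeriv ψ x w)
    rwa [φ.left_inv hx'] at h
  change g.inner (ψ.symm x) (chartSymmDeriv ψ x u) (chartSymmDeriv ψ x v)
    = g.inner (φ.symm (φ (ψ.symm x)))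
      (chartSymmDeriv φ (φ (ψ.symm x)) (fderiv ℝ (φ ∘ ψ.symm) x u))
      (chartSymmDeriv φ (φ (ψ.symm x)) (fderiv ℝ (φ ∘ ψ.symm) x v))
  rw [φ.left_inv hx', key, key]

/-- The definition uses the preferred chart at `p`; the transition map to `φ` is a local
diffeomorphism carrying one coordinate expression to the other, so coordinate invariance applies. -/
theorem scalarCurvature_eq_coordScalar (g : SmoothMetric m M)
    (hφ : φ ∈ IsManifold.maximalAtlas (𝓡 m) ∞ M) {G : Eucl m → BilForm m}
    (hG : ContDiffOn ℝ ∞ G φ.target) (hsymm : ∀ x ∈ φ.target, ∀ u v, G x u v = G x v u)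
    (hpos : ∀ x ∈ φ.target, ∀ u, u ≠ 0 → 0 < G x u u)
    (hgG : ∀ x ∈ φ.target, ∀ u v, metricInChart g φ x u v = G x u v) {p : M} (hp : p ∈ φ.source) :
    scalarCurvature g p = coordScalar (fun x => formMatrix (G x)) (φ p) := by
  classical
  set ψ := chartAt (Eucl m) p with hψd
  have hψ : ψ ∈ IsManifold.maximalAtlas (𝓡 m) ∞ M := IsManifold.chart_mem_maximalAtlas p
  have hps : p ∈ ψ.source := mem_chart_source (Eucl m) p
  have hxt : ψ p ∈ ψ.target := ψ.map_source hps
  have hxs : ψ.symm (ψ p) ∈ φ.source := by rwa [ψ.left_inv hps]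
  have hnear : ∀ᶠ x in 𝓝 (ψ p), x ∈ ψ.target ∧ ψ.symm x ∈ φ.source :=
    (show ∀ᶠ x in 𝓝 (ψ p), x ∈ ψ.target from ψ.open_target.mem_nhds hxt).and
      ((ψ.symm.continuousAt hxt).eventually (φ.open_source.mem_nhds hxs))
  have hfx : (φ ∘ ψ.symm) (ψ p) = φ p := by rw [Function.comp_apply, ψ.left_inv hps]
  have htgt : ∀ᶠ y in 𝓝 ((φ ∘ ψ.symm) (ψ p)), y ∈ φ.target := by
    rw [hfx]; exact φ.open_target.mem_nhds (φ.map_source hp)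
  set G' : Eucl m → BilForm m := fun x => (g.inner (ψ.symm x)).bilinearComp
    (chartSymmDeriv ψ x) (chartSymmDeriv ψ x) with hG'
  have hG'a : ∀ x u v, G' x u v = metricInChart g ψ x u v := fun x u v => rfl
  have h1 : scalarCurvature g p = coordScalar (fun x => formMatrix (G' x)) (ψ p) := rfl
  rw [h1, ← hfx]
  refine coordScalar_pullback (hnear.mono fun x hx => contDiffAt_transition hφ hψ hx.1 hx.2)
    (fderiv_transition_injective hφ hψ hxt hxs)
    (htgt.mono fun y hy => hG.contDiffAt (φ.open_target.mem_nhds hy))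
    (htgt.mono fun y hy => hsymm y hy) ?_ ?_
  · rw [formMatrix_det_ne_zero_iff]
    intro u hu
    by_contra hne
    exact (hpos _ htgt.self_of_nhds u hne).ne' (hu u)
  · filter_upwards [hnear] with x hx u v
    rw [hG'a, metricInChart_transition g hφ hψ hx.1 hx.2]
    exact hgG _ (φ.map_source hx.2) _ _

theorem scalarCurvature_congr {g g' : SmoothMetric m M} {p : M}
    (h : ∀ᶠ q in 𝓝 p, g'.inner q = g.inner q) : scalarCurvature g' p = scalarCurvature g p := by
  refine coordScalar_congr ?_
  have h2 := (chartAt (Eucl m) p).symm.continuousAt (mem_chart_target (Eucl m) p)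
  rw [ContinuousAt, (chartAt (Eucl m) p).left_inv (mem_chart_source (Eucl m) p)] at h2
  filter_upwards [h2.eventually h] with x hx
  ext i j
  simp only [Matrix.of_apply, metricInChart]
  rw [hx]

/-- The pullback under a chart `φ` of a family of bilinear forms on the model space. -/
noncomputable def chartPullback (φ : OpenPartialHomeomorph M (Eucl m)) (G : Eucl m → BilForm m)
    (p : M) : TangentSpace (𝓡 m) p →L[ℝ] TangentSpace (𝓡 m) p →L[ℝ] ℝ :=
  ((G (φ p)).bilinearComp (chartDeriv φ p) (chartDeriv φ p) : BilForm m)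

open Classical in
/-- The family of bilinear forms which in the chart `φ` is given by `G`, and which is `g` elsewhere. -/
noncomputable def gluedForm (g : SmoothMetric m M) (φ : OpenPartialHomeomorph M (Eucl m))
    (G : Eucl m → BilForm m) (p : M) :
    TangentSpace (𝓡 m) p →L[ℝ] TangentSpace (𝓡 m) p →L[ℝ] ℝ :=
  if p ∈ φ.source then chartPullback φ G p else g.inner p

theorem gluedForm_of_mem (g : SmoothMetric m M) {G : Eucl m → BilForm m} {p : M}
    (hp : p ∈ φ.source) (u v : Eucl m) :
    gluedForm g φ G p u v = G (φ p) (chartDeriv φ p u) (chartDeriv φ p v) := by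
  rw [gluedForm, if_pos hp]; rfl

theorem gluedForm_of_notMem (g : SmoothMetric m M) {G : Eucl m → BilForm m} {p : M}
    (hp : p ∉ φ.source) : gluedForm g φ G p = g.inner p := by
  rw [gluedForm, if_neg hp]

theorem gluedForm_eq_inner (g : SmoothMetric m M) (hφ : φ ∈ IsManifold.maximalAtlas (𝓡 m) ∞ M)
    {G : Eucl m → BilForm m} {p : M}
    (h : p ∈ φ.source → ∀ u v, G (φ p) u v = metricInChart g φ (φ p) u v) :
    gluedForm g φ G p = g.inner p := by
  by_cases hp : p ∈ φ.source
  · ext u v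
    refine (gluedForm_of_mem g hp u v).trans ?_
    rw [h hp]
    change g.inner (φ.symm (φ p)) (chartSymmDeriv φ (φ p) (chartDeriv φ p u))
      (chartSymmDeriv φ (φ p) (chartDeriv φ p v)) = _
    have h1 := chartSymmDeriv_chartDeriv hφ (φ.map_source hp)
    rw [φ.left_inv hp] at h1 ⊢
    exact congrArg₂ (fun a b => g.inner p a b) (h1 u) (h1 v)
  · exact gluedForm_of_notMem g hp

theorem contMDiffAt_gluedForm (g : SmoothMetric m M)
    (hφ : φ ∈ IsManifold.maximalAtlas (𝓡 m) ∞ M) {G : Eucl m → BilForm m}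
    (hG : ContDiffOn ℝ ∞ G φ.target) {p : M} (hp : p ∈ φ.source) :
    ContMDiffAt (𝓡 m) ((𝓡 m).prod 𝓘(ℝ, Eucl m →L[ℝ] Eucl m →L[ℝ] ℝ)) ∞
      (fun q => Bundle.TotalSpace.mk' (Eucl m →L[ℝ] Eucl m →L[ℝ] ℝ) q (gluedForm g φ G q)) p := by
  set ψ := chartAt (Eucl m) p with hψd
  have hψ : ψ ∈ IsManifold.maximalAtlas (𝓡 m) ∞ M := IsManifold.chart_mem_maximalAtlas p
  have hps : p ∈ ψ.source := mem_chart_source (Eucl m) p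
  have hxt : ψ p ∈ ψ.target := ψ.map_source hps
  have hxs : ψ.symm (ψ p) ∈ φ.source := by rwa [ψ.left_inv hps]
  have hnear : ∀ᶠ x in 𝓝 (ψ p), x ∈ ψ.target ∧ ψ.symm x ∈ φ.source :=
    (show ∀ᶠ x in 𝓝 (ψ p), x ∈ ψ.target from ψ.open_target.mem_nhds hxt).and
      ((ψ.symm.continuousAt hxt).eventually (φ.open_source.mem_nhds hxs))
  have hf := contDiffAt_transition hφ hψ hxt hxs
  have hdf : ContDiffAt ℝ ∞ (fderiv ℝ (φ ∘ ψ.symm)) (ψ p) := hf.fderiv_right (m := ∞) (by simp)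
  have hG1 : ContDiffAt ℝ ∞ (fun x => G ((φ ∘ ψ.symm) x)) (ψ p) :=
    (hG.contDiffAt (φ.open_target.mem_nhds (φ.map_source hxs))).comp (ψ p) hf
  refine contMDiffAt_bilinear_section (b := fun x => (G ((φ ∘ ψ.symm) x)).bilinearComp
    (fderiv ℝ (φ ∘ ψ.symm) x) (fderiv ℝ (φ ∘ ψ.symm) x)) ?_ ?_
  · refine contDiffAt_form_of_formMatrix fun i j => ?_
    simp only [formMatrix_apply, ContinuousLinearMap.bilinearComp_apply]
    exact (hG1.clm_apply (hdf.clm_apply contDiffAt_const)).clm_apply (hdf.clm_apply contDiffAt_const)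
  · filter_upwards [hnear] with x hx u v
    rw [gluedForm_of_mem g hx.2, ContinuousLinearMap.bilinearComp_apply,
      fderiv_transition hφ hψ hx.1 hx.2]
    rfl

/-- A metric may be replaced in a chart by any metric which agrees with it off a closed subset. -/
theorem exists_smoothMetric_eq_in_chart (g : SmoothMetric m M)
    (hφ : φ ∈ IsManifold.maximalAtlas (𝓡 m) ∞ M) {G : Eucl m → BilForm m}
    (hG : ContDiffOn ℝ ∞ G φ.target) (hsymm : ∀ x ∈ φ.target, ∀ u v, G x u v = G x v u)
    (hpos : ∀ x ∈ φ.target, ∀ u, u ≠ 0 → 0 < G x u u) {K : Set M} (hK : IsClosed K)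
    (hKs : K ⊆ φ.source)
    (hgG : ∀ p ∈ φ.source, p ∉ K → ∀ u v, G (φ p) u v = metricInChart g φ (φ p) u v) :
    ∃ g' : SmoothMetric m M,
      (∀ p, (p ∈ φ.source → ∀ u v, G (φ p) u v = metricInChart g φ (φ p) u v) →
        g'.inner p = g.inner p) ∧
      (∀ x ∈ φ.target, ∀ u v, metricInChart g' φ x u v = G x u v) ∧
      (∀ p ∈ φ.source, scalarCurvature g' p = coordScalar (fun x => formMatrix (G x)) (φ p)) ∧
      ∀ p ∉ K, scalarCurvature g' p = scalarCurvature g p := by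
  have hpos' : ∀ p ∈ φ.source, ∀ u : Eucl m, u ≠ 0 → 0 < gluedForm g φ G p u u := by
    intro p hp u hu
    rw [gluedForm_of_mem g hp]
    refine hpos _ (φ.map_source hp) _ fun h => hu (chartDeriv_injective hφ hp ?_)
    rw [h, map_zero]
  have hoff : ∀ p ∉ K, gluedForm g φ G p = g.inner p := fun p hp =>
    gluedForm_eq_inner g hφ fun hps => hgG p hps hp
  let g' : SmoothMetric m M :=
    { inner := gluedForm g φ G
      symm := fun p u v => by
        by_cases hp : p ∈ φ.source
        · exact (gluedForm_of_mem g hp u v).trans ((hsymm _ (φ.map_source hp) _ _).trans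
            (gluedForm_of_mem g hp v u).symm)
        · rw [gluedForm_of_notMem g hp]; exact g.symm p u v
      pos := fun p u hu => by
        by_cases hp : p ∈ φ.source
        · exact hpos' p hp u hu
        · rw [gluedForm_of_notMem g hp]; exact g.pos p u hu
      isVonNBounded := fun p => by
        by_cases hp : p ∈ φ.source
        · exact isVonNBounded_of_pos (b := gluedForm g φ G p) (hpos' p hp)
        · rw [gluedForm_of_notMem g hp]; exact g.isVonNBounded p
      contMDiff := fun p => by
        by_cases hp : p ∈ φ.source
        · exact contMDiffAt_gluedForm g hφ hG hp
        -- At a point outside the chart domain, possibly on its frontier, smoothness could fail; as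
        -- `K` is closed and contained in the domain, the glued form is equal to `g` near such a
        -- point.
        · refine (g.contMDiff p).congr_of_eventuallyEq ?_
          filter_upwards [hK.isOpen_compl.mem_nhds (fun h => hp (hKs h))] with q hq
          rw [hoff q hq] }
  have hchart : ∀ x ∈ φ.target, ∀ u v, metricInChart g' φ x u v = G x u v := by
    intro x hx u v
    refine (gluedForm_of_mem g (φ.map_target hx) _ _).trans ?_
    have h1 := chartDeriv_chartSymmDeriv hφ hx
    rw [φ.right_inv hx]
    exact congrArg₂ (fun a b => G x a b) (h1 u) (h1 v)
  refine ⟨g', fun p hp => gluedForm_eq_inner g hφ hp, hchart, fun p hp =>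
    scalarCurvature_eq_coordScalar g' hφ hG hsymm hpos hchart hp, fun p hp => ?_⟩
  refine scalarCurvature_congr ?_
  filter_upwards [hK.isOpen_compl.mem_nhds hp] with q hq using hoff q hq
end

/-! ### First-order expansion of the curvature of a perturbed radial metric -/

section
variable {n : ℕ}

/-- The radial coefficient `1 + w⁴ / s² + w^{2n+2} (c - s^{-(n+1)} m(s))`. -/
noncomputable def radialCoeff (n : ℕ) (c : ℝ) (m : ℝ → ℝ) (w s : ℝ) : ℝ :=
  1 + w ^ 4 / s ^ 2 + w ^ (2 * n + 2) * (c - m s / s ^ (n + 1))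

theorem contDiffAt_radialCoeff {c : ℝ} {m : ℝ → ℝ} (hm : ContDiff ℝ ∞ m) {q : ℝ × ℝ}
    (hq : q.1 ≠ 0) : ContDiffAt ℝ ∞ (fun q : ℝ × ℝ => radialCoeff n c m q.2 q.1) q := by
  have h1 : ContDiffAt ℝ ∞ (fun q : ℝ × ℝ => m q.1) q := (hm.comp contDiff_fst).contDiffAt
  have h2 : ContDiffAt ℝ ∞ (fun q : ℝ × ℝ => q.1) q := contDiffAt_fst
  have h3 : ContDiffAt ℝ ∞ (fun q : ℝ × ℝ => q.2) q := contDiffAt_snd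
  unfold radialCoeff
  exact (contDiffAt_const.add ((h3.pow 4).div (h2.pow 2) (pow_ne_zero 2 hq))).add
    ((h3.pow _).mul (contDiffAt_const.sub (h1.div (h2.pow _) (pow_ne_zero _ hq))))

theorem hasDerivAt_radialCoeff (c : ℝ) {m : ℝ → ℝ} (hm : ContDiff ℝ ∞ m) (w : ℝ) {s : ℝ}
    (hs : s ≠ 0) : HasDerivAt (radialCoeff n c m w)
      (-2 * w ^ 4 / s ^ 3 + w ^ (2 * n + 2) *
        ((n + 1) * m s / s ^ (n + 2) - deriv m s / s ^ (n + 1))) s := by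
  have h1 : HasDerivAt m (deriv m s) s := (hm.differentiable (by simp) s).hasDerivAt
  have h2 := (((hasDerivAt_const s (w ^ 4)).div (hasDerivAt_pow 2 s) (pow_ne_zero 2 hs)).const_add
    (1 : ℝ)).add (((h1.div (hasDerivAt_pow (n + 1) s) (pow_ne_zero _ hs)).const_sub c).const_mul
      (w ^ (2 * n + 2)))
  refine h2.congr_deriv ?_
  congr 1
  · field_simp; simp; ring
  · congr 1
    push_cast
    field_simp
    ring

variable {h₀ : Eucl n → Matrix (Fin n) (Fin n) ℝ} {X : ℝ × ℝ × Eucl n → Matrix (Fin n) (Fin n) ℝ}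

/-- The family of matrices `h₀(y) + w^{2n+2} X(s, w, y)`. -/
noncomputable def perturbedMat (h₀ : Eucl n → Matrix (Fin n) (Fin n) ℝ)
    (X : ℝ × ℝ × Eucl n → Matrix (Fin n) (Fin n) ℝ) (w s : ℝ) (y : Eucl n) :
    Matrix (Fin n) (Fin n) ℝ := h₀ y + w ^ (2 * n + 2) • X (s, w, y)

/-- The `s`-derivative of a family of matrices. -/
noncomputable def derivFst (X : ℝ × ℝ × Eucl n → Matrix (Fin n) (Fin n) ℝ) (q : ℝ × ℝ × Eucl n) :
    Matrix (Fin n) (Fin n) ℝ := Matrix.of fun i j => deriv (fun s => X (s, q.2) i j) q.1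

/-- The matrix `(h₀ + w^{2n+2} X)⁻¹ ∂ₛX`. -/
noncomputable def perturbedLogDeriv (h₀ : Eucl n → Matrix (Fin n) (Fin n) ℝ)
    (X : ℝ × ℝ × Eucl n → Matrix (Fin n) (Fin n) ℝ) (q : ℝ × ℝ × Eucl n) :
    Matrix (Fin n) (Fin n) ℝ := (perturbedMat h₀ X q.2.1 q.1 q.2.2)⁻¹ * derivFst X q

/-- As `h₀` does not depend on `s`, the whole logarithmic derivative carries the factor `w^(2n+2)`;
terms quadratic in it are negligible. -/
theorem logDerivMat_perturbedMat (w s : ℝ) (y : Eucl n) :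
    logDerivMat (perturbedMat h₀ X w) s y =
      w ^ (2 * n + 2) • perturbedLogDeriv h₀ X (s, w, y) := by
  have h : matDeriv (perturbedMat h₀ X w) s y = w ^ (2 * n + 2) • derivFst X (s, w, y) := by
    ext i j
    simp only [matDeriv, perturbedMat, derivFst, Matrix.of_apply, Matrix.add_apply,
      Matrix.smul_apply, smul_eq_mul]
    rw [deriv_const_add, deriv_const_mul_field]
  rw [logDerivMat, h, Matrix.mul_smul]
  rfl

theorem contDiffAt_derivFst (hX : ∀ i j, ContDiff ℝ ∞ fun q => X q i j) (q : ℝ × ℝ × Eucl n)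
    (i j : Fin n) : ContDiffAt ℝ ∞ (fun q => derivFst X q i j) q :=
  contDiffAt_deriv_fst (hX i j).contDiffAt

theorem contDiff_perturbedMat (h₀s : ∀ i j, ContDiff ℝ ∞ fun y => h₀ y i j)
    (hX : ∀ i j, ContDiff ℝ ∞ fun q => X q i j) (i j : Fin n) :
    ContDiff ℝ ∞ fun q : ℝ × ℝ × Eucl n => perturbedMat h₀ X q.2.1 q.1 q.2.2 i j :=
  ((h₀s i j).comp contDiff_snd.snd).add ((contDiff_snd.fst.pow _).mul (hX i j))

theorem contDiffAt_perturbedLogDeriv (h₀s : ∀ i j, ContDiff ℝ ∞ fun y => h₀ y i j)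
    (hX : ∀ i j, ContDiff ℝ ∞ fun q => X q i j) {q : ℝ × ℝ × Eucl n}
    (hq : (perturbedMat h₀ X q.2.1 q.1 q.2.2).det ≠ 0) (i j : Fin n) :
    ContDiffAt ℝ ∞ (fun q => perturbedLogDeriv h₀ X q i j) q := by
  simp only [perturbedLogDeriv, Matrix.mul_apply]
  exact ContDiffAt.sum fun l _ => (contDiffAt_matrix_inv
    (fun i j => (contDiff_perturbedMat h₀s hX i j).contDiffAt) hq i l).mul
      (contDiffAt_derivFst hX q l j)

/-- The scalar curvature of a perturbed metric differs little from that of the unperturbed one. -/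
theorem eventually_abs_coordScalar_perturbedMat_sub_le
    (h₀s : ∀ i j, ContDiff ℝ ∞ fun y => h₀ y i j)
    (hX : ∀ i j, ContDiff ℝ ∞ fun q => X q i j) (h₀1 : (h₀ 0).det ≠ 0) (s₀ : ℝ) :
    ∃ K : ℝ, ∀ᶠ q : ℝ × ℝ × Eucl n in 𝓝 (s₀, 0, 0),
      |coordScalar (perturbedMat h₀ X q.2.1 q.1) q.2.2 - coordScalar h₀ q.2.2| ≤
        K * q.2.1 ^ (2 * n + 2) := by
  -- The factor `w^(2n+2)` is made an independent parameter. The two metrics differ only in this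
  -- parameter, so a local Lipschitz bound gives `K w^(2n+2)` directly.
  let G : ℝ × ℝ × ℝ → Eucl n → Matrix (Fin n) (Fin n) ℝ :=
    fun p y => h₀ y + p.1 • X (p.2.1, p.2.2, y)
  have hG : ∀ (i j) (q : (ℝ × ℝ × ℝ) × Eucl n), ContDiffAt ℝ ∞
      (fun q : (ℝ × ℝ × ℝ) × Eucl n => G q.1 q.2 i j) q := by
    intro i j q
    have h1 : ContDiff ℝ ∞ fun q : (ℝ × ℝ × ℝ) × Eucl n => X (q.1.2.1, q.1.2.2, q.2) i j :=
      (hX i j).comp (f := fun q : (ℝ × ℝ × ℝ) × Eucl n => (q.1.2.1, q.1.2.2, q.2))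
        (contDiff_fst.snd.fst.prodMk (contDiff_fst.snd.snd.prodMk contDiff_snd))
    exact (((h₀s i j).comp contDiff_snd).add (contDiff_fst.fst.mul h1)).contDiffAt
  have h0 : (G ((0, s₀, 0) : ℝ × ℝ × ℝ) 0).det ≠ 0 := by simpa [G] using h₀1
  obtain ⟨K, t, ht, hK⟩ := ((contDiffAt_coordScalar_param (q := (((0, s₀, 0) : ℝ × ℝ × ℝ), 0))
    (fun i j => hG i j _) h0).of_le (m := 1) (by simp)).exists_lipschitzOnWith
  have c1 : Tendsto (fun q : ℝ × ℝ × Eucl n => (((q.2.1 ^ (2 * n + 2), q.1, q.2.1) : ℝ × ℝ × ℝ),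
      q.2.2)) (𝓝 (s₀, 0, 0)) (𝓝 (((0, s₀, 0) : ℝ × ℝ × ℝ), 0)) := by
    refine Continuous.tendsto' (by fun_prop) _ _ (by simp)
  have c2 : Tendsto (fun q : ℝ × ℝ × Eucl n => ((((0 : ℝ), q.1, q.2.1) : ℝ × ℝ × ℝ),
      q.2.2)) (𝓝 (s₀, 0, 0)) (𝓝 (((0, s₀, 0) : ℝ × ℝ × ℝ), 0)) := by
    refine Continuous.tendsto' (by fun_prop) _ _ (by simp)
  refine ⟨K, ?_⟩
  filter_upwards [c1 ht, c2 ht] with q h1 h2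
  have h3 := hK.dist_le_mul _ h1 _ h2
  have h4 : G (0, q.1, q.2.1) = h₀ := by ext y; simp [G]
  have h5 : G (q.2.1 ^ (2 * n + 2), q.1, q.2.1) = perturbedMat h₀ X q.2.1 q.1 := rfl
  simp only [h4, h5, Real.dist_eq] at h3
  refine h3.trans_eq ?_
  have h6 : |q.2.1| ^ (2 * n + 2) = q.2.1 ^ (2 * n + 2) := Even.pow_abs ⟨n + 1, by ring⟩ _
  have h7 : 0 ≤ q.2.1 ^ (2 * n + 2) := Even.pow_nonneg ⟨n + 1, by ring⟩ _
  simp [Prod.dist_eq, h6, h7]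

theorem eventually_blockRegular_perturbedMat (c : ℝ) {m : ℝ → ℝ} (hm : ContDiff ℝ ∞ m)
    (h₀s : ∀ i j, ContDiff ℝ ∞ fun y => h₀ y i j) (h₀symm : ∀ y, (h₀ y).IsSymm)
    (hX : ∀ i j, ContDiff ℝ ∞ fun q => X q i j) (hXsymm : ∀ q, (X q).IsSymm)
    (h₀1 : (h₀ 0).det ≠ 0) {s₀ : ℝ} (hs₀ : 0 < s₀) :
    ∀ᶠ q : ℝ × ℝ × Eucl n in 𝓝 (s₀, 0, 0),
      BlockRegular (radialCoeff n c m q.2.1) (perturbedMat h₀ X q.2.1) q.1 q.2.2 := by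
  have hdet : ContinuousAt (fun q : ℝ × ℝ × Eucl n => (perturbedMat h₀ X q.2.1 q.1 q.2.2).det)
      (s₀, 0, 0) := (contDiffAt_matrix_det fun i j =>
        (contDiff_perturbedMat h₀s hX i j).contDiffAt).continuousAt
  have hd0 : (perturbedMat h₀ X 0 s₀ 0).det ≠ 0 := by simpa [perturbedMat] using h₀1
  have hF : ContinuousAt (fun q : ℝ × ℝ × Eucl n => radialCoeff n c m q.2.1 q.1) (s₀, 0, 0) :=
    ContinuousAt.comp (g := fun q : ℝ × ℝ => radialCoeff n c m q.2 q.1)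
      (f := fun q : ℝ × ℝ × Eucl n => (q.1, q.2.1))
      (contDiffAt_radialCoeff (q := (s₀, 0)) hm hs₀.ne').continuousAt (by fun_prop)
  have hF0 : radialCoeff n c m 0 s₀ ≠ 0 := by simp [radialCoeff]
  filter_upwards [hdet.eventually_ne hd0, hF.eventually_ne hF0,
    continuousAt_fst.eventually (lt_mem_nhds hs₀)] with q hq1 hq2 hq3
  have hq3' : q.1 ≠ 0 := (show 0 < q.1 from hq3).ne'
  exact
    { smooth_W := ContDiffAt.comp (g := fun q : ℝ × ℝ => radialCoeff n c m q.2 q.1)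
        (f := fun s => (s, q.2.1)) q.1 (contDiffAt_radialCoeff hm hq3')
        (contDiffAt_id.prodMk contDiffAt_const)
      smooth := fun i j => ((contDiff_perturbedMat h₀s hX i j).comp
        (f := fun p : ℝ × Eucl n => (p.1, q.2.1, p.2))
        (contDiff_fst.prodMk (contDiff_const.prodMk contDiff_snd))).contDiffAt
      symm := Eventually.of_forall fun p => (h₀symm _).add ((hXsymm _).smul _)
      W_ne := hq2
      det_ne := hq1 }

/-- Write `ε = w^(2n+2)`. In the radial formula `-n (s F' + (n+1) F)` equals `-n(n+1)(1 + c ε) -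
n(n-1) w⁴ / s² + ε n m' / s^n`. The middle term is the round sphere's contribution, up to an error
`O(w⁴ ε)`, and all remaining terms contain `ε`. Hence the defect is at least `ε Y` with `Y`
continuous, and `hpos` says that `Y > 0` at `w = 0`, `y = 0`. -/
theorem eventually_coordScalar_perturbed_ge (c : ℝ) {m : ℝ → ℝ} (hm : ContDiff ℝ ∞ m)
    (h₀s : ∀ i j, ContDiff ℝ ∞ fun y => h₀ y i j) (h₀symm : ∀ y, (h₀ y).IsSymm)
    (hX : ∀ i j, ContDiff ℝ ∞ fun q => X q i j) (hXsymm : ∀ q, (X q).IsSymm)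
    (h₀1 : h₀ 0 = 1) (h₀S : ∀ y, coordScalar h₀ y = n * (n - 1)) {s₀ : ℝ} (hs₀ : 0 < s₀)
    (hpos : 0 < n * (deriv m s₀ / s₀ ^ n) -
      (s₀ ^ 2 * deriv (fun s => (derivFst X (s, 0, 0)).trace) s₀
        + (n + 2) * s₀ * (derivFst X (s₀, 0, 0)).trace)) :
    ∀ᶠ q : ℝ × ℝ × Eucl n in 𝓝 (s₀, 0, 0), ∀ (ρ : ℝ) (z : Eucl (n + 1)), 0 < ρ →
      ρ * q.2.1 ^ 2 = 1 → z 0 = q.1 → euclTail n z = q.2.2 →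
      -(n * (n + 1)) * (1 + c * q.2.1 ^ (2 * n + 2)) ≤
        coordScalar (blockMetric (fun s => (s ^ 2 * radialCoeff n c m q.2.1 s)⁻¹)
          fun s y => (ρ * s) ^ 2 • perturbedMat h₀ X q.2.1 s y) z := by
  have h₀d : (h₀ 0).det ≠ 0 := by rw [h₀1, Matrix.det_one]; norm_num
  obtain ⟨K, hK⟩ := eventually_abs_coordScalar_perturbedMat_sub_le h₀s hX h₀d s₀
  have hreg := eventually_blockRegular_perturbedMat c hm h₀s h₀symm hX hXsymm h₀d hs₀
  set N := perturbedLogDeriv h₀ X with hN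
  have hd0 : (perturbedMat h₀ X 0 s₀ 0).det ≠ 0 := by simpa [perturbedMat] using h₀d
  have hNs : ∀ i j, ContDiffAt ℝ ∞ (fun q => N q i j) (s₀, 0, 0) := fun i j =>
    contDiffAt_perturbedLogDeriv h₀s hX hd0 i j
  have htr : ContDiffAt ℝ ∞ (fun q => (N q).trace) (s₀, 0, 0) := by
    simp only [Matrix.trace, Matrix.diag]
    exact ContDiffAt.sum fun i _ => hNs i i
  have htr2 : ContDiffAt ℝ ∞ (fun q => (N q * N q).trace) (s₀, 0, 0) := by
    simp only [Matrix.trace, Matrix.diag, Matrix.mul_apply]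
    exact ContDiffAt.sum fun i _ => ContDiffAt.sum fun j _ => (hNs i j).mul (hNs j i)
  have htr' := contDiffAt_deriv_fst htr
  let F' : ℝ → ℝ → ℝ := fun w s => -2 * w ^ 4 / s ^ 3 + w ^ (2 * n + 2) *
        ((n + 1) * m s / s ^ (n + 2) - deriv m s / s ^ (n + 1))
  -- The defect divided by `w^(2n+2)`, with the curvature of the perturbed sphere replaced by its
  -- Lipschitz lower bound. At `w = 0` the `K` term, the quadratic terms and `F'` vanish and `F =
  -- 1`.
  let Y : ℝ × ℝ × Eucl n → ℝ := fun q => -(q.2.1 ^ 4 / q.1 ^ 2) * K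
    + n * (deriv m q.1 / q.1 ^ n)
    - radialCoeff n c m q.2.1 q.1 * (q.1 ^ 2 * deriv (fun s => (N (s, q.2)).trace) q.1
        + (n + 2) * q.1 * (N q).trace
        + q.1 ^ 2 / 4 * (q.2.1 ^ (2 * n + 2) * ((N q * N q).trace + (N q).trace ^ 2)))
    - q.1 ^ 2 / 2 * F' q.2.1 q.1 * (N q).trace
  have cs : ContinuousAt (fun q : ℝ × ℝ × Eucl n => q.1) (s₀, 0, 0) := continuousAt_fst
  have cw : ContinuousAt (fun q : ℝ × ℝ × Eucl n => q.2.1) (s₀, 0, 0) := by fun_prop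
  have cm : ContinuousAt (fun q : ℝ × ℝ × Eucl n => m q.1) (s₀, 0, 0) :=
    (hm.continuous.comp continuous_fst).continuousAt
  have cm' : ContinuousAt (fun q : ℝ × ℝ × Eucl n => deriv m q.1) (s₀, 0, 0) :=
    ((hm.continuous_deriv (by simp)).comp continuous_fst).continuousAt
  have hsk : ∀ k : ℕ, s₀ ^ k ≠ 0 := fun k => pow_ne_zero k hs₀.ne'
  have cF : ContinuousAt (fun q : ℝ × ℝ × Eucl n => radialCoeff n c m q.2.1 q.1) (s₀, 0, 0) :=
    (continuousAt_const.add ((cw.pow 4).div (cs.pow 2) (hsk 2))).add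
      ((cw.pow _).mul (continuousAt_const.sub (cm.div (cs.pow _) (hsk _))))
  have cF' : ContinuousAt (fun q : ℝ × ℝ × Eucl n => F' q.2.1 q.1) (s₀, 0, 0) :=
    ((continuousAt_const.mul (cw.pow 4)).div (cs.pow 3) (hsk 3)).add ((cw.pow _).mul
      (((continuousAt_const.mul cm).div (cs.pow _) (hsk _)).sub (cm'.div (cs.pow _) (hsk _))))
  have cY : ContinuousAt Y (s₀, 0, 0) :=
    ((((((cw.pow 4).div (cs.pow 2) (hsk 2)).neg.mul continuousAt_const).add
      (continuousAt_const.mul (cm'.div (cs.pow n) (hsk n))))).sub (cF.mul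
        ((((cs.pow 2).mul htr'.continuousAt).add ((continuousAt_const.mul cs).mul
          htr.continuousAt)).add (((cs.pow 2).div_const 4).mul ((cw.pow _).mul
            (htr2.continuousAt.add (htr.continuousAt.pow 2))))))).sub
      ((((cs.pow 2).div_const 2).mul cF').mul htr.continuousAt)
  have hN0 : ∀ s, N (s, 0, 0) = derivFst X (s, 0, 0) := by
    intro s
    simp [hN, perturbedLogDeriv, perturbedMat, h₀1]
  have hY0 : 0 < Y (s₀, 0, 0) := by
    simpa [Y, F', hN0, radialCoeff] using hpos
  filter_upwards [cY.eventually (lt_mem_nhds hY0), hK, hreg.eventually_nhds,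
    cs.eventually (lt_mem_nhds hs₀)] with q hq1 hq2 hq3 hq4 ρ z hρ hρw hz0 hzt
  obtain ⟨s, w, y⟩ := q
  simp only at hz0 hzt hq1 hq2 hq4 hρw ⊢
  subst hz0 hzt
  have hs : z 0 ≠ 0 := ne_of_gt hq4
  have hw : w ≠ 0 := by rintro rfl; simp at hρw
  have hr : ∀ᶠ p : ℝ × Eucl n in 𝓝 (z 0, euclTail n z),
      BlockRegular (radialCoeff n c m w) (perturbedMat h₀ X w) p.1 p.2 :=
    (Continuous.tendsto' (f := fun p : ℝ × Eucl n => (p.1, w, p.2)) (by fun_prop)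
      (z 0, euclTail n z) _ rfl).eventually hq3
  rw [coordScalar_radial hρ hq4 hr]
  rw [(hasDerivAt_radialCoeff c hm w hs).deriv]
  simp only [logDerivMat_perturbedMat, Matrix.trace_smul, smul_eq_mul, deriv_const_mul_field,
    Matrix.smul_mul, Matrix.mul_smul]
  rw [← hN]
  rw [h₀S] at hq2
  have hρ' : ((ρ * z 0) ^ 2)⁻¹ = w ^ 4 / z 0 ^ 2 := by
    have : ρ = (w ^ 2)⁻¹ := eq_inv_of_mul_eq_one_left hρw
    rw [this]; field_simp
  rw [hρ']
  set S := coordScalar (perturbedMat h₀ X w (z 0)) (euclTail n z)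
  have hε : 0 < w ^ (2 * n + 2) := Even.pow_pos ⟨n + 1, by ring⟩ hw
  have h1 : 0 ≤ w ^ 4 / z 0 ^ 2 * (S - n * (n - 1) + K * w ^ (2 * n + 2)) :=
    mul_nonneg (by positivity) (by linarith [(abs_le.1 hq2).1])
  have h2 := mul_pos hε hq1
  rw [← sub_nonneg]
  refine (add_nonneg h1 h2.le).trans_eq ?_
  simp only [Y, F']
  set b := (N (z 0, w, euclTail n z)).trace
  set b2 := (N (z 0, w, euclTail n z) * N (z 0, w, euclTail n z)).trace
  set b' := deriv (fun s => (N (s, w, euclTail n z)).trace) (z 0)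
  simp only [radialCoeff]
  generalize z 0 = s at *
  generalize w ^ (2 * n + 2) = ε at *
  rw [pow_succ s (n + 1), pow_succ s n]
  have hsn : s ^ n ≠ 0 := pow_ne_zero _ hs
  field_simp
  ring

end

/-! ### The expansion of `h` in the variable `w` -/

theorem tendsto_arsinh_div_self : Tendsto (fun x : ℝ => Real.arsinh x / x) (𝓝[≠] 0) (𝓝 1) := by
  have h := (Real.hasDerivAt_arsinh 0).tendsto_slope_zero
  simp only [zero_add, Real.arsinh_zero, sub_zero, smul_eq_mul] at h
  norm_num at h
  exact h.congr fun x => by rw [div_eq_inv_mul]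

/-- The function `arsinh (w² / s)` tends to `0` from the right as `w → 0`, `w ≠ 0`. -/
theorem tendsto_arsinh_sq_div {s : ℝ} (hs : 0 < s) :
    Tendsto (fun w : ℝ => Real.arsinh (w ^ 2 / s)) (𝓝[≠] 0) (𝓝[>] 0) := by
  refine tendsto_nhdsWithin_iff.2 ⟨?_, ?_⟩
  · have : Continuous fun w : ℝ => Real.arsinh (w ^ 2 / s) :=
      Real.continuous_arsinh.comp (by fun_prop)
    exact (this.tendsto' 0 0 (by simp)).mono_left nhdsWithin_le_nhds
  · filter_upwards [self_mem_nhdsWithin] with w hw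
    exact Real.arsinh_pos_iff.2 (div_pos (pow_pos (abs_pos.2 hw) 2 |>.trans_eq (sq_abs w)) hs)

section
variable {n : ℕ} {R : ℝ} {h : ℝ → Eucl (n + 1) → BilForm (n + 1)}
  {k : Eucl (n + 1) → BilForm (n + 1)}

theorem tendsto_expansion_div_pow (he : ∃ C : ℝ, ∀ᶠ t in 𝓝[>] (0 : ℝ), ∀ θ : Eucl (n + 1),
      ‖θ‖ = 1 → ∀ u v : Eucl (n + 1), inner ℝ θ u = 0 → inner ℝ θ v = 0 →
      |h t θ u v - (inner ℝ u v + t ^ (n + 1) * k θ u v)| ≤ C * t ^ (n + 2) * (‖u‖ * ‖v‖))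
    {θ u v : Eucl (n + 1)} (hθ : ‖θ‖ = 1) (hu : inner ℝ θ u = 0) (hv : inner ℝ θ v = 0) :
    Tendsto (fun t => (h t θ u v - inner ℝ u v) / t ^ (n + 1)) (𝓝[>] 0) (𝓝 (k θ u v)) := by
  obtain ⟨C, hC⟩ := he
  rw [tendsto_iff_norm_sub_tendsto_zero]
  have h0 : Tendsto (fun t : ℝ => C * t * (‖u‖ * ‖v‖)) (𝓝[>] 0) (𝓝 0) := by
    have : Continuous fun t : ℝ => C * t * (‖u‖ * ‖v‖) := by fun_prop
    exact (this.tendsto' 0 0 (by simp)).mono_left nhdsWithin_le_nhds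
  refine squeeze_zero' (Eventually.of_forall fun _ => norm_nonneg _) ?_ h0
  filter_upwards [hC, self_mem_nhdsWithin] with t ht ht0
  have ht0' : 0 < t := ht0
  have hp : 0 < t ^ (n + 1) := pow_pos ht0' _
  have h1 := ht θ hθ u v hu hv
  rw [Real.norm_eq_abs, show (h t θ u v - inner ℝ u v) / t ^ (n + 1) - k θ u v =
    (h t θ u v - (inner ℝ u v + t ^ (n + 1) * k θ u v)) / t ^ (n + 1) by field_simp; ring,
    abs_div, abs_of_pos hp, div_le_iff₀ hp]
  refine h1.trans_eq ?_
  ring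

/-- Since `arsinh x ~ x` at `0`, `t^(n+1)` with `t = arsinh(w² / s)` is asymptotic to `w^(2n+2) /
s^(n+1)`. -/
theorem tendsto_expansion_div_sq_pow (he : ∃ C : ℝ, ∀ᶠ t in 𝓝[>] (0 : ℝ), ∀ θ : Eucl (n + 1),
      ‖θ‖ = 1 → ∀ u v : Eucl (n + 1), inner ℝ θ u = 0 → inner ℝ θ v = 0 →
      |h t θ u v - (inner ℝ u v + t ^ (n + 1) * k θ u v)| ≤ C * t ^ (n + 2) * (‖u‖ * ‖v‖))
    {θ u v : Eucl (n + 1)} (hθ : ‖θ‖ = 1) (hu : inner ℝ θ u = 0) (hv : inner ℝ θ v = 0) {s : ℝ}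
    (hs : 0 < s) :
    Tendsto (fun w : ℝ => (h (Real.arsinh (w ^ 2 / s)) θ u v - inner ℝ u v) / w ^ (2 * n + 2))
      (𝓝[≠] 0) (𝓝 (k θ u v / s ^ (n + 1))) := by
  have h1 := (tendsto_expansion_div_pow he hθ hu hv).comp (tendsto_arsinh_sq_div hs)
  have h2 : Tendsto (fun w : ℝ => w ^ 2 / s) (𝓝[≠] 0) (𝓝[≠] 0) := by
    refine tendsto_nhdsWithin_iff.2 ⟨?_, ?_⟩
    · have : Continuous fun w : ℝ => w ^ 2 / s := by fun_prop
      exact (this.tendsto' 0 0 (by simp)).mono_left nhdsWithin_le_nhds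
    · filter_upwards [self_mem_nhdsWithin] with w hw
      exact div_ne_zero (pow_ne_zero 2 hw) hs.ne'
  have h3 := h1.mul (((tendsto_arsinh_div_self.comp h2).div_const s).pow (n + 1))
  rw [one_div, inv_pow, ← div_eq_mul_inv] at h3
  refine h3.congr' ?_
  filter_upwards [self_mem_nhdsWithin] with w hw
  have hw' : w ≠ 0 := hw
  have ht : Real.arsinh (w ^ 2 / s) ≠ 0 := (Real.arsinh_pos_iff.2 (by positivity)).ne'
  simp only [Function.comp_apply]
  rw [show 2 * n + 2 = 2 * (n + 1) by ring, pow_mul]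
  have h4 : Real.arsinh (w ^ 2 / s) / (w ^ 2 / s) / s = Real.arsinh (w ^ 2 / s) / w ^ 2 := by
    field_simp
  rw [h4, div_pow]
  field_simp

/-- The map `w ↦ arsinh(w² / s)` takes values in `[0, T)` for `w` of either sign as long as `R w² <
s`. Smoothness of `h` up to the boundary `t = 0` thus becomes smoothness in `w` at the interior
point `w = 0`. -/
theorem contDiffAt_expansion (hh : ContDiffOn ℝ ∞
      (fun q : ℝ × Eucl (n + 1) => h q.1 (polarTheta q.2)) (Ico 0 (Real.arsinh (1 / R)) ×ˢ {0}ᶜ))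
    (hR : 0 < R) (A : SphereFrame n) {q : ℝ × ℝ × Eucl n} (hq : R * q.1 ^ 2 < q.2.1) (i j : Fin n) :
    ContDiffAt ℝ ∞ (fun q : ℝ × ℝ × Eucl n =>
      formMatrix (A.pull (h (Real.arsinh (q.1 ^ 2 / q.2.1))) q.2.2) i j) q := by
  let U : Set (ℝ × ℝ × Eucl n) := {q | R * q.1 ^ 2 < q.2.1}
  have hU : IsOpen U := isOpen_lt (by fun_prop) (by fun_prop)
  have hs : ∀ q ∈ U, 0 < q.2.1 := fun q hq =>
    lt_of_le_of_lt (mul_nonneg hR.le (sq_nonneg q.1)) hq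
  have h1 : ContDiffOn ℝ ∞ (fun q : ℝ × ℝ × Eucl n =>
      ((Real.arsinh (q.1 ^ 2 / q.2.1), A.center + A.L q.2.2) : ℝ × Eucl (n + 1))) U := by
    refine ContDiffOn.prodMk (ContDiffOn.arsinh ?_)
      (A.contDiff_add.comp contDiff_snd.snd).contDiffOn
    exact (contDiff_fst.pow 2).contDiffOn.div contDiff_snd.fst.contDiffOn fun q hq => (hs q hq).ne'
  have h2 : MapsTo (fun q : ℝ × ℝ × Eucl n =>
      ((Real.arsinh (q.1 ^ 2 / q.2.1), A.center + A.L q.2.2) : ℝ × Eucl (n + 1))) U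
      (Ico 0 (Real.arsinh (1 / R)) ×ˢ {0}ᶜ) := by
    intro q hq
    refine ⟨⟨Real.arsinh_nonneg_iff.2 (div_nonneg (sq_nonneg _) (hs q hq).le), ?_⟩,
      A.add_ne_zero _⟩
    refine Real.arsinh_lt_arsinh.2 ?_
    rw [div_lt_div_iff₀ (hs q hq) hR]
    have : R * q.1 ^ 2 < q.2.1 := hq
    linarith
  have h3 := (hh.comp h1 h2).contDiffAt (hU.mem_nhds hq)
  have h4 : ContDiffAt ℝ ∞ (fun q : ℝ × ℝ × Eucl n => fderiv ℝ A.om q.2.2) q :=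
    ((A.contDiff_om.fderiv_right (m := ∞) (by simp)).comp contDiff_snd.snd).contDiffAt
  simp only [formMatrix_apply, SphereFrame.pull_apply]
  exact (h3.clm_apply (h4.clm_apply contDiffAt_const)).clm_apply (h4.clm_apply contDiffAt_const)

/-- The difference of `h` and the round metric is smooth in `(w, s, y)` and `O(w^(2n+2))`, so
Hadamard's lemma divides it by `w^(2n+2)`. The value of the quotient at `w = 0` is a limit, which
the expansion of `h` identifies; only its trace at the centre is recorded. -/
theorem exists_perturbation_expansion (hh : ContDiffOn ℝ ∞
      (fun q : ℝ × Eucl (n + 1) => h q.1 (polarTheta q.2)) (Ico 0 (Real.arsinh (1 / R)) ×ˢ {0}ᶜ))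
    (hR : 0 < R) (he : ∃ C : ℝ, ∀ᶠ t in 𝓝[>] (0 : ℝ), ∀ θ : Eucl (n + 1), ‖θ‖ = 1 →
      ∀ u v : Eucl (n + 1), inner ℝ θ u = 0 → inner ℝ θ v = 0 →
      |h t θ u v - (inner ℝ u v + t ^ (n + 1) * k θ u v)| ≤ C * t ^ (n + 2) * (‖u‖ * ‖v‖))
    (hsymm : ∀ t ∈ Ioo 0 (Real.arsinh (1 / R)), ∀ θ : Eucl (n + 1), ‖θ‖ = 1 →
      ∀ u v, inner ℝ θ u = 0 → inner ℝ θ v = 0 → h t θ u v = h t θ v u)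
    (A : SphereFrame n) {s₀ : ℝ} (hs₀ : 0 < s₀) :
    ∃ κ : ℝ × ℝ × Eucl n → Matrix (Fin n) (Fin n) ℝ, (∀ i j, ContDiff ℝ ∞ fun q => κ q i j) ∧
      (∀ q, (κ q).IsSymm) ∧
      (∀ᶠ q : ℝ × ℝ × Eucl n in 𝓝 (s₀, 0, 0),
        formMatrix (A.pull (h (Real.arsinh (q.2.1 ^ 2 / q.1))) q.2.2) =
          formMatrix (A.roundForm q.2.2) + q.2.1 ^ (2 * n + 2) • κ q) ∧
      ∀ᶠ s in 𝓝 s₀, (κ (s, 0, 0)).trace = sphereTrace A.center (k A.center) / s ^ (n + 1) := by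
  let U : Set (ℝ × ℝ × Eucl n) := {q | R * q.1 ^ 2 < q.2.1}
  have hU : IsOpen U := isOpen_lt (by fun_prop) (by fun_prop)
  have hUs : ∀ q ∈ U, 0 < q.2.1 := fun q hq =>
    lt_of_le_of_lt (mul_nonneg hR.le (sq_nonneg q.1)) hq
  have hU0 : ((0, s₀, 0) : ℝ × ℝ × Eucl n) ∈ U := by simpa [U] using hs₀
  obtain ⟨r, hr, hrU⟩ := Metric.isOpen_iff.1 hU _ hU0
  -- Hadamard's lemma is for globally defined functions; multiplying by a bump supported where `R w²
  -- < s` gives a global extension that is unchanged near the base point.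
  let b : ContDiffBump ((0, s₀, 0) : ℝ × ℝ × Eucl n) :=
    ⟨r / 4, r / 2, by positivity, by linarith⟩
  have hbU : tsupport b ⊆ U := by
    rw [b.tsupport_eq]
    exact (Metric.closedBall_subset_ball (show r / 2 < r by linarith)).trans hrU
  let d : Fin n → Fin n → ℝ × ℝ × Eucl n → ℝ := fun i j q =>
    formMatrix (A.pull (h (Real.arsinh (q.1 ^ 2 / q.2.1))) q.2.2) i j
      - formMatrix (A.roundForm q.2.2) i j
  have hd : ∀ i j, ∀ q ∈ U, ContDiffAt ℝ ∞ (d i j) q := fun i j q hq =>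
    (contDiffAt_expansion hh hR A hq i j).sub
      ((SphereFrame.contDiff_roundForm i j).comp contDiff_snd.snd).contDiffAt
  have hf : ∀ i j, ContDiff ℝ ∞ fun q => b q * d i j q := by
    intro i j
    refine contDiff_iff_contDiffAt.2 fun q => ?_
    by_cases hq : q ∈ U
    · exact b.contDiffAt.mul (hd i j q hq)
    · refine (contDiffAt_const (c := (0 : ℝ))).congr_of_eventuallyEq ?_
      filter_upwards [notMem_tsupport_iff_eventuallyEq.1 fun h => hq (hbU h)] with p hp
      simp [hp]
  have hlim : ∀ i j (p : ℝ × Eucl n), 0 < p.1 → Tendsto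
      (fun w => (b (w, p) * d i j (w, p)) / w ^ (2 * n + 2)) (𝓝[≠] 0)
      (𝓝 (b (0, p) * (k (A.om p.2) (fderiv ℝ A.om p.2 (EuclideanSpace.single i 1))
        (fderiv ℝ A.om p.2 (EuclideanSpace.single j 1)) / p.1 ^ (n + 1)))) := by
    intro i j p hp
    have h1 := tendsto_expansion_div_sq_pow he (A.norm_om p.2)
      (A.inner_om_fderiv p.2 (EuclideanSpace.single i 1))
      (A.inner_om_fderiv p.2 (EuclideanSpace.single j 1)) hp
    have h2 : Tendsto (fun w : ℝ => b (w, p)) (𝓝[≠] 0) (𝓝 (b (0, p))) :=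
      ((b.continuous.comp (f := fun w : ℝ => (w, p)) (by fun_prop)).tendsto 0).mono_left
        nhdsWithin_le_nhds
    refine (h2.mul h1).congr fun w => ?_
    simp only [d, formMatrix_apply, SphereFrame.pull_apply, SphereFrame.roundForm_apply]
    rw [mul_div_assoc]
  have hO : ∀ i j (p : ℝ × Eucl n), (fun w => b (w, p) * d i j (w, p)) =O[𝓝[≠] 0]
      fun w => w ^ (2 * n + 2) := by
    intro i j p
    by_cases hp : 0 < p.1
    · refine Asymptotics.isBigO_of_div_tendsto_nhds ?_ _ (hlim i j p hp)
      filter_upwards [self_mem_nhdsWithin] with w hw h0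
      exact absurd h0 (pow_ne_zero _ hw)
    · have : ∀ w, b (w, p) * d i j (w, p) = 0 := fun w => by
        have : b (w, p) = 0 := by
          by_contra hb
          exact hp (hUs _ (hbU (subset_tsupport _ hb)))
        rw [this, zero_mul]
      simp only [this]
      exact Asymptotics.isBigO_zero _ _
  choose κ hκ hκe using fun i j => exists_contDiff_eq_pow_mul (hf i j) (2 * n + 2) (hO i j)
  have hb1 : ∀ᶠ q in 𝓝 ((0, s₀, 0) : ℝ × ℝ × Eucl n), b q = 1 := b.eventuallyEq_one
  have hκ0 : ∀ i j (p : ℝ × Eucl n), 0 < p.1 → b (0, p) = 1 → κ i j (0, p) =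
      k (A.om p.2) (fderiv ℝ A.om p.2 (EuclideanSpace.single i 1))
        (fderiv ℝ A.om p.2 (EuclideanSpace.single j 1)) / p.1 ^ (n + 1) := by
    intro i j p hp hb
    have h1 := hlim i j p hp
    rw [hb, one_mul] at h1
    have h2 : Tendsto (fun w : ℝ => κ i j (w, p)) (𝓝[≠] 0) (𝓝 (κ i j (0, p))) :=
      (((hκ i j).continuous.comp (f := fun w : ℝ => (w, p)) (by fun_prop)).tendsto 0).mono_left
        nhdsWithin_le_nhds
    refine tendsto_nhds_unique h2 (h1.congr' ?_)
    filter_upwards [self_mem_nhdsWithin] with w hw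
    rw [hκe, mul_div_cancel_left₀ _ (pow_ne_zero _ hw)]
  let σ : ℝ × ℝ × Eucl n → ℝ × ℝ × Eucl n := fun q => (q.2.1, q.1, q.2.2)
  have hσ : ContDiff ℝ ∞ σ := contDiff_snd.fst.prodMk (contDiff_fst.prodMk contDiff_snd.snd)
  have hσ0 : Tendsto σ (𝓝 (s₀, 0, 0)) (𝓝 (0, s₀, 0)) := hσ.continuous.tendsto' _ _ rfl
  -- Symmetry of `h` is known only for `t ∈ (0, T)`; symmetrising the quotient makes it symmetric
  -- everywhere and does not affect the expansion near the base point.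
  refine ⟨fun q => Matrix.of fun i j => (1 / 2) * (κ i j (σ q) + κ j i (σ q)), fun i j =>
    contDiff_const.mul (((hκ i j).comp hσ).add ((hκ j i).comp hσ)), fun q =>
    Matrix.IsSymm.ext fun i j => by simp [add_comm], ?_, ?_⟩
  · filter_upwards [hσ0.eventually hb1, hσ0.eventually (hU.mem_nhds hU0)] with q hq1 hq2
    have h1 : ∀ i j, d i j (σ q) = q.2.1 ^ (2 * n + 2) * κ i j (σ q) := by
      intro i j
      have := hκe i j q.2.1 (q.1, q.2.2)
      rw [← this]
      change _ = b (σ q) * d i j (σ q)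
      rw [hq1, one_mul]
    have h2 : ∀ i j, d i j (σ q) = d j i (σ q) := by
      intro i j
      by_cases hw : q.2.1 = 0
      · rw [h1, h1, hw]; simp
      · have hs : 0 < q.1 := hUs _ hq2
        have hq2' : R * q.2.1 ^ 2 < q.1 := hq2
        simp only [d, σ, formMatrix_apply, SphereFrame.pull_apply, SphereFrame.roundForm_apply]
        rw [hsymm _ ⟨?_, ?_⟩ _ (A.norm_om _) _ _ (A.inner_om_fderiv _ _) (A.inner_om_fderiv _ _),
          real_inner_comm]
        · exact Real.arsinh_pos_iff.2 (by positivity)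
        · refine Real.arsinh_lt_arsinh.2 ?_
          rw [div_lt_div_iff₀ hs hR]
          linarith
    ext i j
    simp only [Matrix.add_apply, Matrix.smul_apply, Matrix.of_apply, smul_eq_mul]
    have h3 : formMatrix (A.pull (h (Real.arsinh (q.2.1 ^ 2 / q.1))) q.2.2) i j =
        formMatrix (A.roundForm q.2.2) i j + d i j (σ q) := by simp [d, σ]
    rw [h3]
    linear_combination (1 / 2) * h1 i j + (1 / 2) * h1 j i + (1 / 2) * h2 i j
  · have h1 : Tendsto (fun s : ℝ => ((0, s, 0) : ℝ × ℝ × Eucl n)) (𝓝 s₀) (𝓝 (0, s₀, 0)) :=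
      Continuous.tendsto' (by fun_prop) _ _ rfl
    filter_upwards [h1.eventually hb1, lt_mem_nhds hs₀] with s hs1 hs2
    rw [A.sphereTrace_center, Finset.sum_div]
    refine Finset.sum_congr rfl fun i _ => ?_
    have h2 := hκ0 i i (s, 0) hs2 hs1
    simp only [A.om_zero, A.fderiv_om_zero] at h2
    simp only [Matrix.diag_apply, Matrix.of_apply, σ, h2]
    ring

end

/-! ### The deformed metric -/

/-- The Euclidean inner product as a bilinear form. -/
noncomputable def innerForm (m : ℕ) : BilForm m := innerSL ℝ

theorem innerForm_apply {m : ℕ} (u v : Eucl m) : innerForm m u v = inner ℝ u v := rfl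

section
variable {m : ℕ} {W : ℝ → ℝ} {β : ℝ → Eucl m → BilForm m} {x : Eucl m}

theorem polarForm_symm (hx : x ≠ 0) (hβ : ∀ u v, inner ℝ (polarTheta x) u = 0 →
    inner ℝ (polarTheta x) v = 0 → β ‖x‖ (polarTheta x) u v = β ‖x‖ (polarTheta x) v u)
    (u v : Eucl m) : polarForm W β x u v = polarForm W β x v u := by
  rw [polarForm_apply, polarForm_apply,
    hβ _ _ (inner_polarTheta_fderiv hx u) (inner_polarTheta_fderiv hx v)]
  ring

theorem polarForm_pos (hx : x ≠ 0) (hW : 0 < W ‖x‖) (hβ : ∀ u, inner ℝ (polarTheta x) u = 0 →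
    u ≠ 0 → 0 < β ‖x‖ (polarTheta x) u u) {u : Eucl m} (hu : u ≠ 0) :
    0 < polarForm W β x u u := by
  have hn : 0 < ‖x‖ := norm_pos_iff.2 hx
  rw [polarForm_apply]
  by_cases h : fderiv ℝ polarTheta x u = 0
  · have h1 := fderiv_norm_smul_add hx u
    have h2 : fderiv ℝ (fun y : Eucl m => ‖y‖) x u ≠ 0 := by
      intro h2
      rw [h, h2, zero_smul, smul_zero, add_zero] at h1
      exact hu h1.symm
    rw [h, map_zero, mul_zero, add_zero]
    exact mul_pos hW (mul_self_pos.2 h2)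
  · exact add_pos_of_nonneg_of_pos (mul_nonneg hW.le (mul_self_nonneg _))
      (mul_pos (pow_pos hn 2) (hβ _ (inner_polarTheta_fderiv hx u) h))

theorem contDiffAt_polarForm (hx : x ≠ 0) (hW : ContDiffAt ℝ ∞ W ‖x‖)
    (hβ : ContDiffAt ℝ ∞ (fun x => β ‖x‖ (polarTheta x)) x) :
    ContDiffAt ℝ ∞ (polarForm W β) x := by
  have h1 : ContDiffAt ℝ ∞ (fun y : Eucl m => ‖y‖) x := contDiffAt_norm ℝ hx
  have h2 : ContDiffAt ℝ ∞ (fderiv ℝ fun y : Eucl m => ‖y‖) x := h1.fderiv_right (by simp)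
  have h3 : ContDiffAt ℝ ∞ (fderiv ℝ (polarTheta (m := m))) x :=
    (contDiffAt_polarTheta hx).fderiv_right (by simp)
  refine contDiffAt_form_of_formMatrix fun i j => ?_
  simp only [formMatrix_apply, polarForm_apply]
  exact ((hW.comp x h1).mul ((h2.clm_apply contDiffAt_const).mul
    (h2.clm_apply contDiffAt_const))).add ((h1.pow 2).mul
      ((hβ.clm_apply (h3.clm_apply contDiffAt_const)).clm_apply (h3.clm_apply contDiffAt_const)))

end

/-- A family of metrics on the sphere with the expansion at `t = 0` of an asymptotically hyperbolic
end. -/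
structure IsAHFamily {n : ℕ} (R : ℝ) (h : ℝ → Eucl (n + 1) → BilForm (n + 1))
    (k : Eucl (n + 1) → BilForm (n + 1)) : Prop where
  R_pos : 0 < R
  smooth : ContDiffOn ℝ ∞ (fun q : ℝ × Eucl (n + 1) => h q.1 (polarTheta q.2))
    (Ico 0 (Real.arsinh (1 / R)) ×ˢ {0}ᶜ)
  expansion : ∃ C : ℝ, ∀ᶠ t in 𝓝[>] (0 : ℝ), ∀ θ : Eucl (n + 1), ‖θ‖ = 1 →
    ∀ u v : Eucl (n + 1), inner ℝ θ u = 0 → inner ℝ θ v = 0 →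
      |h t θ u v - (inner ℝ u v + t ^ (n + 1) * k θ u v)| ≤ C * t ^ (n + 2) * (‖u‖ * ‖v‖)
  symm : ∀ t ∈ Ioo 0 (Real.arsinh (1 / R)), ∀ θ : Eucl (n + 1), ‖θ‖ = 1 →
    ∀ u v, inner ℝ θ u = 0 → inner ℝ θ v = 0 → h t θ u v = h t θ v u
  pos : ∀ t ∈ Ioo 0 (Real.arsinh (1 / R)), ∀ θ : Eucl (n + 1), ‖θ‖ = 1 →
    ∀ u, inner ℝ θ u = 0 → u ≠ 0 → 0 < h t θ u u

/-- The cut-off function `χ` and the mass function `m` of a deformation. -/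
structure IsRadialProfile (n : ℕ) (c l : ℝ) (χ m : ℝ → ℝ) : Prop where
  c_pos : 0 < c
  one_le : 1 ≤ l
  smooth_cutoff : ContDiff ℝ ∞ χ
  smooth_mass : ContDiff ℝ ∞ m
  cutoff_inner : ∀ s ≤ 1, χ s = 1
  mass_inner : ∀ s ≤ 1, m s = c * s ^ (n + 1)
  cutoff_outer : ∀ s ≥ 4 * l, χ s = 0
  deriv_mass_nonneg : ∀ s ≥ 4 * l, 0 ≤ deriv m s
  mass_outer : ∀ s ≥ 9 * l, m s = 0
  cutoff_nonneg : ∀ s, 0 ≤ χ s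
  cutoff_le : ∀ s, χ s ≤ 1

section
variable {n : ℕ} {R c l : ℝ} {h : ℝ → Eucl (n + 1) → BilForm (n + 1)}
  {k : Eucl (n + 1) → BilForm (n + 1)} {χ m : ℝ → ℝ}

/-- The angular part `(1 - χ) h₀ + χ h` of the deformed metric. -/
noncomputable def deformAngular (h : ℝ → Eucl (n + 1) → BilForm (n + 1)) (χ : ℝ → ℝ) (w r : ℝ)
    (θ : Eucl (n + 1)) : BilForm (n + 1) :=
  (1 - χ (w ^ 2 * r)) • innerForm (n + 1) + χ (w ^ 2 * r) • h (Real.arsinh (1 / r)) θ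

theorem deformAngular_apply (w r : ℝ) (θ u v : Eucl (n + 1)) : deformAngular h χ w r θ u v =
    (1 - χ (w ^ 2 * r)) * inner ℝ u v + χ (w ^ 2 * r) * h (Real.arsinh (1 / r)) θ u v := by
  simp [deformAngular, innerForm_apply]

/-- The deformed metric, at the scale `r ∼ w⁻²`. -/
noncomputable def deformForm (h : ℝ → Eucl (n + 1) → BilForm (n + 1)) (c : ℝ) (χ m : ℝ → ℝ)
    (w : ℝ) : Eucl (n + 1) → BilForm (n + 1) :=
  polarForm (fun r => (r ^ 2 * radialCoeff n c m w (w ^ 2 * r))⁻¹) (deformAngular h χ w)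

theorem arsinh_one_div_mem (hR : 0 < R) {r : ℝ} (hr : R < r) :
    Real.arsinh (1 / r) ∈ Ioo 0 (Real.arsinh (1 / R)) :=
  ⟨Real.arsinh_pos_iff.2 (one_div_pos.2 (hR.trans hr)),
    Real.arsinh_lt_arsinh.2 (one_div_lt_one_div_of_lt hR hr)⟩

theorem contDiffAt_deformForm (hh : IsAHFamily R h k) (hp : IsRadialProfile n c l χ m) {w : ℝ}
    (hw : 0 < w) {x : Eucl (n + 1)} (hx : R < ‖x‖)
    (hF : radialCoeff n c m w (w ^ 2 * ‖x‖) ≠ 0) : ContDiffAt ℝ ∞ (deformForm h c χ m w) x := by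
  have hn : 0 < ‖x‖ := hh.R_pos.trans hx
  have hx0 : x ≠ 0 := norm_pos_iff.1 hn
  have h1 : ContDiffAt ℝ ∞ (fun y : Eucl (n + 1) => ‖y‖) x := contDiffAt_norm ℝ hx0
  have hs : w ^ 2 * ‖x‖ ≠ 0 := by positivity
  have h2 : ContDiffAt ℝ ∞ (fun r => radialCoeff n c m w (w ^ 2 * r)) ‖x‖ :=
    ContDiffAt.comp (g := fun q : ℝ × ℝ => radialCoeff n c m q.2 q.1)
      (f := fun r => (w ^ 2 * r, w)) ‖x‖ (contDiffAt_radialCoeff hp.smooth_mass hs)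
      ((contDiffAt_const.mul contDiffAt_id).prodMk contDiffAt_const)
  refine contDiffAt_polarForm hx0
    (((contDiffAt_id.pow 2).mul h2).inv (mul_ne_zero (pow_ne_zero 2 hn.ne') hF)) ?_
  have h3 : ContDiffAt ℝ ∞ (fun y : Eucl (n + 1) => χ (w ^ 2 * ‖y‖)) x :=
    hp.smooth_cutoff.contDiffAt.comp x (contDiffAt_const.mul h1)
  have h4 : ContDiffAt ℝ ∞ (fun y : Eucl (n + 1) => h (Real.arsinh (1 / ‖y‖)) (polarTheta y)) x := by
    have ht := arsinh_one_div_mem hh.R_pos hx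
    refine ContDiffAt.comp (g := fun q : ℝ × Eucl (n + 1) => h q.1 (polarTheta q.2))
      (f := fun y => (Real.arsinh (1 / ‖y‖), y)) x
      (hh.smooth.contDiffAt (prod_mem_nhds (Ico_mem_nhds ht.1 ht.2)
        (isOpen_compl_singleton.mem_nhds hx0))) (ContDiffAt.prodMk ?_ contDiffAt_id)
    exact (contDiffAt_const.div h1 hn.ne').arsinh
  refine contDiffAt_form_of_formMatrix fun i j => ?_
  simp only [formMatrix_apply, deformAngular_apply]
  exact ((contDiffAt_const.sub h3).mul contDiffAt_const).add
    (h3.mul ((h4.clm_apply contDiffAt_const).clm_apply contDiffAt_const))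

theorem deformForm_symm (hh : IsAHFamily R h k) {w : ℝ} {x : Eucl (n + 1)} (hx : R < ‖x‖)
    (u v : Eucl (n + 1)) : deformForm h c χ m w x u v = deformForm h c χ m w x v u := by
  have hx0 : x ≠ 0 := norm_pos_iff.1 (hh.R_pos.trans hx)
  refine polarForm_symm hx0 (fun u v hu hv => ?_) u v
  rw [deformAngular_apply, deformAngular_apply, hh.symm _ (arsinh_one_div_mem hh.R_pos hx) _
    (norm_polarTheta hx0) u v hu hv, real_inner_comm]

theorem deformForm_pos (hh : IsAHFamily R h k) (hp : IsRadialProfile n c l χ m) {w : ℝ}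
    {x : Eucl (n + 1)} (hx : R < ‖x‖) (hF : 0 < radialCoeff n c m w (w ^ 2 * ‖x‖))
    {u : Eucl (n + 1)} (hu : u ≠ 0) : 0 < deformForm h c χ m w x u u := by
  have hn : 0 < ‖x‖ := hh.R_pos.trans hx
  have hx0 : x ≠ 0 := norm_pos_iff.1 hn
  refine polarForm_pos hx0 (show 0 < (‖x‖ ^ 2 * radialCoeff n c m w (w ^ 2 * ‖x‖))⁻¹ from
    inv_pos.2 (mul_pos (pow_pos hn 2) hF)) (fun v hv hv0 => ?_) hu
  rw [deformAngular_apply]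
  have h1 := hh.pos _ (arsinh_one_div_mem hh.R_pos hx) _ (norm_polarTheta hx0) v hv hv0
  have h2 : 0 < inner ℝ v v := real_inner_self_pos.2 hv0
  rcases (hp.cutoff_nonneg (w ^ 2 * ‖x‖)).eq_or_lt with h0 | h0
  · rw [← h0]; simpa using h2
  · exact add_pos_of_nonneg_of_pos (mul_nonneg (by linarith [hp.cutoff_le (w ^ 2 * ‖x‖)]) h2.le)
      (mul_pos h0 h1)

/-- The scalar curvature of the deformed metric as that of a block metric in rescaled polar
coordinates. -/
theorem coordScalar_deformForm (hh : IsAHFamily R h k) (hp : IsRadialProfile n c l χ m)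
    (A : SphereFrame n) {w ρ : ℝ} (hw : 0 < w) (hρ : 0 < ρ) (hρw : ρ * w ^ 2 = 1)
    {z : Eucl (n + 1)} (hz : 0 < z 0) (hzR : R < ρ * z 0)
    (hF : ∀ s > 0, 0 < radialCoeff n c m w s) {H : ℝ → Eucl n → Matrix (Fin n) (Fin n) ℝ}
    (hH : ∀ᶠ p : ℝ × Eucl n in 𝓝 (z 0, euclTail n z), H p.1 p.2 =
      formMatrix (A.roundForm p.2) + χ p.1 • (formMatrix (A.pull (h (Real.arsinh (w ^ 2 / p.1))) p.2)
        - formMatrix (A.roundForm p.2))) :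
    coordScalar (fun x => formMatrix (deformForm h c χ m w x)) (A.polarMap ρ z) =
      coordScalar (blockMetric (fun s => (s ^ 2 * radialCoeff n c m w s)⁻¹)
        fun s y => (ρ * s) ^ 2 • H s y) z := by
  have hnorm := SphereFrame.norm_polarMap (A := A) hρ hz
  have hnear : ∀ᶠ x in 𝓝 (A.polarMap ρ z), R < ‖x‖ :=
    continuous_norm.continuousAt.eventually (lt_mem_nhds (hzR.trans_eq hnorm.symm))
  have hs : ∀ x : Eucl (n + 1), R < ‖x‖ → 0 < w ^ 2 * ‖x‖ := fun x hx =>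
    mul_pos (pow_pos hw 2) (hh.R_pos.trans hx)
  have h1 := SphereFrame.coordScalar_polarForm (A := A)
    (W := fun r => (r ^ 2 * radialCoeff n c m w (w ^ 2 * r))⁻¹) (β := deformAngular h χ w) hρ hz
    (hnear.mono fun x hx => contDiffAt_deformForm hh hp hw hx (hF _ (hs x hx)).ne')
    (hnear.mono fun x hx => deformForm_symm hh hx) (by
      rw [formMatrix_det_ne_zero_iff]
      intro u hu
      by_contra hu0
      have hx := hnear.self_of_nhds
      exact (deformForm_pos hh hp hx (hF _ (hs _ hx)) hu0).ne' (hu u))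
  refine h1.trans (coordScalar_congr ?_)
  have hsρ : ∀ s, w ^ 2 * (ρ * s) = s := fun s => by rw [← mul_assoc, mul_comm (w ^ 2), hρw, one_mul]
  have hdiv : ∀ s, 1 / (ρ * s) = w ^ 2 / s := fun s => by
    rw [eq_div_of_mul_eq hρ.ne' ((mul_comm _ _).trans hρw), div_div]
  have hc : Tendsto (fun z : Eucl (n + 1) => (z 0, euclTail n z)) (𝓝 z) (𝓝 (z 0, euclTail n z)) :=
    (euclSplit n).continuous.tendsto z
  filter_upwards [hc.eventually hH] with z' hz'
  have e1 : ρ ^ 2 * ((ρ * z' 0) ^ 2 * radialCoeff n c m w (w ^ 2 * (ρ * z' 0)))⁻¹ =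
      (z' 0 ^ 2 * radialCoeff n c m w (z' 0))⁻¹ := by
    rw [hsρ, mul_pow, mul_assoc, mul_inv, ← mul_assoc, mul_inv_cancel₀ (pow_ne_zero 2 hρ.ne'),
      one_mul]
  have e2 : formMatrix (A.pull (deformAngular h χ w (ρ * z' 0)) (euclTail n z')) =
      H (z' 0) (euclTail n z') := by
    rw [hz']
    ext i j
    simp only [formMatrix_apply, SphereFrame.pull_apply, deformAngular_apply, hsρ, hdiv,
      Matrix.add_apply, Matrix.smul_apply, Matrix.sub_apply, smul_eq_mul,
      SphereFrame.roundForm_apply]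
    ring
  simp only [blockMetric, e1, e2]

end

/-! ### The curvature bound for the deformed metric -/

section
variable {n : ℕ} {R c l : ℝ} {h : ℝ → Eucl (n + 1) → BilForm (n + 1)}
  {k : Eucl (n + 1) → BilForm (n + 1)} {χ m : ℝ → ℝ}

/-- The term `c - m / s^(n+1)` is `0` for `s ≤ 1` and `c > 0` for `s ≥ 9l`; in between it is bounded
by compactness, so its product with `w^(2n+2)` is eventually above `-1`. -/
theorem eventually_radialCoeff_pos (hp : IsRadialProfile n c l χ m) :
    ∀ᶠ w in 𝓝 (0 : ℝ), ∀ s > 0, 0 < radialCoeff n c m w s := by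
  have hcont : ContinuousOn (fun s => c - m s / s ^ (n + 1)) (Icc 1 (9 * l)) :=
    continuousOn_const.sub (hp.smooth_mass.continuous.continuousOn.div
      (continuous_pow _).continuousOn fun s hs => pow_ne_zero _ (by linarith [hs.1]))
  obtain ⟨B, hB⟩ := isCompact_Icc.exists_bound_of_continuousOn hcont
  have h0 : Tendsto (fun w : ℝ => w ^ (2 * n + 2) * B) (𝓝 0) (𝓝 0) :=
    Continuous.tendsto' (by fun_prop) _ _ (by simp)
  filter_upwards [h0.eventually (gt_mem_nhds one_pos)] with w hw s hs
  have hε : 0 ≤ w ^ (2 * n + 2) := Even.pow_nonneg ⟨n + 1, by ring⟩ _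
  have h4 : 0 ≤ w ^ 4 / s ^ 2 := div_nonneg (Even.pow_nonneg ⟨2, rfl⟩ _) (sq_nonneg s)
  rw [radialCoeff]
  rcases le_total s 1 with h1 | h1
  · rw [hp.mass_inner s h1, mul_div_cancel_right₀ _ (pow_ne_zero _ hs.ne'), sub_self]
    linarith
  · rcases le_total s (9 * l) with h2 | h2
    · have h3 := hB s ⟨h1, h2⟩
      rw [Real.norm_eq_abs] at h3
      have h5 := mul_le_mul_of_nonneg_left (abs_le.1 h3).1 hε
      have hw' : w ^ (2 * n + 2) * B < 1 := hw
      linarith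
    · rw [hp.mass_outer s h2, zero_div, sub_zero]
      have := mul_nonneg hε hp.c_pos.le
      linarith

theorem SphereFrame.exists_polarMap_eq (A : SphereFrame n) {ρ s : ℝ} (y : Eucl n) :
    ∃ z : Eucl (n + 1), z 0 = s ∧ euclTail n z = y ∧ A.polarMap ρ z = (ρ * s) • A.om y :=
  ⟨WithLp.toLp 2 (Fin.cons s y.ofLp), rfl, by ext i; rfl, rfl⟩

/-- Here `χ = 0`, the slices are round and the radial formula is exact: the defect equals `w^(2n+2)
n m' / s^n`, which is nonnegative. No smallness of `w` beyond positivity of `F` enters, so the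
noncompact range of `s` does no harm. -/
theorem coordScalar_deformForm_outer (hh : IsAHFamily R h k) (hp : IsRadialProfile n c l χ m)
    {w : ℝ} (hw : 0 < w) (hF : ∀ s > 0, 0 < radialCoeff n c m w s) {x : Eucl (n + 1)}
    (hx : 4 * l < w ^ 2 * ‖x‖) (hxR : R < ‖x‖) :
    -(n * (n + 1)) * (1 + c * w ^ (2 * n + 2)) ≤
      coordScalar (fun x => formMatrix (deformForm h c χ m w x)) x := by
  have hx0 : x ≠ 0 := norm_pos_iff.1 (hh.R_pos.trans hxR)
  obtain ⟨A, hA⟩ := SphereFrame.exists_center (norm_polarTheta hx0)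
  set ρ := (w ^ 2)⁻¹ with hρd
  have hw2 : 0 < w ^ 2 := pow_pos hw 2
  have hρ : 0 < ρ := inv_pos.2 hw2
  have hρw : ρ * w ^ 2 = 1 := inv_mul_cancel₀ hw2.ne'
  have hρs : ρ * (w ^ 2 * ‖x‖) = ‖x‖ := by rw [← mul_assoc, hρw, one_mul]
  obtain ⟨z, hz0, hzt, hzx⟩ := A.exists_polarMap_eq (ρ := ρ) (s := w ^ 2 * ‖x‖) 0
  rw [A.om_zero, hA, hρs, norm_smul_polarTheta hx0] at hzx
  rw [← hz0] at hx hρs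
  have hl := hp.one_le
  have hz : 0 < z 0 := by linarith
  have hnear : ∀ᶠ p : ℝ × Eucl n in 𝓝 (z 0, euclTail n z), 4 * l < p.1 :=
    continuousAt_fst.eventually (lt_mem_nhds hx)
  rw [← hzx, coordScalar_deformForm hh hp A hw hρ hρw hz (by rwa [hρs]) hF
    (H := fun _ y => formMatrix (A.roundForm y)) (hnear.mono fun p hpl => by
      rw [hp.cutoff_outer _ (le_of_lt hpl), zero_smul, add_zero])]
  rw [coordScalar_radial hρ hz (hnear.mono fun p hpl => by
    have hp0 : 0 < p.1 := by linarith
    exact SphereFrame.blockRegular_roundForm (ContDiffAt.comp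
      (g := fun q : ℝ × ℝ => radialCoeff n c m q.2 q.1) (f := fun s => (s, w)) p.1
      (contDiffAt_radialCoeff hp.smooth_mass hp0.ne') (contDiffAt_id.prodMk contDiffAt_const))
      (hF _ hp0).ne' _)]
  simp only [SphereFrame.logDerivMat_const, Matrix.trace_zero, SphereFrame.coordScalar_roundForm,
    Matrix.mul_zero]
  rw [(hasDerivAt_radialCoeff c hp.smooth_mass w hz.ne').deriv]
  have hm := hp.deriv_mass_nonneg (z 0) hx.le
  have hw' : ((ρ * z 0) ^ 2)⁻¹ = w ^ 4 / z 0 ^ 2 := by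
    rw [hρd]; field_simp
  rw [hw']
  have key : 0 ≤ w ^ (2 * n + 2) * (n * (deriv m (z 0) / z 0 ^ n)) := by positivity
  rw [← sub_nonneg]
  refine key.trans_eq ?_
  simp only [radialCoeff, deriv_const]
  generalize z 0 = s at *
  generalize w ^ (2 * n + 2) = ε at *
  rw [pow_succ s (n + 1), pow_succ s n]
  have hs : s ≠ 0 := hz.ne'
  have hsn : s ^ n ≠ 0 := pow_ne_zero _ hs
  field_simp
  ring

/-- The derivatives of `s ↦ χ(s) μ / s^{n+1}`. -/
theorem second_order_cutoff_identity (hχ : ContDiff ℝ ∞ χ) (μ : ℝ) {s₀ : ℝ} (hs₀ : 0 < s₀)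
    {f : ℝ → ℝ} (hf : ∀ᶠ s in 𝓝 s₀, f s = χ s * (μ / s ^ (n + 1))) :
    s₀ ^ 2 * deriv (deriv f) s₀ + (n + 2) * s₀ * deriv f s₀ =
      μ * (s₀ * deriv (deriv χ) s₀ - n * deriv χ s₀) / s₀ ^ n := by
  have hd : ∀ s, HasDerivAt χ (deriv χ s) s := fun s => (hχ.differentiable (by simp) s).hasDerivAt
  have hd2 : ∀ s, HasDerivAt (deriv χ) (deriv (deriv χ) s) s := fun s =>
    (((contDiff_infty_iff_deriv.1 hχ).2).differentiable (by simp) s).hasDerivAt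
  have hpow : ∀ (N : ℕ) {s : ℝ}, s ≠ 0 → HasDerivAt (fun s : ℝ => μ / s ^ N)
      (-(N * μ) / s ^ (N + 1)) s := by
    intro N s hs
    refine ((hasDerivAt_const s μ).div (hasDerivAt_pow N s) (pow_ne_zero N hs)).congr_deriv ?_
    rcases N with _ | N
    · simp
    · have : s ^ N ≠ 0 := pow_ne_zero _ hs
      simp only [Nat.add_sub_cancel, pow_succ]
      field_simp
      ring
  have h1 : ∀ᶠ s in 𝓝 s₀, deriv f s =
      deriv χ s * (μ / s ^ (n + 1)) + χ s * (-((n + 1 : ℕ) * μ) / s ^ (n + 2)) := by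
    filter_upwards [hf.eventually_nhds, lt_mem_nhds hs₀] with s hs hs0
    rw [EventuallyEq.deriv_eq hs]
    exact ((hd s).mul (hpow (n + 1) (ne_of_gt hs0))).deriv
  have hpow2 : HasDerivAt (fun s : ℝ => -((n + 1 : ℕ) * μ) / s ^ (n + 2))
      ((n + 1 : ℕ) * ((n + 2 : ℕ) * μ) / s₀ ^ (n + 3)) s₀ := by
    refine ((hpow (n + 2) hs₀.ne').const_mul (-((n + 1 : ℕ) : ℝ))).congr_deriv ?_ |>.congr_of_eventuallyEq ?_
    · ring
    · exact Eventually.of_forall fun s => by simp only []; ring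
  have h2 : deriv (deriv f) s₀ = deriv (deriv χ) s₀ * (μ / s₀ ^ (n + 1))
      + deriv χ s₀ * (-((n + 1 : ℕ) * μ) / s₀ ^ (n + 2))
      + (deriv χ s₀ * (-((n + 1 : ℕ) * μ) / s₀ ^ (n + 2))
        + χ s₀ * ((n + 1 : ℕ) * ((n + 2 : ℕ) * μ) / s₀ ^ (n + 3))) := by
    rw [EventuallyEq.deriv_eq h1]
    exact (((hd2 s₀).mul (hpow (n + 1) hs₀.ne')).add ((hd s₀).mul hpow2)).deriv
  -- The terms with `χ` itself cancel, because `s^(-(n+1))` solves `s² f'' + (n + 2) s f' = 0`: the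
  -- undeformed perturbation contributes nothing at first order.
  rw [h2, h1.self_of_nhds]
  have hs : s₀ ≠ 0 := hs₀.ne'
  have hsn : s₀ ^ n ≠ 0 := pow_ne_zero _ hs
  rw [pow_succ s₀ (n + 2), pow_succ s₀ (n + 1), pow_succ s₀ n]
  push_cast
  field_simp
  ring

/-- The angular part is `h₀ + w^(2n+2) χ κ`, and `tr κ = μ / s^(n+1)` at `w = 0`, so positivity of
the first-order coefficient is the profile inequality at `s₀` divided by `s₀^n`. -/
theorem eventually_coordScalar_deformForm_ge_local (hh : IsAHFamily R h k)
    (hp : IsRadialProfile n c l χ m) (A : SphereFrame n) {s₀ : ℝ} (hs₀ : 0 < s₀)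
    (hpos : -sphereTrace A.center (k A.center) * (n * deriv χ s₀ - s₀ * deriv (deriv χ) s₀)
      < n * deriv m s₀) :
    ∀ᶠ q : ℝ × ℝ × Eucl n in 𝓝 (s₀, 0, 0), 0 < q.2.1 → R * q.2.1 ^ 2 < q.1 →
      -(n * (n + 1)) * (1 + c * q.2.1 ^ (2 * n + 2)) ≤
        coordScalar (fun x => formMatrix (deformForm h c χ m q.2.1 x))
          ((q.1 / q.2.1 ^ 2) • A.om q.2.2) := by
  obtain ⟨κ, hκ, hκs, hκe, hκt⟩ := exists_perturbation_expansion hh.smooth hh.R_pos hh.expansion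
    hh.symm A hs₀
  set μ := sphereTrace A.center (k A.center)
  let X : ℝ × ℝ × Eucl n → Matrix (Fin n) (Fin n) ℝ := fun q => χ q.1 • κ q
  have hX : ∀ i j, ContDiff ℝ ∞ fun q => X q i j := fun i j =>
    (hp.smooth_cutoff.comp contDiff_fst).mul (hκ i j)
  have htr : ∀ s, (derivFst X (s, 0, 0)).trace = deriv (fun s => (X (s, 0, 0)).trace) s := by
    intro s
    simp only [Matrix.trace, Matrix.diag, derivFst, Matrix.of_apply]
    rw [deriv_fun_sum]
    intro i _
    exact ((hX i i).comp (f := fun s : ℝ => ((s, 0, 0) : ℝ × ℝ × Eucl n))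
      (contDiff_id.prodMk contDiff_const)).differentiable (by simp) s
  have hf : ∀ᶠ s in 𝓝 s₀, (X (s, 0, 0)).trace = χ s * (μ / s ^ (n + 1)) := by
    filter_upwards [hκt] with s hs
    simp only [X, Matrix.trace_smul, smul_eq_mul, hs]
  have hid := second_order_cutoff_identity hp.smooth_cutoff μ hs₀ hf
  have hsn : 0 < s₀ ^ n := pow_pos hs₀ n
  have hmain := eventually_coordScalar_perturbed_ge c hp.smooth_mass
    (h₀ := fun y => formMatrix (A.roundForm y)) (X := X) SphereFrame.contDiff_roundForm
    SphereFrame.isSymm_roundForm hX (fun q => (hκs q).smul _) SphereFrame.formMatrix_roundForm_zero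
    SphereFrame.coordScalar_roundForm hs₀ (by
      simp only [htr]
      rw [hid, ← mul_div_assoc, ← sub_div]
      exact div_pos (by linarith) hsn)
  have hF : ∀ᶠ q : ℝ × ℝ × Eucl n in 𝓝 (s₀, 0, 0), ∀ s > 0, 0 < radialCoeff n c m q.2.1 s :=
    (Continuous.tendsto' (f := fun q : ℝ × ℝ × Eucl n => q.2.1) (by fun_prop) (s₀, 0, 0) 0
      rfl).eventually (eventually_radialCoeff_pos hp)
  filter_upwards [hmain, hF, hκe.eventually_nhds,
    continuousAt_fst.eventually (lt_mem_nhds hs₀)] with q h1 h2 h3 h4 hw hR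
  obtain ⟨s, w, y⟩ := q
  simp only at h1 h2 h3 h4 hw hR ⊢
  have hw2 : 0 < w ^ 2 := pow_pos hw 2
  have hρ : 0 < (w ^ 2)⁻¹ := inv_pos.2 hw2
  have hρw : (w ^ 2)⁻¹ * w ^ 2 = 1 := inv_mul_cancel₀ hw2.ne'
  obtain ⟨z, hz0, hzt, hzx⟩ := A.exists_polarMap_eq (ρ := (w ^ 2)⁻¹) (s := s) y
  have h5 := h1 _ z hρ hρw hz0 hzt
  rw [div_eq_inv_mul, ← hzx]
  refine h5.trans_eq (coordScalar_deformForm hh hp A hw hρ hρw (by rwa [hz0]) ?_ h2 ?_).symm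
  · rw [hz0, ← div_eq_inv_mul, lt_div_iff₀ hw2]; exact hR
  · rw [hz0, hzt]
    filter_upwards [(Continuous.tendsto' (f := fun p : ℝ × Eucl n => (p.1, w, p.2)) (by fun_prop)
      (s, y) _ rfl).eventually h3] with p hp'
    rw [hp', add_sub_cancel_left, smul_comm]
    rfl

/-- For small `w` the scalar curvature of the deformed metric is at least `-n(n+1) / a` outside the
ball of radius `w⁻²`. -/
theorem eventually_coordScalar_deformForm_ge (hh : IsAHFamily R h k)
    (hp : IsRadialProfile n c l χ m)
    (hpos : ∀ s ∈ Icc 1 (4 * l), ∀ θ : Eucl (n + 1), ‖θ‖ = 1 →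
      -sphereTrace θ (k θ) * (n * deriv χ s - s * deriv (deriv χ) s) < n * deriv m s) :
    ∀ᶠ w in 𝓝[>] (0 : ℝ), ∀ x : Eucl (n + 1), 1 ≤ w ^ 2 * ‖x‖ →
      -(n * (n + 1)) * (1 + c * w ^ (2 * n + 2)) ≤
        coordScalar (fun x => formMatrix (deformForm h c χ m w x)) x := by
  -- The local estimate holds near each `(0, s₀, θ₀)`; compactness yields one bound on `w` for all
  -- `s ∈ [1, 4l]` and all directions. Larger `s` is left to the exact formula.
  have hK : IsCompact (Icc 1 (4 * l) ×ˢ Metric.sphere (0 : Eucl (n + 1)) 1) :=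
    isCompact_Icc.prod (isCompact_sphere _ _)
  have h1 : ∀ᶠ w in 𝓝 (0 : ℝ), ∀ p ∈ Icc 1 (4 * l) ×ˢ Metric.sphere (0 : Eucl (n + 1)) 1,
      ‖p.2‖ = 1 → 0 < w → R * w ^ 2 < p.1 →
      -(n * (n + 1)) * (1 + c * w ^ (2 * n + 2)) ≤
        coordScalar (fun x => formMatrix (deformForm h c χ m w x)) ((p.1 / w ^ 2) • p.2) := by
    refine hK.eventually_forall_of_forall_eventually fun p hpm => ?_
    obtain ⟨s₀, θ₀⟩ := p
    have hθ₀ : ‖θ₀‖ = 1 := by simpa using hpm.2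
    have hs₀ : s₀ ∈ Icc 1 (4 * l) := hpm.1
    obtain ⟨A, hA⟩ := SphereFrame.exists_center hθ₀
    have hloc := eventually_coordScalar_deformForm_ge_local hh hp A (s₀ := s₀)
      (by linarith [hs₀.1]) (by rw [hA]; exact hpos s₀ hs₀ θ₀ hθ₀)
    have hom : ContinuousAt (fun q : ℝ × ℝ × Eucl (n + 1) => A.omInv q.2.2) (0, s₀, θ₀) := by
      refine ContinuousAt.comp (g := A.omInv) (f := fun q : ℝ × ℝ × Eucl (n + 1) => q.2.2) ?_
        (by fun_prop)
      rw [← hA]; exact A.continuousAt_omInv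
    have ht : Tendsto (fun q : ℝ × ℝ × Eucl (n + 1) => (q.2.1, q.1, A.omInv q.2.2))
        (𝓝 (0, s₀, θ₀)) (𝓝 (s₀, 0, 0)) := by
      have h0 : A.omInv θ₀ = 0 := by rw [← hA]; exact A.omInv_center
      have h2 : ContinuousAt (fun q : ℝ × ℝ × Eucl (n + 1) => (q.2.1, q.1, A.omInv q.2.2))
          (0, s₀, θ₀) := (by fun_prop : ContinuousAt (fun q : ℝ × ℝ × Eucl (n + 1) => q.2.1) _).prodMk
        (continuousAt_fst.prodMk hom)
      rw [ContinuousAt, h0] at h2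
      exact h2
    have hin : ∀ᶠ q : ℝ × ℝ × Eucl (n + 1) in 𝓝 (0, s₀, θ₀), 0 < inner ℝ A.center q.2.2 := by
      have : ContinuousAt (fun q : ℝ × ℝ × Eucl (n + 1) => inner ℝ A.center q.2.2) (0, s₀, θ₀) := by
        fun_prop
      refine this.eventually (lt_mem_nhds ?_)
      change 0 < inner ℝ A.center θ₀
      rw [hA, real_inner_self_eq_norm_sq, hθ₀]; norm_num
    filter_upwards [ht.eventually hloc, hin] with q hq1 hq2 hq3 hq4 hq5
    have := hq1 hq4 hq5
    rwa [A.om_omInv hq3 hq2] at this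
  have hR : ∀ᶠ w in 𝓝 (0 : ℝ), R * w ^ 2 < 1 :=
    (Continuous.tendsto' (f := fun w : ℝ => R * w ^ 2) (by fun_prop) 0 0 (by simp)).eventually
      (gt_mem_nhds one_pos)
  filter_upwards [nhdsWithin_le_nhds h1, nhdsWithin_le_nhds hR,
    nhdsWithin_le_nhds (eventually_radialCoeff_pos hp), self_mem_nhdsWithin] with w hw1 hw2 hw3 hw4
    x hx
  have hw0 : 0 < w := hw4
  have hw20 : 0 < w ^ 2 := pow_pos hw0 2
  have hx0 : x ≠ 0 := by rintro rfl; simp at hx; linarith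
  rcases le_or_gt (w ^ 2 * ‖x‖) (4 * l) with hx4 | hx4
  · have := hw1 (w ^ 2 * ‖x‖, polarTheta x) ⟨⟨hx, hx4⟩, by simpa using norm_polarTheta hx0⟩
      (norm_polarTheta hx0) hw0 (hw2.trans_le hx)
    rwa [mul_div_cancel_left₀ _ hw20.ne', norm_smul_polarTheta hx0] at this
  · refine coordScalar_deformForm_outer hh hp hw0 hw3 hx4 ?_
    have h3 : R * w ^ 2 < w ^ 2 * ‖x‖ := hw2.trans_le hx
    rw [mul_comm] at h3
    exact lt_of_mul_lt_mul_left h3 hw20.le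

end

/-! ### The deformed metric near the inner boundary and near infinity -/

section
variable {n : ℕ} {c l : ℝ} {h : ℝ → Eucl (n + 1) → BilForm (n + 1)} {χ m : ℝ → ℝ}

theorem fderiv_polarT_apply {x : Eucl (n + 1)} (hx : x ≠ 0) (u : Eucl (n + 1)) :
    fderiv ℝ polarT x u = (√(1 + (1 / ‖x‖) ^ 2))⁻¹ * (-(‖x‖ ^ 2)⁻¹ *
      fderiv ℝ (fun y : Eucl (n + 1) => ‖y‖) x u) := by
  have h1 := ((contDiffAt_norm ℝ hx (n := ∞)).differentiableAt (by simp)).hasFDerivAt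
  have h2 := (hasDerivAt_inv (norm_ne_zero_iff.2 hx)).comp_hasFDerivAt x h1
  have h3 := (Real.hasDerivAt_arsinh (‖x‖⁻¹)).comp_hasFDerivAt x h2
  have h4 : (polarT : Eucl (n + 1) → ℝ) = Real.arsinh ∘ Inv.inv ∘ fun y : Eucl (n + 1) => ‖y‖ := by
    ext y; simp [polarT]
  rw [h4, h3.fderiv]
  simp [smul_apply]

theorem sinh_polarT (x : Eucl (n + 1)) : Real.sinh (polarT x) = 1 / ‖x‖ := Real.sinh_arsinh _

/-- The deformed metric agrees with the given one inside the ball of radius `w⁻²`. -/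
theorem deformForm_eq_ahForm (hp : IsRadialProfile n c l χ m) {w : ℝ} (hw : 0 < w)
    {x : Eucl (n + 1)} (hx : x ≠ 0) (hx1 : w ^ 2 * ‖x‖ ≤ 1) (u v : Eucl (n + 1)) :
    deformForm h c χ m w x u v = ahForm h x u v := by
  have hn : 0 < ‖x‖ := norm_pos_iff.2 hx
  have hs : 0 < w ^ 2 * ‖x‖ := by positivity
  rw [deformForm, polarForm_apply, ahForm, deformAngular_apply, hp.cutoff_inner _ hx1, radialCoeff,
    hp.mass_inner _ hx1, mul_div_cancel_right₀ _ (pow_ne_zero _ hs.ne'), sinh_polarT,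
    fderiv_polarT_apply hx, fderiv_polarT_apply hx]
  have hq : √(1 + (1 / ‖x‖) ^ 2) ^ 2 = 1 + (1 / ‖x‖) ^ 2 := Real.sq_sqrt (by positivity)
  have hq0 : √(1 + (1 / ‖x‖) ^ 2) ≠ 0 := (Real.sqrt_pos.2 (by positivity)).ne'
  rw [polarT]
  generalize √(1 + (1 / ‖x‖) ^ 2) = q at *
  generalize fderiv ℝ (fun y : Eucl (n + 1) => ‖y‖) x u = du
  generalize fderiv ℝ (fun y : Eucl (n + 1) => ‖y‖) x v = dv
  -- For `s ≤ 1` the mass term cancels `c`, so `r² F = 1 + r²`, which is the radial part of `dt² /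
  -- sinh² t` for `sinh t = 1 / r`.
  have e1 : (‖x‖ ^ 2 * (1 + w ^ 4 / (w ^ 2 * ‖x‖) ^ 2 + w ^ (2 * n + 2) * (c - c)))⁻¹ =
      (‖x‖ ^ 2 * q ^ 2)⁻¹ := by
    rw [hq]
    congr 2
    field_simp
    ring
  rw [e1]
  field_simp
  ring

/-- The deformed metric is `g_a` outside a large ball. -/
theorem deformForm_eq_gaForm (hp : IsRadialProfile n c l χ m) {w : ℝ} (hw : 0 < w)
    {x : Eucl (n + 1)} (hx : x ≠ 0) (hx9 : 9 * l ≤ w ^ 2 * ‖x‖) (u v : Eucl (n + 1)) :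
    deformForm h c χ m w x u v = gaForm (1 / (1 + c * w ^ (2 * n + 2))) x u v := by
  have hn : 0 < ‖x‖ := norm_pos_iff.2 hx
  have hl := hp.one_le
  have hε : 0 < w ^ (2 * n + 2) := pow_pos hw _
  have hc := hp.c_pos
  rw [deformForm, polarForm_apply, gaForm, deformAngular_apply, hp.cutoff_outer _ (by linarith),
    radialCoeff, hp.mass_outer _ hx9, sub_zero, one_mul, zero_mul, add_zero, zero_div, sub_zero]
  congr 3
  field_simp
  ring

end

/-! ### Properties of the end: symmetry and positivity of `h`, bounds for the mass aspect -/

section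
variable {n : ℕ} {M : Type*} [TopologicalSpace M] [ChartedSpace (Eucl (n + 1)) M]
  [IsManifold (𝓡 (n + 1)) ∞ M] {g : SmoothMetric (n + 1) M}

namespace AHEnd

theorem metricInChart_symm (g : SmoothMetric (n + 1) M)
    (φ : OpenPartialHomeomorph M (Eucl (n + 1))) (x u v : Eucl (n + 1)) :
    metricInChart g φ x u v = metricInChart g φ x v u := g.symm _ _ _

theorem metricInChart_pos (g : SmoothMetric (n + 1) M) {φ : OpenPartialHomeomorph M (Eucl (n + 1))}
    (hφ : φ ∈ IsManifold.maximalAtlas (𝓡 (n + 1)) ∞ M) {x : Eucl (n + 1)} (hx : x ∈ φ.target)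
    {u : Eucl (n + 1)} (hu : u ≠ 0) : 0 < metricInChart g φ x u u := by
  refine g.pos _ _ fun h0 => hu ?_
  have h1 := chartDeriv_chartSymmDeriv hφ hx u
  rw [← h1]
  refine (congrArg _ (show chartSymmDeriv φ x u = 0 from h0)).trans (map_zero _)

/-- On tangent vectors of the sphere the family `h` is given by the metric `g`. -/
theorem h_eq_metricInChart (e : AHEnd g) {t : ℝ} (ht : t ∈ Ioo 0 (Real.arsinh (1 / e.R)))
    {θ u v : Eucl (n + 1)} (hθ : ‖θ‖ = 1) (hu : inner ℝ θ u = 0) (hv : inner ℝ θ v = 0) :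
    e.R < ‖(Real.sinh t)⁻¹ • θ‖ ∧
      e.h t θ u v = metricInChart g e.φ ((Real.sinh t)⁻¹ • θ) u v := by
  have hs : 0 < Real.sinh t := Real.sinh_pos_iff.2 ht.1
  have hr : ‖(Real.sinh t)⁻¹ • θ‖ = (Real.sinh t)⁻¹ := by
    rw [norm_smul, hθ, mul_one, Real.norm_of_nonneg (inv_pos.2 hs).le]
  have hs2 : Real.sinh t < 1 / e.R := by
    have := Real.sinh_lt_sinh.2 ht.2
    rwa [Real.sinh_arsinh] at this
  have hR : e.R < ‖(Real.sinh t)⁻¹ • θ‖ := by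
    rw [hr, lt_inv_comm₀ e.R_pos hs, ← one_div]
    exact hs2
  refine ⟨hR, ?_⟩
  have hx0 : (Real.sinh t)⁻¹ • θ ≠ 0 := norm_pos_iff.1 (e.R_pos.trans hR)
  have hT : polarTheta ((Real.sinh t)⁻¹ • θ) = θ := by
    rw [polarTheta_smul (inv_pos.2 hs), polarTheta_of_norm_eq_one hθ]
  have ht' : polarT ((Real.sinh t)⁻¹ • θ) = t := by
    rw [polarT, hr, one_div, inv_inv, Real.arsinh_sinh]
  have hd : ∀ u, inner ℝ θ u = 0 → fderiv ℝ polarTheta ((Real.sinh t)⁻¹ • θ) u = Real.sinh t • u := by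
    intro u hu
    rw [fderiv_polarTheta_apply hx0, hT, hr, inv_inv, tangProj, hu, zero_smul, sub_zero]
  rw [e.metric_eq _ hR, ahForm, ht', hT, hd u hu, hd v hv, fderiv_polarT_apply hx0,
    fderiv_norm_apply hx0, hT, hu, map_smul, map_smul, smul_apply]
  simp only [smul_eq_mul]
  field_simp
  ring

/-- Symmetry and positivity of `h` are not data of the end; for `t > 0` they are read off from `g`
at the point `θ / sinh t`. -/
theorem isAHFamily (e : AHEnd g) : IsAHFamily e.R e.h e.k where
  R_pos := e.R_pos
  smooth := e.h_smooth
  expansion := e.h_expansion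
  symm t ht θ hθ u v hu hv := by
    rw [(e.h_eq_metricInChart ht hθ hu hv).2, (e.h_eq_metricInChart ht hθ hv hu).2,
      metricInChart_symm]
  pos t ht θ hθ u hu hu0 := by
    obtain ⟨h1, h2⟩ := e.h_eq_metricInChart ht hθ hu hu
    rw [h2]
    exact metricInChart_pos g e.φ_smooth (by rw [e.φ_target]; exact h1) hu0

end AHEnd

end

section
variable {n : ℕ} {R : ℝ} {h : ℝ → Eucl (n + 1) → BilForm (n + 1)}
  {k : Eucl (n + 1) → BilForm (n + 1)}

theorem inner_tangProj {m : ℕ} {θ : Eucl m} (hθ : ‖θ‖ = 1) (v : Eucl m) :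
    inner ℝ θ (tangProj θ v) = 0 := by
  rw [tangProj, inner_sub_right, inner_smul_right, real_inner_self_eq_norm_sq, hθ]
  ring

theorem norm_tangProj_le {m : ℕ} {θ : Eucl m} (hθ : ‖θ‖ = 1) (v : Eucl m) :
    ‖tangProj θ v‖ ≤ 2 * ‖v‖ := by
  have h1 : ‖inner ℝ θ v • θ‖ ≤ ‖v‖ := by
    rw [norm_smul, hθ, mul_one]
    simpa [hθ] using norm_inner_le_norm (𝕜 := ℝ) θ v
  calc ‖tangProj θ v‖ ≤ ‖v‖ + ‖inner ℝ θ v • θ‖ := norm_sub_le _ _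
    _ ≤ 2 * ‖v‖ := by linarith

/-- The mass aspect function is continuous, as a uniform limit of continuous functions. -/
theorem IsAHFamily.continuous_sphereTrace (hh : IsAHFamily R h k) :
    Continuous fun θ : Metric.sphere (0 : Eucl (n + 1)) 1 => sphereTrace θ.1 (k θ.1) := by
  have hT : 0 < Real.arsinh (1 / R) := Real.arsinh_pos_iff.2 (one_div_pos.2 hh.R_pos)
  let f : ℝ → Metric.sphere (0 : Eucl (n + 1)) 1 → ℝ := fun t θ =>
    ∑ i, (h t θ.1 (tangProj θ.1 (EuclideanSpace.single i 1))
      (tangProj θ.1 (EuclideanSpace.single i 1))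
      - inner ℝ (tangProj θ.1 (EuclideanSpace.single i (1 : ℝ)))
        (tangProj θ.1 (EuclideanSpace.single i (1 : ℝ)))) / t ^ (n + 1)
  have hnorm : ∀ θ : Metric.sphere (0 : Eucl (n + 1)) 1, ‖θ.1‖ = 1 := fun θ => by simp
  have hf : ∀ t ∈ Ioo 0 (Real.arsinh (1 / R)), Continuous (f t) := by
    intro t ht
    have h1 : Continuous fun θ : Metric.sphere (0 : Eucl (n + 1)) 1 => h t θ.1 := by
      have h2 : Continuous fun θ : Metric.sphere (0 : Eucl (n + 1)) 1 => h t (polarTheta θ.1) :=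
        hh.smooth.continuousOn.comp_continuous (f := fun θ : Metric.sphere (0 : Eucl (n + 1)) 1 =>
          (t, θ.1)) (by fun_prop) fun θ => ⟨⟨ht.1.le, ht.2⟩, by
            have := hnorm θ
            intro h0
            rw [show θ.1 = 0 from h0, norm_zero] at this
            exact zero_ne_one this⟩
      refine h2.congr fun θ => ?_
      rw [polarTheta_of_norm_eq_one (hnorm θ)]
    have h3 : ∀ i, Continuous fun θ : Metric.sphere (0 : Eucl (n + 1)) 1 =>
        tangProj θ.1 (EuclideanSpace.single i 1) := by
      intro i
      unfold tangProj
      fun_prop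
    exact continuous_finsetSum _ fun i _ =>
      (((h1.clm_apply (h3 i)).clm_apply (h3 i)).sub ((h3 i).inner (h3 i))).div_const _
  have hu : TendstoUniformly f (fun θ => sphereTrace θ.1 (k θ.1)) (𝓝[>] 0) := by
    obtain ⟨C, hC⟩ := hh.expansion
    rw [Metric.tendstoUniformly_iff]
    intro ε hε
    have h0 : Tendsto (fun t : ℝ => ∑ _i : Fin (n + 1), |C| * t * 4) (𝓝[>] 0) (𝓝 0) :=
      ((Continuous.tendsto' (f := fun t : ℝ => ∑ _i : Fin (n + 1), |C| * t * 4) (by fun_prop) 0 0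
        (by simp))).mono_left nhdsWithin_le_nhds
    filter_upwards [hC, self_mem_nhdsWithin, h0.eventually (gt_mem_nhds hε)] with t ht ht0 htε θ
    have ht0' : 0 < t := ht0
    rw [dist_comm, Real.dist_eq, sphereTrace, ← Finset.sum_sub_distrib]
    refine lt_of_le_of_lt ((Finset.abs_sum_le_sum_abs _ _).trans (Finset.sum_le_sum fun i _ => ?_)) htε
    set v := tangProj θ.1 (EuclideanSpace.single i (1 : ℝ)) with hv
    have h1 := ht θ.1 (hnorm θ) v v (inner_tangProj (hnorm θ) _) (inner_tangProj (hnorm θ) _)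
    have h2 : ‖v‖ ≤ 2 := by simpa using norm_tangProj_le (hnorm θ) (EuclideanSpace.single i (1 : ℝ))
    have hp : 0 < t ^ (n + 1) := pow_pos ht0' _
    rw [show (h t θ.1 v v - inner ℝ v v) / t ^ (n + 1) - k θ.1 v v =
      (h t θ.1 v v - (inner ℝ v v + t ^ (n + 1) * k θ.1 v v)) / t ^ (n + 1) by field_simp; ring,
      abs_div, abs_of_pos hp, div_le_iff₀ hp]
    refine h1.trans ?_
    have h3 : ‖v‖ * ‖v‖ ≤ 4 := by nlinarith [norm_nonneg v]
    calc C * t ^ (n + 2) * (‖v‖ * ‖v‖) ≤ |C| * t ^ (n + 2) * 4 := by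
          have := le_abs_self C
          gcongr
      _ = |C| * t * 4 * t ^ (n + 1) := by ring
  refine hu.continuous (Eventually.frequently ?_)
  filter_upwards [Ioo_mem_nhdsGT hT] with t ht using hf t ht

end

namespace AHEnd

variable {n : ℕ} {M : Type*} [TopologicalSpace M] [ChartedSpace (Eucl (n + 1)) M]
  [IsManifold (𝓡 (n + 1)) ∞ M] {g : SmoothMetric (n + 1) M}

/-- For `n = 0` the tangent spaces of the sphere are trivial and the trace is `0`, hence not
negative. -/
theorem one_le_of_massAspect_neg (e : AHEnd g) (hμ : ∀ θ, e.massAspect θ < 0) : 1 ≤ n := by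
  by_contra hn
  obtain rfl : n = 0 := by omega
  have hθ : ‖(EuclideanSpace.single 0 1 : Eucl (0 + 1))‖ = 1 := by simp
  obtain ⟨A, hA⟩ := SphereFrame.exists_center hθ
  have h := hμ ⟨A.center, by simpa using A.norm_center⟩
  rw [massAspect, A.sphereTrace_center] at h
  simp at h

/-- The mass aspect function is pinched: `min |μ| ≤ |μ| ≤ λ^{n+1} min |μ|`. -/
theorem exists_massAspect_bounds (e : AHEnd g) (hμ : ∀ θ, e.massAspect θ < 0) :
    ∃ a b : ℝ, 0 < a ∧ a ≤ b ∧ 1 ≤ e.lam ∧ b ≤ e.lam ^ (n + 1) * a ∧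
      ∀ θ, -e.massAspect θ ∈ Icc a b := by
  have hne : Nonempty (Metric.sphere (0 : Eucl (n + 1)) 1) :=
    ⟨⟨EuclideanSpace.single 0 1, by simp⟩⟩
  have hc : Continuous fun θ => |e.massAspect θ| := e.isAHFamily.continuous_sphereTrace.abs
  have hbb : BddBelow (range fun θ => |e.massAspect θ|) := ⟨0, by rintro _ ⟨θ, rfl⟩; positivity⟩
  have hba : BddAbove (range fun θ => |e.massAspect θ|) := (isCompact_range hc).bddAbove
  -- Pointwise negativity gives a positive infimum of `|μ|` only because it is attained.
  obtain ⟨θ₀, -, hθ₀⟩ := isCompact_univ.exists_isMinOn univ_nonempty hc.continuousOn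
  set a := ⨅ θ, |e.massAspect θ| with ha
  set b := ⨆ θ, |e.massAspect θ| with hb
  have h1 : ∀ θ, a ≤ |e.massAspect θ| := fun θ => ciInf_le hbb θ
  have h2 : ∀ θ, |e.massAspect θ| ≤ b := fun θ => le_ciSup hba θ
  have h0 : 0 < a := lt_of_lt_of_le (abs_pos.2 (hμ θ₀).ne)
    (le_ciInf fun θ => hθ₀ (mem_univ θ))
  have hab : a ≤ b := (h1 θ₀).trans (h2 θ₀)
  have hdiv : 1 ≤ b / a := (one_le_div h0).2 hab
  have hlam : e.lam = (b / a) ^ (1 / ((n : ℝ) + 1)) := rfl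
  refine ⟨a, b, h0, hab, ?_, ?_, fun θ => ?_⟩
  · rw [hlam]
    exact Real.one_le_rpow hdiv (by positivity)
  · rw [hlam, ← Real.rpow_natCast, ← Real.rpow_mul (by positivity)]
    have : 1 / ((n : ℝ) + 1) * ((n + 1 : ℕ) : ℝ) = 1 := by push_cast; field_simp
    rw [this, Real.rpow_one, div_mul_cancel₀ _ h0.ne']
  · rw [← abs_of_neg (hμ θ)]
    exact ⟨h1 θ, h2 θ⟩

end AHEnd

/-! ### The deformation theorem -/

theorem mainTheorem4 {n : ℕ} {M : Type*} [TopologicalSpace M] [T2Space M]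
    [SecondCountableTopology M] [ChartedSpace (Eucl (n + 1)) M] [IsManifold (𝓡 (n + 1)) ∞ M]
    (g : SmoothMetric (n + 1) M) (e : AHEnd g)
    (hS : ∀ p : M, -((n : ℝ) * (n + 1)) ≤ scalarCurvature g p)
    (hμ : ∀ θ, e.massAspect θ < 0) :
    ∃ R₀ ≥ e.R, ∀ R₁ > R₀, ∃ a ∈ Ioo (0 : ℝ) 1, ∃ g' : SmoothMetric (n + 1) M,
      (∀ p : M, ¬ (p ∈ e.φ.source ∧ R₁ < ‖e.φ p‖) → g'.inner p = g.inner p) ∧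
      (∀ x : Eucl (n + 1), 9 * e.lam * R₁ ≤ ‖x‖ → ∀ u v : Eucl (n + 1),
        metricInChart g' e.φ x u v = gaForm a x u v) ∧
      (∀ p : M, -((n : ℝ) * (n + 1)) / a ≤ scalarCurvature g' p) := by
  have hn := e.one_le_of_massAspect_neg hμ
  obtain ⟨ν, ν', hν, hνν', hl, hlν, hνμ⟩ := e.exists_massAspect_bounds hμ
  obtain ⟨c, hc, χ, m, hχ, hm, h1, h2, h3, h4, h5, h6, h7, h8⟩ :=
    exists_radial_profile hn hν hνν' hl hlν
  have hp : IsRadialProfile n c e.lam χ m := ⟨hc, hl, hχ, hm, h1, h2, h3, h4, h5, h6, h7⟩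
  have hh := e.isAHFamily
  have hcurv := eventually_coordScalar_deformForm_ge hh hp fun s hs θ hθ =>
    h8 s hs _ (hνμ ⟨θ, by simpa using hθ⟩)
  obtain ⟨δ, hδ, hδw⟩ := mem_nhdsGT_iff_exists_Ioo_subset.1
    (hcurv.and (nhdsWithin_le_nhds (eventually_radialCoeff_pos hp)))
  have hδ0 : 0 < δ := hδ
  -- `δ` bounds the admissible scales `w`; with `w = R₁^(-1/2)`, the condition `w < δ` is `R₁ >
  -- δ⁻²`.
  refine ⟨max e.R (δ ^ 2)⁻¹, le_max_left _ _, fun R₁ hR₁ => ?_⟩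
  have hRR₁ : e.R < R₁ := (le_max_left _ _).trans_lt hR₁
  have hδR₁ : (δ ^ 2)⁻¹ < R₁ := (le_max_right _ _).trans_lt hR₁
  have hR₁0 : 0 < R₁ := e.R_pos.trans hRR₁
  set w := (√R₁)⁻¹ with hw
  have hw0 : 0 < w := inv_pos.2 (Real.sqrt_pos.2 hR₁0)
  have hw2 : w ^ 2 = R₁⁻¹ := by rw [hw, inv_pow, Real.sq_sqrt hR₁0.le]
  have hwδ : w < δ := by
    refine lt_of_pow_lt_pow_left₀ 2 hδ0.le ?_
    rw [hw2]
    exact (inv_lt_comm₀ (pow_pos hδ0 2) hR₁0).1 hδR₁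
  obtain ⟨hS', hF⟩ := hδw ⟨hw0, hwδ⟩
  set ε := w ^ (2 * n + 2) with hε
  have hε0 : 0 < ε := pow_pos hw0 _
  have hcε : 0 < c * ε := mul_pos hc hε0
  set a := 1 / (1 + c * ε) with ha
  have htgt : ∀ x, x ∈ e.φ.target ↔ e.R < ‖x‖ := fun x => by rw [e.φ_target]; rfl
  have hx0 : ∀ x, x ∈ e.φ.target → x ≠ 0 := fun x hx =>
    norm_pos_iff.1 (e.R_pos.trans ((htgt x).1 hx))
  have hsx : ∀ x, x ∈ e.φ.target → 0 < w ^ 2 * ‖x‖ := fun x hx =>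
    mul_pos (pow_pos hw0 2) (norm_pos_iff.2 (hx0 x hx))
  have hinner : ∀ p ∈ e.φ.source, ‖e.φ p‖ ≤ R₁ → ∀ u v,
      deformForm e.h c χ m w (e.φ p) u v = metricInChart g e.φ (e.φ p) u v := by
    intro p hps hpR u v
    have hx := e.φ.map_source hps
    rw [e.metric_eq _ ((htgt _).1 hx)]
    refine deformForm_eq_ahForm hp hw0 (hx0 _ hx) ?_ u v
    rwa [hw2, inv_mul_le_iff₀ hR₁0, mul_one]
  -- The gluing set is `{r ≥ R₁}`, closed in `M` by assumption; inside it the bound on the scalar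
  -- curvature comes from the deformation.
  obtain ⟨g', hg1, hg2, hg3, hg4⟩ := exists_smoothMetric_eq_in_chart g e.φ_smooth
    (G := deformForm e.h c χ m w)
    (fun x hx => (contDiffAt_deformForm hh hp hw0 ((htgt x).1 hx)
      (hF _ (hsx x hx)).ne').contDiffWithinAt)
    (fun x hx => deformForm_symm hh ((htgt x).1 hx))
    (fun x hx u hu => deformForm_pos hh hp ((htgt x).1 hx) (hF _ (hsx x hx)) hu)
    (e.φ_closed R₁ hRR₁) (fun p hpK => hpK.1)
    (fun p hps hpK => hinner p hps (le_of_not_ge fun hle => hpK ⟨hps, hle⟩))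
  have hdiv : -((n : ℝ) * (n + 1)) / a = -((n : ℝ) * (n + 1)) * (1 + c * ε) := by
    rw [ha, div_div_eq_mul_div, div_one]
  refine ⟨a, ⟨by positivity, ?_⟩, g', fun p hpR => hg1 p fun hps => hinner p hps ?_, ?_, ?_⟩
  · rw [ha, div_lt_one (by linarith)]
    linarith
  · exact le_of_not_gt fun hlt => hpR ⟨hps, hlt⟩
  · intro x hx u v
    have hxR : e.R < ‖x‖ := hRR₁.trans_le (le_trans (by nlinarith) hx)
    have hxt := (htgt x).2 hxR
    rw [hg2 x hxt]
    refine deformForm_eq_gaForm hp hw0 (hx0 x hxt) ?_ u v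
    rw [hw2, ← div_eq_inv_mul, le_div_iff₀ hR₁0]
    exact hx
  · intro p
    rw [hdiv]
    by_cases hpK : p ∈ {p : M | p ∈ e.φ.source ∧ R₁ ≤ ‖e.φ p‖}
    · rw [hg3 p hpK.1]
      refine hS' _ ?_
      rw [hw2, ← div_eq_inv_mul, le_div_iff₀ hR₁0, one_mul]
      exact hpK.2
    · rw [hg4 p hpK]
      -- Off the gluing set the curvature is that of `g`, and `-n(n+1) ≥ -n(n+1) / a` because `a <
      -- 1`.
      refine le_trans ?_ (hS p)
      have : 0 ≤ (n : ℝ) * (n + 1) * (c * ε) := by positivity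
      linarith
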